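/- Let $X=\{0,1\}$ and let $\operatorname{Aut}(X^*)$ be the group of automorphisms of the binary rooted tree $X^*$ of finite words, acting on the right. Write $\langle g_0,g_1\rangle$ for the automorphism $0u\mapsto 0(u^{g_0})$, $1u\mapsto 1(u^{g_1})$, and let $\sigma$ be the automorphism that exchanges $0$ and $1$ in the first letter and fixes the rest of each word. Write $[g,h]=g^{-1}h^{-1}gh$, $g^h=h^{-1}gh$, $G'=[G,G]$, and $\langle S\rangle^{G}$ for the normal closure of $S$ in $G$. For $H\le\operatorname{Aut}(X^*)$ the geometric direct product is $H\times H=\{\langle h_0,h_1\rangle : h_0,h_1\in H\}\le\operatorname{Aut}(X^*)$. A group $G\le\operatorname{Aut}(X^*)$ is *regular weakly branch on* $H\le G$ if $H\neq1$ and $H\times H\le H$; it is *regular branch on* $H$ if moreover $H$ has finite index in $G$. It is *weakly branch* if it is transitive on every level $X^m$ and, for every $u\in X^*$, some non-trivial element of $G$ fixes all words that do not begin with $u$. Let $w=y_1\ldots y_k$ and $v=x_1\ldots x_n$ be words over $X$ with $k,n\ge1$ and $y_k\ne x_n$, and let $K=K(w,v)$ be the subgroup of $\operatorname{Aut}(X^*)$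 generated by the elements $b_1,\ldots,b_k,a_1,\ldots,a_n$ defined recursively by $$b_1=\sigma,\qquad b_{j+1}=\begin{cases}\langle b_j,1\rangle & y_j=0\\ \langle 1,b_j\rangle & y_j=1\end{cases}\ (1\le j<k),$$ $$a_1=\begin{cases}\langle b_k,a_n\rangle & y_k=0,\ x_n=1\\ \langle a_n,b_k\rangle & y_k=1,\ x_n=0\end{cases},\qquad a_{i+1}=\begin{cases}\langle a_i,1\rangle & x_i=0\\ \langle 1,a_i\rangle & x_i=1\end{cases}\ (1\le i<n).$$ **Theorem.** 1. If $k\ge2$ and $n\ge2$, or if $k\ge3$ and $n=1$, then $K$ is regular branch on $K'$; $K/K'\cong(\mathbb Z/2)^{k+n}$, generated by the images of the $a_i$ and $b_j$; and $K'/(K'\times K')\cong(\mathbb Z/2)^{k+n-1}$, generated by the images of $[b_1,b_j]$ $(2\le j\le k)$ and $[b_1,a_i]$ $(1\le i\le n)$. 2. If $k=2$ and $n=1$, put $x=[b_1,b_2a_1]$ and $L=\langle x\rangle^{K}$. Then $K$ is regular branch on $L$; $L\le K'$ and $K'/L\cong(\mathbb Z/2)^2$, generated by the images of $[b_1,b_2]$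 and $[b_2,a_1]$; and $L/(L\times L)\cong\mathbb Z/4\times\mathbb Z/2$, generated by the images of $x$ and $x^{a_1}$, which satisfy $x^4=(x^{a_1})^4=x^2(x^2)^{a_1}=1$ in this quotient. 3. If $k=1$ and $n\ge2$, put $L=\big\langle [a_i,a_j]\ (1\le i<j\le n),\ [a_i,b_1]\ (1\le i<n)\big\rangle^{K}$. Then $K$ is regular branch on $L$; $L\le K'$ and $K'/L\cong\mathbb Z/2$, generated by the image of $[a_n,b_1]$; and $L/(L\times L)\cong\mathbb Z/4\times(\mathbb Z/2)^{n-2}$, generated by the images of $[a_i,b_1]$ $(1\le i<n)$, where $[a_1,b_1]$ has order $4$ and $[a_i,b_1]$ has order $2$ for $2\le i<n$. 4. If $k=n=1$, then $K$ is infinite dihedral, and it is not weakly branch, nor regular weakly branch on any subgroup. -/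

import Mathlib

namespace Kneading

/-- Automorphisms of the binary rooted tree `X^*`, `X = {0, 1}` (`false = 0`, `true = 1`).
The vertices are the finite words and the edges join `u` to `ux`: an automorphism is a bijection
of the words that preserves levels and the prefix relation. -/
@[ext]
structure TreeAut where
  toEquiv : List Bool ≃ List Bool
  length_eq : ∀ u, (toEquiv u).length = u.length
  prefix_iff : ∀ u u', toEquiv u <+: toEquiv u' ↔ u <+: u'

namespace TreeAut

instance : CoeFun TreeAut (fun _ => List Bool → List Bool) := ⟨fun g => g.toEquiv⟩

/-- Automorphisms act on the right: in the product `g * h`, first `g` acts, and then `h`. -/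
instance : Mul TreeAut where
  mul g h :=
    { toEquiv := g.toEquiv.trans h.toEquiv
      length_eq := fun u => by simp [h.length_eq, g.length_eq]
      prefix_iff := fun u u' => by simp [h.prefix_iff, g.prefix_iff] }

instance : One TreeAut where
  one := { toEquiv := Equiv.refl _, length_eq := fun _ => rfl, prefix_iff := fun _ _ => Iff.rfl }

instance : Inv TreeAut where
  inv g :=
    { toEquiv := g.toEquiv.symm
      length_eq := fun u => by
        simpa using (g.length_eq (g.toEquiv.symm u)).symm
      prefix_iff := fun u u' => by
        simpa using (g.prefix_iff (g.toEquiv.symm u) (g.toEquiv.symm u')).symm }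

instance : Group TreeAut where
  mul_assoc _ _ _ := TreeAut.ext (Equiv.ext fun _ => rfl)
  one_mul _ := TreeAut.ext (Equiv.ext fun _ => rfl)
  mul_one _ := TreeAut.ext (Equiv.ext fun _ => rfl)
  inv_mul_cancel g := TreeAut.ext (Equiv.ext fun u => g.toEquiv.apply_symm_apply u)

/-- The action of `⟨g₀, g₁⟩` on words: `0u ↦ 0(u^{g₀})`, `1u ↦ 1(u^{g₁})`. -/
def pairFun (f₀ f₁ : List Bool → List Bool) : List Bool → List Bool
  | [] => []
  | false :: u => false :: f₀ u
  | true :: u => true :: f₁ u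

/-- The automorphism `⟨g₀, g₁⟩`, acting as `g₀` on the subtree `0X^*` and as `g₁` on `1X^*`. -/
def pair (g₀ g₁ : TreeAut) : TreeAut where
  toEquiv :=
    { toFun := pairFun g₀ g₁
      invFun := pairFun g₀.toEquiv.symm g₁.toEquiv.symm
      left_inv := by rintro (_ | ⟨_ | _, u⟩) <;> simp [pairFun]
      right_inv := by rintro (_ | ⟨_ | _, u⟩) <;> simp [pairFun] }
  length_eq := by
    rintro (_ | ⟨_ | _, u⟩) <;> simp [pairFun, g₀.length_eq, g₁.length_eq]
  prefix_iff := by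
    rintro (_ | ⟨_ | _, u⟩) (_ | ⟨_ | _, u'⟩) <;>
      simp [pairFun, List.cons_prefix_cons, g₀.prefix_iff, g₁.prefix_iff]

/-- `(g₀, g₁) ↦ ⟨g₀, g₁⟩` as a group homomorphism. -/
def pairHom : TreeAut × TreeAut →* TreeAut where
  toFun p := pair p.1 p.2
  map_one' := TreeAut.ext (Equiv.ext (by rintro (_ | ⟨_ | _, u⟩) <;> rfl))
  map_mul' p q := TreeAut.ext (Equiv.ext (by rintro (_ | ⟨_ | _, u⟩) <;> rfl))

end TreeAut

/-- The geometric direct product `H × H`: the group of all `⟨h₀, h₁⟩` with `h₀, h₁ ∈ H`. -/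
def geomSquare (H : Subgroup TreeAut) : Subgroup TreeAut :=
  (H.prod H).map TreeAut.pairHom

/-- `G` is regular weakly branch on `H ≤ G`. -/
structure IsRegularWeaklyBranchOn (G H : Subgroup TreeAut) : Prop where
  le : H ≤ G
  ne_bot : H ≠ ⊥
  geomSquare_le : geomSquare H ≤ H

/-- `G` is regular branch on `H ≤ G`. -/
structure IsRegularBranchOn (G H : Subgroup TreeAut) : Prop
    extends IsRegularWeaklyBranchOn G H where
  finiteIndex : (H.subgroupOf G).FiniteIndex

/-- `G` is weakly branch: it is transitive on every level of the tree, and for every vertex `u`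
some nontrivial element of `G` fixes all vertices outside the subtree `uX^*`. -/
def IsWeaklyBranch (G : Subgroup TreeAut) : Prop :=
  (∀ u u' : List Bool, u.length = u'.length → ∃ g ∈ G, g u = u') ∧
    ∀ u : List Bool, ∃ g ∈ G, g ≠ 1 ∧ ∀ u' : List Bool, ¬ u <+: u' → g u' = u'

/-! The automaton of the group `K(w, v)`, for `w = y₁…y_k` and `v = x₁…x_n`. -/

/-- The states: `b j` stands for `b_j` (`1 ≤ j ≤ k`), `a i` for `a_i` (`1 ≤ i ≤ n`), and `one` for
the identity. -/
inductive State where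
  | one : State
  | b (j : ℕ) : State
  | a (i : ℕ) : State

/-- The output letter of a state that reads `x`: the only active state is `b₁ = σ`. -/
def out : State → Bool → Bool
  | State.b 1, x => !x
  | _, x => x

/-- The state reached from a state that reads `x`. Here `y_{j+1}` is `w[j]` and `x_{i+1}` is `v[i]`.
* `b₁ = σ`;
* `b_{j+1}` has `b_j` as its restriction to the letter `y_j`, and `1` to the other letter;
* `a₁` has `b_k` as its restriction to the letter `y_k`, and `a_n` to the other letter
  (which is `x_n` when `x_n ≠ y_k`);
* `a_{i+1}` has `a_i` as its restriction to the letter `x_i`, and `1` to the other letter. -/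
def next (w v : List Bool) : State → Bool → State
  | State.one, _ => State.one
  | State.b 0, _ => State.one
  | State.b 1, _ => State.one
  | State.b (j + 2), x => if w[j]? = some x then State.b (j + 1) else State.one
  | State.a 0, _ => State.one
  | State.a 1, x => if w.getLast? = some x then State.b w.length else State.a v.length
  | State.a (i + 2), x => if v[i]? = some x then State.a (i + 1) else State.one

/-- The transformation of words defined by a state of the automaton. -/
def act (w v : List Bool) : State → List Bool → List Bool
  | _, [] => []
  | q, x :: u => out q x :: act w v (next w v q x) u

theorem out_out (q : State) (x : Bool) : out q (out q x) = x := by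
  rcases q with _ | (_ | _ | j) | i <;> simp [out]

theorem next_out (w v : List Bool) (q : State) (x : Bool) :
    next w v q (out q x) = next w v q x := by
  rcases q with _ | (_ | _ | j) | i <;> simp [out, next]

theorem act_act (w v : List Bool) (u : List Bool) :
    ∀ q, act w v q (act w v q u) = u := by
  induction u with
  | nil => intro q; simp [act]
  | cons x u ih => intro q; simp [act, out_out, next_out, ih]

theorem length_act (w v : List Bool) (u : List Bool) :
    ∀ q, (act w v q u).length = u.length := by
  induction u with
  | nil => intro q; simp [act]
  | cons x u ih => intro q; simp [act, ih]

theorem act_prefix (w v : List Bool) (u : List Bool) :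
    ∀ (q : State) (u' : List Bool), u <+: u' → act w v q u <+: act w v q u' := by
  induction u with
  | nil => intro q u' _; simp [act]
  | cons x u ih =>
    intro q u' h
    rcases u' with _ | ⟨x', u'⟩
    · simp at h
    · rw [List.cons_prefix_cons] at h
      obtain ⟨rfl, h⟩ := h
      simp only [act, List.cons_prefix_cons]
      exact ⟨trivial, ih _ _ h⟩

/-- The automorphism of the tree defined by a state of the automaton. -/
def stateAut (w v : List Bool) (q : State) : TreeAut where
  toEquiv := Function.Involutive.toPerm (act w v q) (fun u => act_act w v u q)
  length_eq u := length_act w v u q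
  prefix_iff u u' :=
    ⟨fun h => by
      have h2 := act_prefix w v (act w v q u) q (act w v q u') h
      rwa [act_act, act_act] at h2, act_prefix w v u q u'⟩

/-- The generator `b_j` of `K(w, v)`, for `1 ≤ j ≤ |w|`. -/
def genB (w v : List Bool) (j : ℕ) : TreeAut := stateAut w v (State.b j)

/-- The generator `a_i` of `K(w, v)`, for `1 ≤ i ≤ |v|`. -/
def genA (w v : List Bool) (i : ℕ) : TreeAut := stateAut w v (State.a i)

/-- The group `K(w, v)`, generated by `b_1, …, b_k, a_1, …, a_n`. -/
def kneadingGroup (w v : List Bool) : Subgroup TreeAut :=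
  Subgroup.closure
    ({g | ∃ j, 1 ≤ j ∧ j ≤ w.length ∧ g = genB w v j} ∪
      {g | ∃ i, 1 ≤ i ∧ i ≤ v.length ∧ g = genA w v i})

/-! Generalities on groups. -/

/-- The commutator `[g, h] = g⁻¹h⁻¹gh`. -/
def rcomm {G : Type*} [Group G] (g h : G) : G := g⁻¹ * h⁻¹ * g * h

/-- The conjugate `g^h = h⁻¹gh`. -/
def rconj {G : Type*} [Group G] (g h : G) : G := h⁻¹ * g * h

/-- `⟨S⟩^K`, the subgroup generated by the conjugates of the elements of `S` by those of `K`. -/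
def normalClosureIn {G : Type*} [Group G] (K : Subgroup G) (S : Set G) : Subgroup G :=
  Subgroup.closure {y | ∃ s ∈ S, ∃ g ∈ K, y = rconj s g}

/-- `N` is a normal subgroup of `H`, and `H / N ≅ A`. -/
def QuotientIso {G : Type*} [Group G] (H N : Subgroup G) (A : Type*) [Group A] : Prop :=
  N ≤ H ∧ ∃ _ : (N.subgroupOf H).Normal, Nonempty ((H ⧸ N.subgroupOf H) ≃* A)

/-- `S` is a subset of `H` whose image generates `H / N` (for `N` a normal subgroup of `H`). -/
def GeneratesQuotient {G : Type*} [Group G] (H N : Subgroup G) (S : Set G) : Prop :=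
  S ⊆ H ∧ Subgroup.closure S ⊔ N = H

/-- The order of `g` modulo `N` is exactly `d`. -/
def HasOrderMod {G : Type*} [Group G] (N : Subgroup G) (g : G) (d : ℕ) : Prop :=
  ∀ m : ℕ, g ^ m ∈ N ↔ d ∣ m

/-- For `k = 2`, `n = 1`: the element `x = [b₁, b₂a₁]`. -/
def elemX (w v : List Bool) : TreeAut :=
  rcomm (genB w v 1) (genB w v 2 * genA w v 1)

/-- For `k = 2`, `n = 1`: the subgroup `L = ⟨x⟩^{K(w,v)}`. -/
def subgroupL₂₁ (w v : List Bool) : Subgroup TreeAut :=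
  normalClosureIn (kneadingGroup w v) {elemX w v}

/-- For `k = 1`, `n ≥ 2`: the subgroup
`L = ⟨[a_i, a_j] (1 ≤ i < j ≤ n), [a_i, b₁] (1 ≤ i < n)⟩^{K(w,v)}`. -/
def subgroupL₁ (w v : List Bool) : Subgroup TreeAut :=
  normalClosureIn (kneadingGroup w v)
    ({g | ∃ i j, 1 ≤ i ∧ i < j ∧ j ≤ v.length ∧ g = rcomm (genA w v i) (genA w v j)} ∪
      {g | ∃ i, 1 ≤ i ∧ i < v.length ∧ g = rcomm (genA w v i) (genB w v 1)})

end Kneading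

open Kneading

/-! Number the generators `b_1, …, b_k, a_1, …, a_n` from `0` as `gen m`. Each `gen (m + 1)` is `gen
m` placed on one first-level subtree, except `a_1`, whose sections are `b_k` and `a_n`. Hence the
level parities `sgn l`, `l < k + n`, are homomorphisms to `ℤ/2` dual to the generating involutions
(`sgn_gen`). They identify `K/K'` with `(ℤ/2)^(k+n)` and detect `K'` (`mem_commutator_iff`).

The two sections of an element of `K` are linked: `b_k` and `a_n` arise as sections only from `a_1`,
on opposite sides, so the `b_k`-parity of one section equals the `a_n`-parity of the other
(`sgn_sec_eq_sgn_sec_not`). For `g ∈ K'` the two sections also have equal parities on every level.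
So `k + n - 1` parities of one section decide whether both sections lie in `K'`
(`sec_mem_commutator`), and the commutators with `b_1` realize all values.

For branching one needs `H × H ≤ H`. As `K` is self-replicating, copying a normal closure onto a
subtree needs a check only on its normal generators (`inj_mem_of_mem_normalClosureIn`). Every
generator except `b_k` and `a_n` has a copy on a subtree that is again a generator, so the normal
closure `smallClosure` of those generators can be copied into `K`. In the generic case `b_k` and
`a_n` commute modulo `smallClosure`, so `K' ≤ smallClosure`.

In the two exceptional branch cases `K'` is replaced by `L`, cut out of `K'` by functions `q` with
`q (xy) = q x + q y + f₁ x * f₂ y` (`IsHeisenberg`). They are additive on `K'`, and on a commutator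
they take the value of the alternating form of `f₁` and `f₂`, so they see selected commutators of
generators (`mem_subgroupL₁_iff`, `mem_subgroupL₂₁_iff`). A section of an element of `K'` has equal
`b_k`- and `a_n`-parity; there the cocycle `f₁ * f₂` is the carry of addition in `ℤ/4`, and this is
the source of the factor `ℤ/4` in `L/(L × L)` (`liftFour_add`).

If `k = n = 1`, the square of `r = b_1 a_1` has sections `r` and `r⁻¹`, so `r` has infinite order,
and an element fixing the first level with one trivial section is trivial (`eq_one_of_sec_eq_one`).
This excludes every kind of branching. -/

namespace Kneading

/-! ### Sections, copies on a subtree, and level parities -/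

namespace TreeAut

theorem apply_nil (g : TreeAut) : g.toEquiv [] = [] :=
  List.length_eq_zero_iff.mp (g.length_eq [])

theorem mul_apply (g h : TreeAut) (u : List Bool) :
    (g * h).toEquiv u = h.toEquiv (g.toEquiv u) := rfl

theorem inv_apply_self (g : TreeAut) (u : List Bool) : g⁻¹.toEquiv (g.toEquiv u) = u :=
  g.toEquiv.symm_apply_apply u

theorem apply_inv_self (g : TreeAut) (u : List Bool) : g.toEquiv (g⁻¹.toEquiv u) = u :=
  g.toEquiv.apply_symm_apply u

/-- The permutation of the letters induced on the first level. -/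
def letterMap (g : TreeAut) (x : Bool) : Bool := (g.toEquiv [x]).headD false

theorem apply_singleton (g : TreeAut) (x : Bool) : g.toEquiv [x] = [letterMap g x] := by
  have h := g.length_eq [x]
  obtain ⟨y, hy⟩ := List.length_eq_one_iff.mp h
  simp [letterMap, hy]

theorem apply_cons_tail (g : TreeAut) (x : Bool) (u : List Bool) :
    g.toEquiv (x :: u) = letterMap g x :: (g.toEquiv (x :: u)).tail := by
  have h : g.toEquiv [x] <+: g.toEquiv (x :: u) := by
    rw [g.prefix_iff]; simp [List.cons_prefix_cons]
  rw [apply_singleton] at h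
  obtain ⟨t, ht⟩ := h
  rw [← ht]; simp

theorem letterMap_inv_letterMap (g : TreeAut) (x : Bool) :
    letterMap g⁻¹ (letterMap g x) = x := by
  have h := inv_apply_self g [x]
  rw [apply_singleton, apply_singleton] at h
  simpa using h

/-- The section (restriction) of an automorphism at a letter. -/
def sec (g : TreeAut) (x : Bool) : TreeAut where
  toEquiv :=
    { toFun := fun u => (g.toEquiv (x :: u)).tail
      invFun := fun u => (g⁻¹.toEquiv (letterMap g x :: u)).tail
      left_inv := fun u => by
        dsimp only
        rw [← apply_cons_tail, inv_apply_self, List.tail_cons]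
      right_inv := fun u => by
        dsimp only
        have h := apply_cons_tail g⁻¹ (letterMap g x) u
        rw [letterMap_inv_letterMap] at h
        rw [← h, apply_inv_self, List.tail_cons] }
  length_eq u := by simp [g.length_eq]
  prefix_iff u u' := by
    have h := g.prefix_iff (x :: u) (x :: u')
    rw [apply_cons_tail g x u, apply_cons_tail g x u'] at h
    simpa [List.cons_prefix_cons] using h

/-- Whether an automorphism exchanges the two letters on the first level. -/
def flips (g : TreeAut) : Bool := letterMap g false

theorem letterMap_eq (g : TreeAut) (x : Bool) : letterMap g x = (x ^^ flips g) := by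
  have h0 := letterMap_inv_letterMap g false
  have h1 := letterMap_inv_letterMap g true
  cases x
  · simp [flips]
  · unfold flips
    cases h : letterMap g false <;> cases h' : letterMap g true <;> simp_all

theorem apply_cons (g : TreeAut) (x : Bool) (u : List Bool) :
    g.toEquiv (x :: u) = (x ^^ flips g) :: (sec g x).toEquiv u := by
  rw [apply_cons_tail, letterMap_eq]; rfl

theorem ext_sec {g h : TreeAut} (hf : flips g = flips h) (h0 : sec g false = sec h false)
    (h1 : sec g true = sec h true) : g = h := by
  refine TreeAut.ext (Equiv.ext fun u => ?_)
  rcases u with _ | ⟨_ | _, u⟩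
  · rw [apply_nil, apply_nil]
  · rw [apply_cons, apply_cons, hf, h0]
  · rw [apply_cons, apply_cons, hf, h1]

theorem eq_of_apply_cons {g s : TreeAut} {x y : Bool}
    (h : ∀ u, g.toEquiv (x :: u) = y :: s.toEquiv u) : sec g x = s := by
  refine TreeAut.ext (Equiv.ext fun u => ?_)
  have := h u
  rw [apply_cons] at this
  exact (List.cons.inj this).2

theorem flips_of_apply {g : TreeAut} {y : Bool} (h : g.toEquiv [false] = [y]) : flips g = y := by
  rw [apply_cons] at h
  simpa using (List.cons.inj h).1

@[simp] theorem flips_one : flips 1 = false := rfl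

@[simp] theorem sec_one (x : Bool) : sec 1 x = 1 := rfl

@[simp] theorem flips_mul (g h : TreeAut) : flips (g * h) = (flips g ^^ flips h) := by
  refine flips_of_apply ?_
  rw [mul_apply, apply_cons, apply_cons]
  simp [apply_nil]

@[simp] theorem sec_mul (g h : TreeAut) (x : Bool) :
    sec (g * h) x = sec g x * sec h (x ^^ flips g) :=
  eq_of_apply_cons (y := (x ^^ flips g ^^ flips h)) fun u => by
    rw [mul_apply, mul_apply, apply_cons, apply_cons]

@[simp] theorem flips_inv (g : TreeAut) : flips g⁻¹ = flips g := by
  have h := flips_mul g⁻¹ g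
  rw [inv_mul_cancel, flips_one] at h
  revert h
  cases flips g⁻¹ <;> cases flips g <;> simp

@[simp] theorem sec_inv (g : TreeAut) (x : Bool) : sec g⁻¹ x = (sec g (x ^^ flips g))⁻¹ := by
  have h := sec_mul g⁻¹ g x
  rw [inv_mul_cancel, sec_one, flips_inv] at h
  exact eq_inv_of_mul_eq_one_left h.symm

@[simp] theorem flips_pair (g h : TreeAut) : flips (pair g h) = false := rfl

@[simp] theorem sec_pair_false (g h : TreeAut) : sec (pair g h) false = g :=
  eq_of_apply_cons (y := false) fun _ => rfl

@[simp] theorem sec_pair_true (g h : TreeAut) : sec (pair g h) true = h :=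
  eq_of_apply_cons (y := true) fun _ => rfl

theorem pair_sec {g : TreeAut} (h : flips g = false) : pair (sec g false) (sec g true) = g :=
  ext_sec (by simp [h]) (by simp) (by simp)

/-- The automorphism acting as `g` on the subtree `xX^*` and trivially elsewhere. -/
def inj (x : Bool) (g : TreeAut) : TreeAut := if x then pair 1 g else pair g 1

@[simp] theorem flips_inj (x : Bool) (g : TreeAut) : flips (inj x g) = false := by
  cases x <;> simp [inj]

theorem sec_inj (x y : Bool) (g : TreeAut) : sec (inj x g) y = if x = y then g else 1 := by
  cases x <;> cases y <;> simp [inj]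

@[simp] theorem sec_inj_self (x : Bool) (g : TreeAut) : sec (inj x g) x = g := by
  simp [sec_inj]

@[simp] theorem sec_inj_not (x : Bool) (g : TreeAut) : sec (inj x g) (!x) = 1 := by
  simp [sec_inj]

/-- Extensionality based at the letter whose section is known, so that no case split on that letter
is needed. -/
theorem ext_letter (x : Bool) {g h : TreeAut} (hf : flips g = flips h) (h0 : sec g x = sec h x)
    (h1 : sec g (!x) = sec h (!x)) : g = h := by
  cases x
  · exact ext_sec hf h0 h1
  · exact ext_sec hf h1 h0

@[simp] theorem inj_one (x : Bool) : inj x 1 = 1 :=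
  ext_letter x (by simp) (by simp) (by simp)

theorem inj_mul (x : Bool) (g h : TreeAut) : inj x (g * h) = inj x g * inj x h :=
  ext_letter x (by simp) (by simp) (by simp)

theorem inj_inv (x : Bool) (g : TreeAut) : inj x g⁻¹ = (inj x g)⁻¹ :=
  ext_letter x (by simp) (by simp) (by simp)

theorem inj_commute {x y : Bool} (hxy : x ≠ y) (g h : TreeAut) :
    inj x g * inj y h = inj y h * inj x g := by
  obtain rfl : y = !x := by cases x <;> cases y <;> simp_all
  refine ext_letter x (by simp) (by simp [sec_inj]) (by simp [sec_inj])

theorem pair_eq_inj (g h : TreeAut) : pair g h = inj false g * inj true h :=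
  ext_sec (by simp) (by simp [sec_inj]) (by simp [sec_inj])

/-- If `h` fixes the letters, then conjugation by `h` acts on the subtree at `x` as conjugation
by its section. -/
theorem rconj_inj {h : TreeAut} (hh : flips h = false) (x : Bool) (g : TreeAut) :
    rconj (inj x g) h = inj x (rconj g (sec h x)) := by
  refine ext_letter x (by simp [rconj, hh]) (by simp [rconj, hh]) (by simp [rconj, hh])

/-- The parity of the number of active vertices on a level. -/
def sgn : ℕ → TreeAut → ZMod 2
  | 0, g => if flips g then 1 else 0
  | m + 1, g => sgn m (sec g false) + sgn m (sec g true)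

theorem sgn_succ (m : ℕ) (g : TreeAut) :
    sgn (m + 1) g = sgn m (sec g false) + sgn m (sec g true) := rfl

-- If `g` is active, it only exchanges the two sections of `h`, and their sum does not change.
@[simp] theorem sgn_mul (m : ℕ) (g h : TreeAut) : sgn m (g * h) = sgn m g + sgn m h := by
  induction m generalizing g h with
  | zero =>
    simp only [sgn, flips_mul]
    cases flips g <;> cases flips h <;> decide
  | succ m ih =>
    simp only [sgn, sec_mul, ih]
    cases flips g <;> simp <;> ring

@[simp] theorem sgn_one (m : ℕ) : sgn m 1 = 0 := by
  have h := sgn_mul m 1 1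
  rw [mul_one] at h
  simpa using h

@[simp] theorem sgn_inv (m : ℕ) (g : TreeAut) : sgn m g⁻¹ = sgn m g := by
  have h := sgn_mul m g⁻¹ g
  rw [inv_mul_cancel, sgn_one] at h
  rw [← CharTwo.add_eq_zero, ← h]

theorem sgn_zero_eq_zero {g : TreeAut} : sgn 0 g = 0 ↔ flips g = false := by
  unfold sgn; cases flips g <;> simp

theorem sgn_inj (m : ℕ) (x : Bool) (g : TreeAut) : sgn (m + 1) (inj x g) = sgn m g := by
  cases x <;> simp [sgn, sec_inj]

@[simp] theorem sgn_rconj (m : ℕ) (g h : TreeAut) : sgn m (rconj g h) = sgn m g := by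
  simp only [rconj, sgn_mul, sgn_inv]
  generalize sgn m g = a
  generalize sgn m h = b
  revert a b; decide

end TreeAut

open TreeAut

theorem mem_geomSquare {H : Subgroup TreeAut} {g : TreeAut} :
    g ∈ geomSquare H ↔ flips g = false ∧ sec g false ∈ H ∧ sec g true ∈ H := by
  constructor
  · rintro ⟨⟨a, b⟩, ⟨ha, hb⟩, rfl⟩
    exact ⟨flips_pair a b, by simpa [pairHom] using ha, by simpa [pairHom] using hb⟩
  · rintro ⟨hf, h0, h1⟩
    exact ⟨(sec g false, sec g true), ⟨h0, h1⟩, pair_sec hf⟩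

/-! Sections of the generators. -/

section generators
variable (w v : List Bool)

theorem flips_stateAut (q : State) : flips (stateAut w v q) = out q false :=
  flips_of_apply rfl

theorem sec_stateAut (q : State) (x : Bool) :
    sec (stateAut w v q) x = stateAut w v (next w v q x) :=
  eq_of_apply_cons (y := out q x) fun _ => rfl

theorem stateAut_one : stateAut w v State.one = 1 := by
  refine TreeAut.ext (Equiv.ext fun u => ?_)
  change act w v State.one u = u
  induction u with
  | nil => rfl
  | cons x u ih => simp [act, out, next, ih]

theorem stateAut_mul_self (q : State) : stateAut w v q * stateAut w v q = 1 :=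
  TreeAut.ext (Equiv.ext fun u => act_act w v u q)

@[simp] theorem flips_genB_one : flips (genB w v 1) = true := flips_stateAut ..

@[simp] theorem sec_genB_one (x : Bool) : sec (genB w v 1) x = 1 :=
  (sec_stateAut ..).trans (stateAut_one w v)

@[simp] theorem flips_genA (i : ℕ) : flips (genA w v i) = false := flips_stateAut ..

@[simp] theorem genB_mul_self (j : ℕ) : genB w v j * genB w v j = 1 := stateAut_mul_self ..

@[simp] theorem genA_mul_self (i : ℕ) : genA w v i * genA w v i = 1 := stateAut_mul_self ..

theorem genB_add_two (j : ℕ) (h : j < w.length) :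
    genB w v (j + 2) = inj w[j] (genB w v (j + 1)) := by
  refine ext_letter w[j] ?_ ?_ ?_
  · simp [genB, flips_stateAut, out]
  · simp [genB, sec_stateAut, next, h]
  · simp [genB, sec_stateAut, next, h, stateAut_one]

theorem genA_add_two (i : ℕ) (h : i < v.length) :
    genA w v (i + 2) = inj v[i] (genA w v (i + 1)) := by
  refine ext_letter v[i] ?_ ?_ ?_
  · simp [genA, flips_stateAut, out]
  · simp [genA, sec_stateAut, next, h]
  · simp [genA, sec_stateAut, next, h, stateAut_one]

theorem sec_genA_one_last (hw : w ≠ []) :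
    sec (genA w v 1) (w.getLast hw) = genB w v w.length := by
  simp [genA, genB, sec_stateAut, next, List.getLast?_eq_getLast_of_ne_nil hw]

theorem sec_genA_one_not_last (hw : w ≠ []) :
    sec (genA w v 1) (!w.getLast hw) = genA w v v.length := by
  simp [genA, sec_stateAut, next, List.getLast?_eq_getLast_of_ne_nil hw]

theorem rconj_genB_one_inj (x : Bool) (g : TreeAut) :
    rconj (inj x g) (genB w v 1) = inj (!x) g := by
  refine ext_letter x (by simp [rconj]) ?_ ?_ <;> simp [rconj, sec_inj]

end generators

/-! ### Conjugation-invariant subgroups and calculation modulo them -/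

section groups
variable {G : Type*} [Group G]

theorem rconj_mul (a b h : G) : rconj (a * b) h = rconj a h * rconj b h := by
  simp [rconj, mul_assoc]

@[simp] theorem rconj_one (h : G) : rconj 1 h = 1 := by simp [rconj]

theorem rconj_inv (a h : G) : rconj a⁻¹ h = (rconj a h)⁻¹ := by
  simp [rconj, mul_assoc]

@[simp] theorem rconj_one_right (a : G) : rconj a 1 = a := by simp [rconj]

theorem rconj_rconj (a g h : G) : rconj (rconj a g) h = rconj a (g * h) := by
  simp [rconj, mul_assoc]

theorem rcomm_eq (g h : G) : rcomm g h = g⁻¹ * rconj g h := by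
  simp [rcomm, rconj, mul_assoc]

theorem rcomm_inv (g h : G) : (rcomm g h)⁻¹ = rcomm h g := by
  simp [rcomm, mul_assoc]

theorem rcomm_eq_one_iff {g h : G} : rcomm g h = 1 ↔ g * h = h * g := by
  rw [rcomm, mul_assoc, ← mul_inv_rev, inv_mul_eq_one, eq_comm]

theorem map_rcomm {G' : Type*} [Group G'] (f : G →* G') (g h : G) :
    f (rcomm g h) = rcomm (f g) (f h) := by
  simp [rcomm]

theorem map_rconj {G' : Type*} [Group G'] (f : G →* G') (g h : G) :
    f (rconj g h) = rconj (f g) (f h) := by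
  simp [rconj]

theorem rcomm_mem {K : Subgroup G} {g h : G} (hg : g ∈ K) (hh : h ∈ K) : rcomm g h ∈ K :=
  mul_mem (mul_mem (mul_mem (inv_mem hg) (inv_mem hh)) hg) hh

theorem rconj_mem {K : Subgroup G} {g h : G} (hg : g ∈ K) (hh : h ∈ K) : rconj g h ∈ K :=
  mul_mem (mul_mem (inv_mem hh) hg) hh

theorem rcomm_mem_commutator {K : Subgroup G} {g h : G} (hg : g ∈ K) (hh : h ∈ K) :
    rcomm g h ∈ ⁅K, K⁆ := by
  have := Subgroup.commutator_mem_commutator (inv_mem hg) (inv_mem hh)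
  simpa [rcomm, commutatorElement_def] using this

/-- The subgroup `M` is invariant under conjugation by the elements of `K`. -/
def ConjInvariant (K M : Subgroup G) : Prop := ∀ m ∈ M, ∀ h ∈ K, rconj m h ∈ M

theorem ConjInvariant.rcomm_mem {K M : Subgroup G} (hM : ConjInvariant K M) {m h : G}
    (hm : m ∈ M) (hh : h ∈ K) : rcomm m h ∈ M := by
  rw [rcomm_eq]
  exact mul_mem (inv_mem hm) (hM m hm h hh)

theorem ConjInvariant.rcomm_mem' {K M : Subgroup G} (hM : ConjInvariant K M) {m h : G}
    (hm : m ∈ M) (hh : h ∈ K) : rcomm h m ∈ M := by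
  rw [← rcomm_inv]
  exact inv_mem (hM.rcomm_mem hm hh)

theorem ConjInvariant.mono {K K' M : Subgroup G} (hM : ConjInvariant K M) (h : K' ≤ K) :
    ConjInvariant K' M := fun m hm g hg => hM m hm g (h hg)

theorem conjInvariant_self (K : Subgroup G) : ConjInvariant K K :=
  fun _ hm _ hh => rconj_mem hm hh

theorem conjInvariant_commutator (K : Subgroup G) : ConjInvariant K ⁅K, K⁆ := by
  intro m hm h hh
  have : rconj m h = m * rcomm m h := by simp [rconj, rcomm, mul_assoc]
  rw [this]
  exact mul_mem hm (rcomm_mem_commutator (Subgroup.commutator_le_self K hm) hh)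

/-- Since the generators are involutions, their inverses need no separate check. -/
theorem conjInvariant_of_generators {T : Set G} (hT : ∀ t ∈ T, t * t = 1) {M : Subgroup G}
    (h : ∀ m ∈ M, ∀ t ∈ T, rconj m t ∈ M) : ConjInvariant (Subgroup.closure T) M := by
  intro m hm g hg
  induction hg using Subgroup.closure_induction_left generalizing m with
  | one => simpa
  | mul_left x hx y hy ih => rw [← rconj_rconj]; exact ih _ (h m hm x hx)
  | inv_mul_cancel x hx y hy ih =>
    rw [← rconj_rconj, inv_eq_of_mul_eq_one_left (hT x hx)]; exact ih _ (h m hm x hx)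

theorem conjInvariant_closure_sup {T : Set G} (hT : ∀ t ∈ T, t * t = 1) {S : Set G}
    {N : Subgroup G} (hN : ConjInvariant (Subgroup.closure T) N)
    (h : ∀ s ∈ S, ∀ t ∈ T, rconj s t ∈ Subgroup.closure S ⊔ N) :
    ConjInvariant (Subgroup.closure T) (Subgroup.closure S ⊔ N) := by
  refine conjInvariant_of_generators hT fun m hm t ht => ?_
  have key : Subgroup.closure S ⊔ N ≤
      (Subgroup.closure S ⊔ N).comap (MulAut.conj t⁻¹).toMonoidHom := by
    refine sup_le ((Subgroup.closure_le _).2 fun s hs => ?_) fun s hs => ?_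
    · simpa [rconj] using h s hs t ht
    · have := hN s hs t (Subgroup.subset_closure ht)
      simpa [rconj] using (Subgroup.mem_sup_right this : _ ∈ Subgroup.closure S ⊔ N)
  simpa [rconj] using key hm

theorem mem_normalClosureIn {K : Subgroup G} {S : Set G} {s : G} (hs : s ∈ S) :
    s ∈ normalClosureIn K S :=
  Subgroup.subset_closure ⟨s, hs, 1, one_mem K, by simp⟩

theorem conjInvariant_normalClosureIn (K : Subgroup G) (S : Set G) :
    ConjInvariant K (normalClosureIn K S) := by
  intro m hm h hh
  have key : normalClosureIn K S ≤
      (normalClosureIn K S).comap (MulAut.conj h⁻¹).toMonoidHom := by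
    refine (Subgroup.closure_le _).2 ?_
    rintro _ ⟨s, hs, g, hg, rfl⟩
    refine Subgroup.subset_closure ⟨s, hs, g * h, mul_mem hg hh, ?_⟩
    simp [rconj, mul_assoc]
  simpa [rconj] using key hm

theorem normalClosureIn_le {K M : Subgroup G} {S : Set G} (hM : ConjInvariant K M)
    (hS : ∀ s ∈ S, s ∈ M) : normalClosureIn K S ≤ M := by
  refine (Subgroup.closure_le _).2 ?_
  rintro _ ⟨s, hs, g, hg, rfl⟩
  exact hM s (hS s hs) g hg

theorem ConjInvariant.normal_subgroupOf {K M : Subgroup G} (hM : ConjInvariant K M) :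
    (M.subgroupOf K).Normal := by
  refine ⟨fun m hm g => ?_⟩
  have := hM m hm (g⁻¹ : K) (g⁻¹ : K).2
  simpa [Subgroup.mem_subgroupOf, rconj] using this

/-- The quotient of `K` by `M ∩ K`, as a homomorphism. -/
theorem ConjInvariant.exists_quotient {G : Type} [Group G] {K M : Subgroup G}
    (hM : ConjInvariant K M) :
    ∃ (Q : Type) (_ : Group Q) (π : K →* Q), ∀ g : K, π g = 1 ↔ (g : G) ∈ M := by
  have := hM.normal_subgroupOf
  exact ⟨K ⧸ M.subgroupOf K, inferInstance, QuotientGroup.mk' _, fun g => by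
    rw [QuotientGroup.mk'_apply, QuotientGroup.eq_one_iff, Subgroup.mem_subgroupOf]⟩

/-- In the quotient by `M` the generators commute pairwise; commutation extends to products and
inverses in each argument in turn. -/
theorem commutator_closure_le {G : Type} [Group G] {T : Set G} {M : Subgroup G}
    (hM : ConjInvariant (Subgroup.closure T) M) (h : ∀ s ∈ T, ∀ t ∈ T, rcomm s t ∈ M) :
    ⁅Subgroup.closure T, Subgroup.closure T⁆ ≤ M := by
  obtain ⟨Q, _, π, hπ⟩ := hM.exists_quotient
  have h1 : ∀ s, ∀ hs : s ∈ T, ∀ t, ∀ ht : t ∈ T,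
      Commute (π ⟨s, Subgroup.subset_closure hs⟩) (π ⟨t, Subgroup.subset_closure ht⟩) := by
    intro s hs t ht
    rw [Commute, SemiconjBy, ← rcomm_eq_one_iff, ← map_rcomm, hπ]
    exact h s hs t ht
  have h2 : ∀ g, ∀ hg : g ∈ Subgroup.closure T, ∀ t, ∀ ht : t ∈ T,
      Commute (π ⟨g, hg⟩) (π ⟨t, Subgroup.subset_closure ht⟩) := by
    intro g hg t ht
    induction hg using Subgroup.closure_induction with
    | mem x hx => exact h1 x hx t ht
    | one => exact (π.map_one ▸ Commute.one_left _ : Commute (π 1) _)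
    | mul x y hx hy ihx ihy =>
      have := ihx.mul_left ihy
      rwa [← map_mul] at this
    | inv x hx ih =>
      have := ih.inv_left
      rwa [← map_inv] at this
  have h3 : ∀ g, ∀ hg : g ∈ Subgroup.closure T, ∀ g', ∀ hg' : g' ∈ Subgroup.closure T,
      Commute (π ⟨g, hg⟩) (π ⟨g', hg'⟩) := by
    intro g hg g' hg'
    induction hg' using Subgroup.closure_induction with
    | mem x hx => exact h2 g hg x hx
    | one => exact (π.map_one ▸ Commute.one_right _ : Commute _ (π 1))
    | mul x y hx hy ihx ihy =>
      have := ihx.mul_right ihy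
      rwa [← map_mul] at this
    | inv x hx ih =>
      have := ih.inv_right
      rwa [← map_inv] at this
  rw [Subgroup.commutator_le]
  intro g hg g' hg'
  have := h3 g hg g' hg'
  rw [← commutatorElement_eq_one_iff_commute, ← map_commutatorElement, hπ] at this
  exact this

theorem eq_zero_of_additive {A : Type*} [AddGroup A] {H : Subgroup G} {f : G → A}
    (hadd : ∀ x ∈ H, ∀ y ∈ H, f (x * y) = f x + f y) : f 1 = 0 := by
  have := hadd 1 (one_mem H) 1 (one_mem H)
  rw [mul_one] at this
  simpa using this

theorem neg_of_additive {A : Type*} [AddGroup A] {H : Subgroup G} {f : G → A}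
    (hadd : ∀ x ∈ H, ∀ y ∈ H, f (x * y) = f x + f y) {x : G} (hx : x ∈ H) : f x⁻¹ = - f x := by
  have := hadd x⁻¹ (inv_mem hx) x hx
  rw [inv_mul_cancel, eq_zero_of_additive hadd] at this
  exact eq_neg_of_add_eq_zero_left this.symm

theorem exists_closure_of_additive {A : Type*} [AddGroup A] {H : Subgroup G} {f : G → A}
    (hadd : ∀ x ∈ H, ∀ y ∈ H, f (x * y) = f x + f y) {S : Set G} (hS : S ⊆ H) {a : A}
    (ha : a ∈ AddSubgroup.closure (f '' S)) : ∃ s ∈ Subgroup.closure S, f s = a := by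
  have hle : Subgroup.closure S ≤ H := (Subgroup.closure_le _).2 hS
  induction ha using AddSubgroup.closure_induction with
  | mem x hx =>
    obtain ⟨s, hs, rfl⟩ := hx
    exact ⟨s, Subgroup.subset_closure hs, rfl⟩
  | zero => exact ⟨1, one_mem _, eq_zero_of_additive hadd⟩
  | add x y _ _ ihx ihy =>
    obtain ⟨s, hs, rfl⟩ := ihx
    obtain ⟨t, ht, rfl⟩ := ihy
    exact ⟨s * t, mul_mem hs ht, hadd s (hle hs) t (hle ht)⟩
  | neg x _ ih =>
    obtain ⟨s, hs, rfl⟩ := ih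
    exact ⟨s⁻¹, inv_mem hs, neg_of_additive hadd (hle hs)⟩

/-- A function on `H` that is additive with kernel `N`, and whose values on `S ⊆ H` generate `A`,
identifies `H / N` with `A`. -/
theorem quotientIso_of_additive {A : Type*} [AddCommGroup A] {H N : Subgroup G} (hNH : N ≤ H)
    {f : G → A} (hadd : ∀ x ∈ H, ∀ y ∈ H, f (x * y) = f x + f y)
    (hker : ∀ x ∈ H, f x = 0 ↔ x ∈ N) {S : Set G} (hS : S ⊆ H)
    (hgen : ∀ a, a ∈ AddSubgroup.closure (f '' S)) :
    QuotientIso H N (Multiplicative A) ∧ GeneratesQuotient H N S := by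
  have hle : Subgroup.closure S ≤ H := (Subgroup.closure_le _).2 hS
  refine ⟨⟨hNH, ?_⟩, hS, le_antisymm (sup_le hle hNH) fun x hx => ?_⟩
  · let φ : H →* Multiplicative A :=
      MonoidHom.mk' (fun x => Multiplicative.ofAdd (f x)) fun x y => by
        simpa using congrArg Multiplicative.ofAdd (hadd x x.2 y y.2)
    have hφ : φ.ker = N.subgroupOf H := by
      ext x
      rw [MonoidHom.mem_ker, Subgroup.mem_subgroupOf, ← hker x x.2]
      exact ofAdd_eq_one
    have hsurj : Function.Surjective φ := fun a => by
      obtain ⟨s, hs, h⟩ := exists_closure_of_additive hadd hS (hgen a.toAdd)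
      exact ⟨⟨s, hle hs⟩, congrArg Multiplicative.ofAdd h⟩
    rw [← hφ]
    exact ⟨φ.normal_ker, ⟨QuotientGroup.quotientKerEquivOfSurjective φ hsurj⟩⟩
  · obtain ⟨s, hs, h⟩ := exists_closure_of_additive hadd hS (hgen (f x))
    have hsx : s⁻¹ * x ∈ N := by
      have h1 := mul_mem (inv_mem (hle hs)) hx
      rw [← hker _ h1, hadd _ (inv_mem (hle hs)) _ hx, neg_of_additive hadd (hle hs), h]
      simp
    have := Subgroup.mul_mem_sup hs hsx
    simpa using this

theorem mem_of_pi_single_mem {ι : Type*} [Fintype ι] [DecidableEq ι] {m : ℕ}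
    {P : AddSubgroup (ι → ZMod m)} (hP : ∀ i, Pi.single i 1 ∈ P) (a : ι → ZMod m) : a ∈ P := by
  rw [← Finset.univ_sum_single a]
  refine sum_mem fun i _ => ?_
  obtain ⟨c, hc⟩ := ZMod.intCast_surjective (a i)
  have : Pi.single i (a i) = c • (Pi.single i 1 : ι → ZMod m) := by
    rw [← Pi.single_smul, ← hc]; simp
  rw [this]
  exact zsmul_mem (hP i) c

theorem pow_of_additive {A : Type*} [AddCommGroup A] {H : Subgroup G} {f : G → A}
    (hadd : ∀ x ∈ H, ∀ y ∈ H, f (x * y) = f x + f y) {x : G} (hx : x ∈ H) (m : ℕ) :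
    f (x ^ m) = m • f x := by
  induction m with
  | zero => simpa using eq_zero_of_additive hadd
  | succ m ih => rw [pow_succ, hadd _ (pow_mem hx m) _ hx, ih, succ_nsmul]

/-- The kernel of a function that is additive on `H`. -/
def kerOn {A : Type*} [AddCommGroup A] (H : Subgroup G) (f : G → A)
    (hadd : ∀ x ∈ H, ∀ y ∈ H, f (x * y) = f x + f y) : Subgroup G where
  carrier := {x | x ∈ H ∧ f x = 0}
  one_mem' := ⟨one_mem H, eq_zero_of_additive hadd⟩
  mul_mem' := fun {x y} hx hy => ⟨mul_mem hx.1 hy.1, by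
    rw [hadd x hx.1 y hy.1, hx.2, hy.2, add_zero]⟩
  inv_mem' := fun {x} hx => ⟨inv_mem hx.1, by rw [neg_of_additive hadd hx.1, hx.2, neg_zero]⟩

theorem commutator_le_of_generatesQuotient {G : Type} [Group G] {H N : Subgroup G} {S : Set G}
    (hNH : N ≤ H) (hN : ConjInvariant H N) (hgen : GeneratesQuotient H N S)
    (h : ∀ s ∈ S, ∀ t ∈ S, rcomm s t ∈ N) : ⁅H, H⁆ ≤ N := by
  have hcl : Subgroup.closure (S ∪ N) = H := by
    rw [Subgroup.closure_union, Subgroup.closure_eq]; exact hgen.2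
  have key : ∀ s ∈ S ∪ N, ∀ t ∈ S ∪ N, rcomm s t ∈ N := by
    rintro s (hs | hs) t (ht | ht)
    · exact h s hs t ht
    · exact hN.rcomm_mem' ht (hgen.1 hs)
    · exact hN.rcomm_mem hs (hgen.1 ht)
    · exact hN.rcomm_mem hs (hNH ht)
  have := commutator_closure_le (T := S ∪ N) (by rwa [hcl]) key
  rwa [hcl] at this

/-- The elements that commute with `t` modulo `M` form a subgroup. -/
theorem rcomm_rcomm_mem {G : Type} [Group G] {K M : Subgroup G} (hM : ConjInvariant K M)
    {g h t : G} (hg : g ∈ K) (hh : h ∈ K) (ht : t ∈ K) (h1 : rcomm g t ∈ M)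
    (h2 : rcomm h t ∈ M) : rcomm (rcomm g h) t ∈ M := by
  obtain ⟨Q, _, π, hπ⟩ := hM.exists_quotient
  have c1 : Commute (π ⟨g, hg⟩) (π ⟨t, ht⟩) := by
    rw [Commute, SemiconjBy, ← rcomm_eq_one_iff, ← map_rcomm, hπ]; exact h1
  have c2 : Commute (π ⟨h, hh⟩) (π ⟨t, ht⟩) := by
    rw [Commute, SemiconjBy, ← rcomm_eq_one_iff, ← map_rcomm, hπ]; exact h2
  refine (hπ (rcomm (rcomm ⟨g, hg⟩ ⟨h, hh⟩) ⟨t, ht⟩)).1 ?_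
  rw [map_rcomm, map_rcomm, rcomm_eq_one_iff]
  exact ((c1.inv_left.mul_left c2.inv_left).mul_left c1).mul_left c2

theorem rconj_rcomm_right {g h : G} (hh : h * h = 1) : rconj (rcomm g h) h = (rcomm g h)⁻¹ := by
  have : h⁻¹ = h := inv_eq_of_mul_eq_one_left hh
  simp [rconj, rcomm, mul_assoc, hh, this]

theorem rconj_rcomm_left {g h : G} (hg : g * g = 1) : rconj (rcomm g h) g = (rcomm g h)⁻¹ := by
  rw [← rcomm_inv h g, rconj_inv, rconj_rcomm_right hg]

/-- If `H / N` is abelian and generated by involutions that an additive function maps to the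
standard basis of an elementary abelian 2-group, then the kernel of this function is `N`. -/
theorem mem_of_additive_eq_zero {ι : Type*} [Fintype ι] [DecidableEq ι] {H N : Subgroup G}
    (hN : ConjInvariant H N) {f : G → ι → ZMod 2}
    (hadd : ∀ x ∈ H, ∀ y ∈ H, f (x * y) = f x + f y) (hfN : ∀ x ∈ N, f x = 0)
    {g : ι → G} (hg : ∀ i, f (g i) = Pi.single i 1) (hg2 : ∀ i, g i * g i ∈ N)
    (hcomm : ⁅H, H⁆ ≤ N) (hgen : GeneratesQuotient H N (Set.range g))
    {x : G} (hx : x ∈ H) (hfx : f x = 0) : x ∈ N := by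
  have := hN.normal_subgroupOf
  have hgH : ∀ i, g i ∈ H := fun i => hgen.1 ⟨i, rfl⟩
  let _ : CommGroup (H ⧸ N.subgroupOf H) :=
    -- Commutativity of the quotient is what allows an element of the closure of the generators to
    -- be written below as a product of powers, one exponent per generator.
    { (inferInstance : Group (H ⧸ N.subgroupOf H)) with
      mul_comm := by
        intro a b
        obtain ⟨a, rfl⟩ := QuotientGroup.mk_surjective a
        obtain ⟨b, rfl⟩ := QuotientGroup.mk_surjective b
        rw [← QuotientGroup.mk_mul, ← QuotientGroup.mk_mul, QuotientGroup.eq,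
          Subgroup.mem_subgroupOf]
        have : (((a * b)⁻¹ * (b * a) : H) : G) = rcomm (b : G) a := by
          simp [rcomm, mul_assoc]
        rw [this]
        exact hcomm (rcomm_mem_commutator b.2 a.2) }
  let q : ι → H ⧸ N.subgroupOf H := fun i => QuotientGroup.mk ⟨g i, hgH i⟩
  let φ : H ⧸ N.subgroupOf H →* Multiplicative (ι → ZMod 2) :=
    QuotientGroup.lift _ (MonoidHom.mk' (fun x : H => Multiplicative.ofAdd (f x)) fun x y => by
        simpa using congrArg Multiplicative.ofAdd (hadd x x.2 y y.2))
      fun x hx => by simpa using hfN x hx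
  have hφ : ∀ y : H, φ (QuotientGroup.mk y) = Multiplicative.ofAdd (f y) := fun _ => rfl
  have hq : ∀ y : G, ∀ hy : y ∈ H, (QuotientGroup.mk ⟨y, hy⟩ : H ⧸ N.subgroupOf H) ∈
      Subgroup.closure (Set.range q) := by
    intro y hy
    have hy' : y ∈ Subgroup.closure (Set.range g) ⊔ N := by rw [hgen.2]; exact hy
    rw [← Subgroup.closure_eq N, ← Subgroup.closure_union] at hy'
    have hle : Subgroup.closure (Set.range g ∪ N) = H := by
      rw [Subgroup.closure_union, Subgroup.closure_eq]; exact hgen.2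
    induction hy' using Subgroup.closure_induction with
    | mem z hz =>
      rcases hz with ⟨i, rfl⟩ | hz
      · exact Subgroup.subset_closure ⟨i, rfl⟩
      · rw [(QuotientGroup.eq_one_iff (N := N.subgroupOf H) _).2
          (Subgroup.mem_subgroupOf.2 hz)]
        exact one_mem _
    | one => exact one_mem _
    | mul a b ha hb iha ihb => exact mul_mem (iha (hle ▸ ha)) (ihb (hle ▸ hb))
    | inv a ha iha => exact inv_mem (iha (hle ▸ ha))
  obtain ⟨e, he⟩ := Subgroup.exists_of_mem_closure_range q _ (hq x hx)
  have hq2 : ∀ i, q i * q i = 1 := fun i => by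
    rw [← QuotientGroup.mk_mul, QuotientGroup.eq_one_iff, Subgroup.mem_subgroupOf]
    exact hg2 i
  -- The `i`-th coordinate of `f x` is `e i` modulo 2, so all exponents are even and the product of
  -- involutions collapses.
  have he2 : ∀ i, (e i : ZMod 2) = 0 := fun i => by
    have h := congrArg φ he
    rw [hφ, map_prod] at h
    have h' := congrArg (fun z => z.toAdd i) h
    simp only [hfx, toAdd_prod, map_zpow, q, hφ, toAdd_zpow, toAdd_ofAdd, hg, Finset.sum_apply,
      Pi.smul_apply, Pi.zero_apply] at h'
    rw [Finset.sum_eq_single i] at h'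
    · simpa using h'.symm
    · intro j _ hj; simp [hj.symm]
    · simp
  have : (QuotientGroup.mk ⟨x, hx⟩ : H ⧸ N.subgroupOf H) = 1 := by
    rw [he]
    refine Finset.prod_eq_one fun i _ => ?_
    obtain ⟨c, hc⟩ := (ZMod.intCast_zmod_eq_zero_iff_dvd (e i) 2).1 (he2 i)
    rw [hc]
    push_cast
    rw [zpow_mul, zpow_two, hq2, one_zpow]
  rw [QuotientGroup.eq_one_iff, Subgroup.mem_subgroupOf] at this
  exact this

theorem QuotientIso.relIndex_ne_zero {H N : Subgroup G} {A : Type*} [Group A] [Finite A]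
    (h : QuotientIso H N A) : N.relIndex H ≠ 0 := by
  obtain ⟨_, _, ⟨e⟩⟩ := h
  have : Finite (H ⧸ N.subgroupOf H) := Finite.of_equiv A e.symm.toEquiv
  have : (N.subgroupOf H).FiniteIndex := Subgroup.finiteIndex_of_finite_quotient
  exact Subgroup.FiniteIndex.index_ne_zero

end groups

/-! ### The generators as one sequence, self-replication, abelianization -/

/-- The generators in the order `b_1, …, b_k, a_1, …, a_n`, indexed from `0`. -/
def gen (w v : List Bool) (m : ℕ) : TreeAut :=
  if m < w.length then genB w v (m + 1) else genA w v (m - w.length + 1)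

section kneading
variable {w v : List Bool}

theorem gen_of_lt {m : ℕ} (h : m < w.length) : gen w v m = genB w v (m + 1) := if_pos h

theorem gen_add (i : ℕ) : gen w v (w.length + i) = genA w v (i + 1) := by
  simp [gen]

theorem genB_eq_gen {j : ℕ} (h1 : 1 ≤ j) (h2 : j ≤ w.length) : genB w v j = gen w v (j - 1) := by
  rw [gen_of_lt (by omega), Nat.sub_add_cancel h1]

theorem genA_eq_gen {i : ℕ} (h1 : 1 ≤ i) : genA w v i = gen w v (w.length + i - 1) := by
  rw [Nat.add_sub_assoc h1, gen_add, Nat.sub_add_cancel h1]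

@[simp] theorem gen_mul_self (m : ℕ) : gen w v m * gen w v m = 1 := by
  unfold gen; split_ifs <;> simp

@[simp] theorem gen_inv (m : ℕ) : (gen w v m)⁻¹ = gen w v m :=
  inv_eq_of_mul_eq_one_left (gen_mul_self m)

@[simp] theorem sgn_add_self (l : ℕ) (g : TreeAut) : sgn l g + sgn l g = 0 :=
  CharTwo.add_self_eq_zero _

theorem gen_zero (hw : w ≠ []) : gen w v 0 = genB w v 1 :=
  gen_of_lt (List.length_pos_iff.2 hw)

/-- The excluded index `w.length` is that of `a_1`, the only generator with two nontrivial sections.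
-/
theorem gen_succ {m : ℕ} (hm : m + 1 < w.length + v.length) (hk : m + 1 ≠ w.length) :
    ∃ x, gen w v (m + 1) = inj x (gen w v m) := by
  by_cases h : m + 1 < w.length
  · exact ⟨w[m], by rw [gen_of_lt h, gen_of_lt (by omega), genB_add_two]⟩
  · obtain ⟨i, rfl⟩ := Nat.exists_eq_add_of_le (show w.length ≤ m by omega)
    exact ⟨v[i], by rw [add_assoc, gen_add, gen_add, genA_add_two]⟩

theorem exists_sec_gen_length (hw : w ≠ []) (hv : v ≠ []) :
    ∃ z, sec (gen w v w.length) z = gen w v (w.length - 1) ∧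
      sec (gen w v w.length) (!z) = gen w v (w.length + v.length - 1) := by
  have hk := List.length_pos_iff.2 hw
  have hn := List.length_pos_iff.2 hv
  have h := gen_add (w := w) (v := v) 0
  rw [add_zero, zero_add] at h
  refine ⟨w.getLast hw, ?_, ?_⟩
  · rw [h, sec_genA_one_last, genB_eq_gen hk le_rfl]
  · rw [h, sec_genA_one_not_last, genA_eq_gen hn]

theorem flips_gen_zero (hw : w ≠ []) : flips (gen w v 0) = true := by
  rw [gen_zero hw, flips_genB_one]

theorem sec_gen_zero (hw : w ≠ []) (x : Bool) : sec (gen w v 0) x = 1 := by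
  rw [gen_zero hw, sec_genB_one]

theorem flips_gen_length : flips (gen w v w.length) = false := by
  simp [gen]

theorem flips_gen {m : ℕ} (h0 : m ≠ 0) (hm : m < w.length + v.length) :
    flips (gen w v m) = false := by
  obtain ⟨m, rfl⟩ := Nat.exists_eq_succ_of_ne_zero h0
  by_cases hk : m + 1 = w.length
  · rw [Nat.succ_eq_add_one, hk, flips_gen_length]
  · obtain ⟨x, hx⟩ := gen_succ hm hk
    rw [Nat.succ_eq_add_one, hx, flips_inj]

theorem flips_rconj_gen_zero (g : TreeAut) : flips (rconj g (gen w v 0)) = flips g := by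
  simp only [rconj, flips_mul, flips_inv]
  cases flips g <;> cases flips (gen w v 0) <;> rfl

theorem sec_rconj_gen_zero (hw : w ≠ []) (g : TreeAut) (x : Bool) :
    sec (rconj g (gen w v 0)) x = sec g (!x) := by
  simp [rconj, sec_gen_zero hw, flips_gen_zero hw]

theorem rconj_inj_gen_zero (hw : w ≠ []) (g : TreeAut) (x : Bool) :
    rconj (inj x g) (gen w v 0) = inj (!x) g := by
  rw [gen_zero hw, rconj_genB_one_inj]

/-- Passing to sections lowers both the level and the index by one. At `a_1` there is the extra
section `a_n`, but its index `k + n - 1` is above every level that the induction still reaches. -/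
theorem sgn_gen (hw : w ≠ []) (hv : v ≠ []) {l m : ℕ} (hl : l < w.length + v.length)
    (hm : m < w.length + v.length) : sgn l (gen w v m) = if m = l then 1 else 0 := by
  have hk := List.length_pos_iff.2 hw
  have hn := List.length_pos_iff.2 hv
  induction l generalizing m with
  | zero =>
    by_cases h : m = 0
    · subst h; simp [sgn, flips_gen_zero hw]
    · simp [sgn, flips_gen h hm, h]
  | succ l ih =>
    rcases m with _ | m
    · simp [sgn_succ, sec_gen_zero hw]
    · by_cases hmk : m + 1 = w.length
      · obtain ⟨z, h1, h2⟩ := exists_sec_gen_length hw hv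
        have : sgn (l + 1) (gen w v (m + 1)) = sgn l (gen w v (w.length - 1)) +
            sgn l (gen w v (w.length + v.length - 1)) := by
          rw [hmk, sgn_succ, ← h1, ← h2]
          cases z <;> simp [add_comm]
        rw [this, ih (by omega) (by omega), ih (by omega) (by omega)]
        rw [if_neg (show w.length + v.length - 1 ≠ l by omega), add_zero]
        simp [show w.length - 1 = m by omega]
      · obtain ⟨x, hx⟩ := gen_succ hm hmk
        rw [hx, sgn_inj, ih (by omega) (by omega)]
        simp

theorem kneadingGroup_eq :
    kneadingGroup w v = Subgroup.closure {g | ∃ m < w.length + v.length, g = gen w v m} := by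
  refine congrArg Subgroup.closure (Set.ext fun g => ⟨?_, ?_⟩)
  · rintro (⟨j, h1, h2, rfl⟩ | ⟨i, h1, h2, rfl⟩)
    · exact ⟨j - 1, by omega, genB_eq_gen h1 h2⟩
    · exact ⟨w.length + i - 1, by omega, genA_eq_gen h1⟩
  · rintro ⟨m, hm, rfl⟩
    by_cases h : m < w.length
    · exact Or.inl ⟨m + 1, by omega, by omega, gen_of_lt h⟩
    · obtain ⟨i, rfl⟩ := Nat.exists_eq_add_of_le (show w.length ≤ m by omega)
      exact Or.inr ⟨i + 1, by omega, by omega, gen_add i⟩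

theorem gen_mem {m : ℕ} (hm : m < w.length + v.length) : gen w v m ∈ kneadingGroup w v := by
  rw [kneadingGroup_eq]
  exact Subgroup.subset_closure ⟨m, hm, rfl⟩

theorem gen_zero_mem (hw : w ≠ []) : gen w v 0 ∈ kneadingGroup w v :=
  gen_mem (by have := List.length_pos_iff.2 hw; omega)

theorem kneadingGroup_induction {P : ∀ g, g ∈ kneadingGroup w v → Prop}
    (hgen : ∀ m, ∀ hm : m < w.length + v.length, P (gen w v m) (gen_mem hm)) (one : P 1 (one_mem _))
    (mul : ∀ g h hg hh, P g hg → P h hh → P (g * h) (mul_mem hg hh))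
    {g : TreeAut} (hg : g ∈ kneadingGroup w v) : P g hg := by
  have key : ∀ g, g ∈ Subgroup.closure {g | ∃ m < w.length + v.length, g = gen w v m} →
      ∃ hg : g ∈ kneadingGroup w v, P g hg := by
    intro g hg
    induction hg using Subgroup.closure_induction_left with
    | one => exact ⟨_, one⟩
    | mul_left x hx y hy ih =>
      obtain ⟨m, hm, rfl⟩ := hx
      obtain ⟨hy, ih⟩ := ih
      exact ⟨_, mul _ _ (gen_mem hm) hy (hgen m hm) ih⟩
    | inv_mul_cancel x hx y hy ih =>
      obtain ⟨m, hm, rfl⟩ := hx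
      obtain ⟨hy, ih⟩ := ih
      rw [gen_inv]
      exact ⟨_, mul _ _ (gen_mem hm) hy (hgen m hm) ih⟩
  exact (key g (by rwa [← kneadingGroup_eq])).2

theorem conjInvariant_kneadingGroup_sup {S : Set TreeAut} {N : Subgroup TreeAut}
    (hN : ConjInvariant (kneadingGroup w v) N)
    (h : ∀ s ∈ S, ∀ m < w.length + v.length, rconj s (gen w v m) ∈ Subgroup.closure S ⊔ N) :
    ConjInvariant (kneadingGroup w v) (Subgroup.closure S ⊔ N) := by
  rw [kneadingGroup_eq] at hN ⊢
  refine conjInvariant_closure_sup ?_ hN ?_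
  · rintro _ ⟨m, hm, rfl⟩; simp
  · rintro s hs _ ⟨m, hm, rfl⟩; exact h s hs m hm

theorem commutator_kneadingGroup_le {M : Subgroup TreeAut}
    (hM : ConjInvariant (kneadingGroup w v) M)
    (h : ∀ l m, l < m → m < w.length + v.length → rcomm (gen w v l) (gen w v m) ∈ M) :
    ⁅kneadingGroup w v, kneadingGroup w v⁆ ≤ M := by
  rw [kneadingGroup_eq] at hM ⊢
  refine commutator_closure_le hM ?_
  rintro _ ⟨l, hl, rfl⟩ _ ⟨m, hm, rfl⟩
  rcases lt_trichotomy l m with hlm | rfl | hlm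
  · exact h l m hlm hm
  · rw [rcomm_eq_one_iff.2 rfl]; exact one_mem _
  · rw [← rcomm_inv]; exact inv_mem (h m l hlm hl)

theorem sec_mem (hw : w ≠ []) (hv : v ≠ []) {g : TreeAut} (hg : g ∈ kneadingGroup w v)
    (x : Bool) : sec g x ∈ kneadingGroup w v := by
  have hk := List.length_pos_iff.2 hw
  have hn := List.length_pos_iff.2 hv
  induction hg using kneadingGroup_induction generalizing x with
  | hgen m hm =>
    rcases m with _ | m
    · rw [sec_gen_zero hw]; exact one_mem _
    · by_cases hmk : m + 1 = w.length
      · obtain ⟨z, h1, h2⟩ := exists_sec_gen_length hw hv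
        rw [hmk]
        obtain rfl | rfl : x = z ∨ x = !z := by cases x <;> cases z <;> simp
        · rw [h1]; exact gen_mem (by omega)
        · rw [h2]; exact gen_mem (by omega)
      · obtain ⟨y, hy⟩ := gen_succ hm hmk
        rw [hy, sec_inj]
        split_ifs
        · exact gen_mem (by omega)
        · exact one_mem _
  | one => simp
  | mul g h hg hh ihg ihh => rw [sec_mul]; exact mul_mem (ihg _) (ihh _)

/-- `K` is self-replicating: each generator is a section of a generator that fixes the letters
(`b_k` and `a_n` both come from `a_1`), and conjugation by `b_1` moves that section to the
prescribed letter. -/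
theorem exists_sec_eq (hw : w ≠ []) (hv : v ≠ []) (x : Bool) {g : TreeAut}
    (hg : g ∈ kneadingGroup w v) :
    ∃ h ∈ kneadingGroup w v, flips h = false ∧ sec h x = g := by
  have hk := List.length_pos_iff.2 hw
  have hn := List.length_pos_iff.2 hv
  have either : ∀ h ∈ kneadingGroup w v, flips h = false → ∀ y,
      ∃ h' ∈ kneadingGroup w v, flips h' = false ∧ sec h' x = sec h y := by
    intro h hh hf y
    obtain rfl | rfl : y = x ∨ y = !x := by cases x <;> cases y <;> simp
    · exact ⟨h, hh, hf, rfl⟩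
    · exact ⟨rconj h (gen w v 0), rconj_mem hh (gen_zero_mem hw), by rw [flips_rconj_gen_zero, hf],
        sec_rconj_gen_zero hw _ _⟩
  induction hg using kneadingGroup_induction with
  | hgen m hm =>
    obtain ⟨z, h1, h2⟩ := exists_sec_gen_length hw hv
    have hK : gen w v w.length ∈ kneadingGroup w v := gen_mem (by omega)
    by_cases hmk : m + 1 = w.length
    · have := either _ hK flips_gen_length z
      rwa [h1, show w.length - 1 = m by omega] at this
    by_cases hmn : m + 1 = w.length + v.length
    · have := either _ hK flips_gen_length (!z)
      rwa [h2, show w.length + v.length - 1 = m by omega] at this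
    obtain ⟨y, hy⟩ := gen_succ (show m + 1 < w.length + v.length by omega) hmk
    have := either _ (gen_mem (show m + 1 < w.length + v.length by omega))
      (flips_gen (by omega) (by omega)) y
    rwa [hy, sec_inj_self] at this
  | one => exact ⟨1, one_mem _, by simp⟩
  | mul g h _ _ ihg ihh =>
    obtain ⟨a, ha, ha1, ha2⟩ := ihg
    obtain ⟨b, hb, hb1, hb2⟩ := ihh
    exact ⟨a * b, mul_mem ha hb, by simp [ha1, hb1], by simp [ha1, ha2, hb2]⟩

theorem inj_mem_of_inj_mem (hw : w ≠ []) {M : Subgroup TreeAut}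
    (hM : ConjInvariant (kneadingGroup w v) M) {x : Bool} {g : TreeAut} (h : inj x g ∈ M)
    (y : Bool) : inj y g ∈ M := by
  obtain rfl | rfl : y = x ∨ y = !x := by cases x <;> cases y <;> simp
  · exact h
  · rw [← rconj_inj_gen_zero hw]
    exact hM _ h _ (gen_zero_mem hw)

/-- The copy of `s^g` is the copy of `s` conjugated by an element of `K` that fixes the letters and
has section `g`; such an element exists by `exists_sec_eq`. -/
theorem inj_mem_of_mem_normalClosureIn (hw : w ≠ []) (hv : v ≠ []) {M : Subgroup TreeAut}
    (hM : ConjInvariant (kneadingGroup w v) M) {S : Set TreeAut}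
    (hS : ∀ s ∈ S, ∃ y, inj y s ∈ M) {g : TreeAut}
    (hg : g ∈ normalClosureIn (kneadingGroup w v) S) (x : Bool) : inj x g ∈ M := by
  unfold normalClosureIn at hg
  induction hg using Subgroup.closure_induction with
  | mem y hy =>
    obtain ⟨s, hs, g, hg, rfl⟩ := hy
    obtain ⟨y, hy⟩ := hS s hs
    obtain ⟨h, hh, hf, rfl⟩ := exists_sec_eq hw hv x hg
    rw [← rconj_inj hf]
    exact hM _ (inj_mem_of_inj_mem hw hM hy x) _ hh
  | one => rw [inj_one]; exact one_mem _
  | mul a b _ _ iha ihb => rw [inj_mul]; exact mul_mem iha ihb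
  | inv a _ iha => rw [inj_inv]; exact inv_mem iha

/-- The constraint between the signs of the two sections of an element of `K(w, v)`. -/
theorem sgn_sec_eq_sgn_sec_not (hw : w ≠ []) (hv : v ≠ []) {g : TreeAut}
    (hg : g ∈ kneadingGroup w v) (x : Bool) :
    sgn (w.length - 1) (sec g x) = sgn (w.length + v.length - 1) (sec g (!x)) := by
  have hk := List.length_pos_iff.2 hw
  have hn := List.length_pos_iff.2 hv
  induction hg using kneadingGroup_induction generalizing x with
  | hgen m hm =>
    rcases m with _ | m
    · simp [sec_gen_zero hw]
    -- Among the generators only `a_1` has `b_k` or `a_n` as a section. It has one of each, at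
    -- opposite letters, so both sides are `1` at one letter and `0` at the other.
    · by_cases hmk : m + 1 = w.length
      · obtain ⟨z, h1, h2⟩ := exists_sec_gen_length hw hv
        rw [hmk]
        obtain rfl | rfl : x = z ∨ x = !z := by cases x <;> cases z <;> simp
        · rw [h1, h2]; simp (disch := omega) only [sgn_gen hw hv]
        · rw [Bool.not_not, h1, h2]
          rw [sgn_gen hw hv (by omega) (by omega), sgn_gen hw hv (by omega) (by omega)]
          rw [if_neg (by omega), if_neg (by omega)]
      · obtain ⟨y, hy⟩ := gen_succ hm hmk
        have e1 : sgn (w.length - 1) (gen w v m) = 0 := by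
          rw [sgn_gen hw hv (by omega) (by omega), if_neg (by omega)]
        have e2 : sgn (w.length + v.length - 1) (gen w v m) = 0 := by
          rw [sgn_gen hw hv (by omega) (by omega), if_neg (by omega)]
        rw [hy, sec_inj, sec_inj]
        split_ifs <;> simp [e1, e2]
  | one => simp
  | mul g h hg hh ihg ihh =>
    simp only [sec_mul, sgn_mul, ihg, ihh]
    congr 3
    cases x <;> cases flips g <;> rfl

theorem sgn_eq_zero_of_mem_commutator {H : Subgroup TreeAut} {g : TreeAut} (hg : g ∈ ⁅H, H⁆)
    (l : ℕ) : sgn l g = 0 := by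
  have key : ⁅H, H⁆ ≤ (MonoidHom.mk' (fun g => Multiplicative.ofAdd (sgn l g))
      fun a b => by simp).ker := by
    rw [Subgroup.commutator_le]
    intro a _ b _
    rw [MonoidHom.mem_ker, map_commutatorElement, commutatorElement_eq_one_iff_mul_comm, mul_comm]
  exact key hg

/-- `K/K'` is abelian and generated by involutions to which the first `k + n` level parities are
dual, so these parities separate its elements. -/
theorem mem_commutator_iff (hw : w ≠ []) (hv : v ≠ []) {g : TreeAut}
    (hg : g ∈ kneadingGroup w v) :
    g ∈ ⁅kneadingGroup w v, kneadingGroup w v⁆ ↔ ∀ l < w.length + v.length, sgn l g = 0 := by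
  refine ⟨fun h l _ => sgn_eq_zero_of_mem_commutator h l, fun h => ?_⟩
  have hmem : ∀ m : Fin (w.length + v.length), gen w v m ∈ kneadingGroup w v :=
    fun m => gen_mem m.2
  refine mem_of_additive_eq_zero (ι := Fin (w.length + v.length)) (H := kneadingGroup w v)
    (f := fun g l => sgn (l : ℕ) g) (g := fun m => gen w v m) (conjInvariant_commutator _)
    (fun x _ y _ => funext fun l => sgn_mul ..)
    (fun x hx => funext fun l => sgn_eq_zero_of_mem_commutator hx l)
    (fun m => funext fun l => ?_) (fun m => ?_) le_rfl ⟨?_, ?_⟩ hg (funext fun l => h l l.2)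
  · rw [sgn_gen hw hv l.2 m.2, Pi.single_apply]
    simp [Fin.ext_iff, eq_comm]
  · rw [gen_mul_self]; exact one_mem _
  · rintro _ ⟨m, rfl⟩; exact hmem m
  · refine le_antisymm (sup_le ((Subgroup.closure_le _).2 ?_) (Subgroup.commutator_le_self _)) ?_
    · rintro _ ⟨m, rfl⟩; exact hmem m
    · refine le_trans ?_ le_sup_left
      rw [kneadingGroup_eq]
      refine Subgroup.closure_mono ?_
      rintro _ ⟨m, hm, rfl⟩
      exact ⟨⟨m, hm⟩, rfl⟩

theorem abelianization_kneadingGroup (hw : w ≠ []) (hv : v ≠ []) :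
    QuotientIso (kneadingGroup w v) ⁅kneadingGroup w v, kneadingGroup w v⁆
        (Multiplicative (Fin (w.length + v.length) → ZMod 2)) ∧
      GeneratesQuotient (kneadingGroup w v) ⁅kneadingGroup w v, kneadingGroup w v⁆
        ({g | ∃ i, 1 ≤ i ∧ i ≤ v.length ∧ g = genA w v i} ∪
          {g | ∃ j, 1 ≤ j ∧ j ≤ w.length ∧ g = genB w v j}) := by
  refine quotientIso_of_additive (f := fun g (l : Fin (w.length + v.length)) => sgn l g)
    (Subgroup.commutator_le_self _)
    (fun x _ y _ => funext fun l => sgn_mul ..) (fun x hx => ?_) ?_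
    (mem_of_pi_single_mem fun m => AddSubgroup.subset_closure
      ⟨gen w v m, ?_, funext fun l => ?_⟩)
  · rw [mem_commutator_iff hw hv hx]
    exact ⟨fun h l hl => congrFun h ⟨l, hl⟩, fun h => funext fun l => h l l.2⟩
  · rw [Set.union_comm]
    exact Subgroup.subset_closure
  · by_cases h : (m : ℕ) < w.length
    · exact Or.inr ⟨m + 1, by omega, by omega, gen_of_lt h⟩
    · obtain ⟨i, hi⟩ := Nat.exists_eq_add_of_le (show w.length ≤ m by omega)
      exact Or.inl ⟨i + 1, by omega, by omega, by rw [hi, gen_add i]⟩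
  · change sgn l (gen w v m) = _
    rw [sgn_gen hw hv l.2 m.2, Pi.single_apply]
    simp [Fin.ext_iff, eq_comm]

/-! ### Branching over `K'`: the generic case -/

theorem geomSquare_le_of_inj {H M : Subgroup TreeAut} (h : ∀ g ∈ H, ∀ x, inj x g ∈ M) :
    geomSquare H ≤ M := by
  intro g hg
  obtain ⟨hf, h0, h1⟩ := mem_geomSquare.1 hg
  rw [← pair_sec hf, pair_eq_inj]
  exact mul_mem (h _ h0 _) (h _ h1 _)

/-- Elements supported on different subtrees commute, so their conjugates commute modulo a
normal subgroup that contains `b_1`. -/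
theorem rcomm_inj_inj_mem (hw : w ≠ []) {M : Subgroup TreeAut}
    (hM : ConjInvariant (kneadingGroup w v) M) (h0 : gen w v 0 ∈ M) {x y : Bool}
    {g h : TreeAut} (hg : inj x g ∈ kneadingGroup w v) (hh : inj y h ∈ kneadingGroup w v) :
    rcomm (inj x g) (inj y h) ∈ M := by
  obtain ⟨Q, _, π, hπ⟩ := hM.exists_quotient
  have h1 : π ⟨gen w v 0, gen_zero_mem hw⟩ = 1 := (hπ _).2 h0
  have h2 : inj (!y) g ∈ kneadingGroup w v :=
    inj_mem_of_inj_mem hw (conjInvariant_self _) hg _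
  have h3 : π ⟨inj x g, hg⟩ = π ⟨inj (!y) g, h2⟩ := by
    obtain rfl | rfl : x = !y ∨ y = x := by cases x <;> cases y <;> simp
    · rfl
    · have : (⟨inj (!y) g, h2⟩ : kneadingGroup w v) =
          rconj ⟨inj y g, hg⟩ ⟨gen w v 0, gen_zero_mem hw⟩ :=
        Subtype.ext (rconj_inj_gen_zero hw g y).symm
      rw [this, map_rconj, h1, rconj_one_right]
  have h4 : π (rcomm ⟨inj x g, hg⟩ ⟨inj y h, hh⟩) = 1 := by
    rw [map_rcomm, h3, ← map_rcomm,
      rcomm_eq_one_iff.2 (Subtype.ext (inj_commute (by cases y <;> simp) g h)), map_one]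
  exact (hπ _).1 h4

theorem sgn_sec_rcomm_gen_zero (hw : w ≠ []) (l : ℕ) {g : TreeAut} (hg : flips g = false)
    (x : Bool) : sgn l (sec (rcomm (gen w v 0) g) x) = sgn (l + 1) g := by
  cases x <;> simp [rcomm, sec_gen_zero hw, flips_gen_zero hw, hg, sgn_succ, add_comm]

theorem flips_eq_false_of_mem_commutator {H : Subgroup TreeAut} {g : TreeAut} (hg : g ∈ ⁅H, H⁆) :
    flips g = false :=
  sgn_zero_eq_zero.1 (sgn_eq_zero_of_mem_commutator hg 0)

theorem sgn_sec_eq_of_mem_commutator {H : Subgroup TreeAut} {g : TreeAut} (hg : g ∈ ⁅H, H⁆)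
    (l : ℕ) : sgn l (sec g true) = sgn l (sec g false) := by
  have := sgn_eq_zero_of_mem_commutator hg (l + 1)
  rw [sgn_succ, CharTwo.add_eq_zero] at this
  exact this.symm

theorem mem_of_mem_commutator {K : Subgroup TreeAut} {g : TreeAut} (hg : g ∈ ⁅K, K⁆) : g ∈ K :=
  Subgroup.commutator_le_self K hg

theorem sgn_sec_last_eq (hw : w ≠ []) (hv : v ≠ []) {g : TreeAut}
    (hg : g ∈ ⁅kneadingGroup w v, kneadingGroup w v⁆) :
    sgn (w.length + v.length - 1) (sec g false) = sgn (w.length - 1) (sec g false) := by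
  rw [← sgn_sec_eq_of_mem_commutator hg (w.length - 1),
    sgn_sec_eq_sgn_sec_not hw hv (mem_of_mem_commutator hg), Bool.not_true]

/-- The parity at the last level `k + n - 1` equals that at level `k - 1` by `sgn_sec_last_eq`, so
it need not be assumed. The section at `true` has the same parities as that at `false`, because
their sums are parities of `g`. -/
theorem sec_mem_commutator (hw : w ≠ []) (hv : v ≠ []) {g : TreeAut}
    (hg : g ∈ ⁅kneadingGroup w v, kneadingGroup w v⁆)
    (h : ∀ l < w.length + v.length - 1, sgn l (sec g false) = 0) (x : Bool) :
    sec g x ∈ ⁅kneadingGroup w v, kneadingGroup w v⁆ := by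
  have hk := List.length_pos_iff.2 hw
  have hn := List.length_pos_iff.2 hv
  have hgK := mem_of_mem_commutator hg
  rw [mem_commutator_iff hw hv (sec_mem hw hv hgK x)]
  have h0 : ∀ l < w.length + v.length, sgn l (sec g false) = 0 := by
    intro l hl
    by_cases h' : l < w.length + v.length - 1
    · exact h l h'
    · obtain rfl : l = w.length + v.length - 1 := by omega
      rw [sgn_sec_last_eq hw hv hg]
      exact h _ (by omega)
  cases x
  · exact h0
  · intro l hl
    rw [sgn_sec_eq_of_mem_commutator hg]
    exact h0 l hl

theorem inj_mem_commutator (hw : w ≠ []) (hv : v ≠ []) {g : TreeAut} {x : Bool}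
    (hg : g ∈ ⁅kneadingGroup w v, kneadingGroup w v⁆) (h : inj x g ∈ kneadingGroup w v) :
    inj x g ∈ ⁅kneadingGroup w v, kneadingGroup w v⁆ := by
  rw [mem_commutator_iff hw hv h]
  rintro (_ | l) _
  · simp [sgn]
  · rw [sgn_inj, sgn_eq_zero_of_mem_commutator hg]

variable (w v) in
/-- The normal closure of all generators except `b_k` and `a_n`. -/
def smallClosure : Subgroup TreeAut :=
  normalClosureIn (kneadingGroup w v) {g | ∃ m < w.length + v.length,
    m + 1 ≠ w.length ∧ m + 1 ≠ w.length + v.length ∧ g = gen w v m}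

theorem conjInvariant_smallClosure : ConjInvariant (kneadingGroup w v) (smallClosure w v) :=
  conjInvariant_normalClosureIn _ _

theorem gen_mem_smallClosure {m : ℕ} (h : m < w.length + v.length) (h1 : m + 1 ≠ w.length)
    (h2 : m + 1 ≠ w.length + v.length) : gen w v m ∈ smallClosure w v :=
  mem_normalClosureIn ⟨m, h, h1, h2, rfl⟩

/-- For the normal generators, `gen (m + 1)` is itself a copy of `gen m`. This fails for `b_k` and
`a_n`, which is why `smallClosure` omits them. -/
theorem inj_mem_of_mem_smallClosure (hw : w ≠ []) (hv : v ≠ []) {g : TreeAut}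
    (hg : g ∈ smallClosure w v) (x : Bool) : inj x g ∈ kneadingGroup w v := by
  refine inj_mem_of_mem_normalClosureIn hw hv (conjInvariant_self _) ?_ hg x
  rintro _ ⟨m, h, h1, h2, rfl⟩
  obtain ⟨y, hy⟩ := gen_succ (show m + 1 < w.length + v.length by omega) h1
  exact ⟨y, hy ▸ gen_mem (by omega)⟩

theorem rcomm_rconj_mem {K M : Subgroup TreeAut} (hM : ConjInvariant K M) {g h s : TreeAut}
    (hg : g ∈ K) (hh : h ∈ K) (hs : s ∈ K) (hsM : s ∈ M) (hc : rcomm g h ∈ M) :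
    rcomm (rconj g s) h ∈ M := by
  obtain ⟨Q, _, π, hπ⟩ := hM.exists_quotient
  refine (hπ (rcomm (rconj ⟨g, hg⟩ ⟨s, hs⟩) ⟨h, hh⟩)).1 ?_
  rw [map_rcomm, map_rconj, (hπ ⟨s, hs⟩).2 hsM, rconj_one_right, ← map_rcomm, hπ]
  exact hc

/-- If `k, n ≥ 2`, both `b_k` and `a_n` live on one subtree, and `b_1 ∈ smallClosure` moves them
apart. If `n = 1`, then `a_1` has section `b_k` at `z`, so its commutator with the copy of `b_{k-1}`
at `z` is the copy of `[b_{k-1}, b_k]`. That commutator lies in the normal closure of `b_1, …,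
b_{k-2}`, whose copies lie in `smallClosure`. -/
theorem rcomm_last_mem_smallClosure (hw : w ≠ []) (hv : v ≠ [])
    (hkn : (2 ≤ w.length ∧ 2 ≤ v.length) ∨ (3 ≤ w.length ∧ v.length = 1)) :
    rcomm (gen w v (w.length - 1)) (gen w v (w.length + v.length - 1)) ∈ smallClosure w v := by
  have h0 : gen w v 0 ∈ smallClosure w v :=
    gen_mem_smallClosure (by omega) (by omega) (by omega)
  obtain ⟨y, hy⟩ := gen_succ (show w.length - 2 + 1 < w.length + v.length by omega) (by omega)
  rw [show w.length - 2 + 1 = w.length - 1 by omega] at hy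
  have hyK := hy ▸ gen_mem (show w.length - 1 < w.length + v.length by omega)
  rcases hkn with ⟨hk, hn⟩ | ⟨hk, hn⟩
  · obtain ⟨x, hx⟩ := gen_succ (show w.length + v.length - 2 + 1 < w.length + v.length by omega)
      (by omega)
    rw [show w.length + v.length - 2 + 1 = w.length + v.length - 1 by omega] at hx
    have hxK := hx ▸ gen_mem (show w.length + v.length - 1 < w.length + v.length by omega)
    rw [hy, hx]
    exact rcomm_inj_inj_mem hw conjInvariant_smallClosure h0 hyK hxK
  · obtain ⟨z, h1, h2⟩ := exists_sec_gen_length hw hv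
    rw [show w.length + v.length - 1 = w.length by omega] at h2 ⊢
    obtain ⟨x, hx⟩ := gen_succ (show w.length - 3 + 1 < w.length + v.length by omega) (by omega)
    rw [show w.length - 3 + 1 = w.length - 2 by omega] at hx
    have hxK := hx ▸ gen_mem (show w.length - 2 < w.length + v.length by omega)
    have hM := conjInvariant_normalClosureIn (kneadingGroup w v)
      {g | ∃ m, m + 2 < w.length ∧ g = gen w v m}
    have hc : rcomm (gen w v (w.length - 2)) (gen w v (w.length - 1)) ∈ normalClosureIn
        (kneadingGroup w v) {g | ∃ m, m + 2 < w.length ∧ g = gen w v m} := by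
      rw [hx] at hy hyK ⊢
      rw [hy]
      exact rcomm_inj_inj_mem hw hM (mem_normalClosureIn ⟨0, by omega, rfl⟩) hxK hyK
    have hinj : inj z (rcomm (gen w v (w.length - 2)) (gen w v (w.length - 1))) ∈
        smallClosure w v := by
      refine inj_mem_of_mem_normalClosureIn hw hv conjInvariant_smallClosure ?_ hc z
      rintro _ ⟨m, hm, rfl⟩
      obtain ⟨y, hy⟩ := gen_succ (show m + 1 < w.length + v.length by omega) (by omega)
      exact ⟨y, hy ▸ gen_mem_smallClosure (by omega) (by omega) (by omega)⟩
    have hz : inj z (rcomm (gen w v (w.length - 2)) (gen w v (w.length - 1))) =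
        rcomm (inj z (gen w v (w.length - 2))) (gen w v w.length) := by
      refine ext_letter z ?_ ?_ ?_ <;> simp [rcomm, flips_gen_length, h1, h2]
    rw [hz] at hinj
    have hzK : inj z (gen w v (w.length - 2)) ∈ kneadingGroup w v :=
      inj_mem_of_inj_mem hw (conjInvariant_self _) hyK z
    rw [hy]
    -- The letter `y` that carries `b_{k-1}` inside `b_k` may differ from `z`; conjugation by `b_1`,
    -- trivial modulo `smallClosure`, repairs this.
    obtain rfl | rfl : y = z ∨ y = !z := by cases y <;> cases z <;> simp
    · exact hinj
    · rw [← rconj_inj_gen_zero (v := v) hw]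
      exact rcomm_rconj_mem conjInvariant_smallClosure hzK (gen_mem (by omega))
        (gen_zero_mem hw) h0 hinj

/-- Modulo `smallClosure` only `b_k` and `a_n` survive, so theirs is the only commutator to check.
-/
theorem commutator_le_smallClosure (hw : w ≠ []) (hv : v ≠ [])
    (hkn : (2 ≤ w.length ∧ 2 ≤ v.length) ∨ (3 ≤ w.length ∧ v.length = 1)) :
    ⁅kneadingGroup w v, kneadingGroup w v⁆ ≤ smallClosure w v := by
  refine commutator_kneadingGroup_le conjInvariant_smallClosure fun l m hlm hm => ?_
  have hM := conjInvariant_smallClosure (w := w) (v := v)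
  by_cases hl : l + 1 = w.length
  · by_cases hm' : m + 1 = w.length + v.length
    · obtain rfl : l = w.length - 1 := by omega
      obtain rfl : m = w.length + v.length - 1 := by omega
      exact rcomm_last_mem_smallClosure hw hv hkn
    · exact hM.rcomm_mem' (gen_mem_smallClosure hm (by omega) hm') (gen_mem (by omega))
  · exact hM.rcomm_mem (gen_mem_smallClosure (by omega) hl (by omega)) (gen_mem hm)

/-- The coordinates on `K'/(K' × K')` are the parities of the section at `false` on all levels but
the last. The section of `[b_1, gen (m + 1)]` has the parities of `gen m` there, so these
commutators give the standard basis. -/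
theorem regularBranch_commutator (hw : w ≠ []) (hv : v ≠ [])
    (hkn : (2 ≤ w.length ∧ 2 ≤ v.length) ∨ (3 ≤ w.length ∧ v.length = 1)) :
    IsRegularBranchOn (kneadingGroup w v) ⁅kneadingGroup w v, kneadingGroup w v⁆ ∧
      QuotientIso ⁅kneadingGroup w v, kneadingGroup w v⁆
        (geomSquare ⁅kneadingGroup w v, kneadingGroup w v⁆)
        (Multiplicative (Fin (w.length + v.length - 1) → ZMod 2)) ∧
      GeneratesQuotient ⁅kneadingGroup w v, kneadingGroup w v⁆
        (geomSquare ⁅kneadingGroup w v, kneadingGroup w v⁆)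
        ({g | ∃ j, 2 ≤ j ∧ j ≤ w.length ∧ g = rcomm (genB w v 1) (genB w v j)} ∪
          {g | ∃ i, 1 ≤ i ∧ i ≤ v.length ∧ g = rcomm (genB w v 1) (genA w v i)}) := by
  have hsq : geomSquare ⁅kneadingGroup w v, kneadingGroup w v⁆ ≤
      ⁅kneadingGroup w v, kneadingGroup w v⁆ :=
    geomSquare_le_of_inj fun g hg x => inj_mem_commutator hw hv hg
      (inj_mem_of_mem_smallClosure hw hv (commutator_le_smallClosure hw hv hkn hg) x)
  have hrc : ∀ m < w.length + v.length - 1, ∀ l < w.length + v.length - 1,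
      sgn l (sec (rcomm (gen w v 0) (gen w v (m + 1))) false) = if m = l then 1 else 0 := by
    intro m hm l hl
    rw [sgn_sec_rcomm_gen_zero hw _ (flips_gen (by omega) (by omega)),
      sgn_gen hw hv (by omega) (by omega)]
    simp
  refine ⟨⟨⟨Subgroup.commutator_le_self _, ?_, hsq⟩, ?_⟩, ?_⟩
  · intro hbot
    have h := hrc 0 (by omega) 0 (by omega)
    have hmem : rcomm (gen w v 0) (gen w v 1) ∈ ⁅kneadingGroup w v, kneadingGroup w v⁆ :=
      rcomm_mem_commutator (gen_mem (by omega)) (gen_mem (by omega))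
    rw [hbot, Subgroup.mem_bot] at hmem
    simp [hmem] at h
  · exact ⟨QuotientIso.relIndex_ne_zero (abelianization_kneadingGroup hw hv).1⟩
  refine quotientIso_of_additive hsq
    (f := fun g (l : Fin (w.length + v.length - 1)) => sgn l (sec g false))
    (fun x hx y hy => funext fun l => ?_) (fun x hx => ?_) ?_
    (mem_of_pi_single_mem fun m => AddSubgroup.subset_closure
      ⟨rcomm (gen w v 0) (gen w v (m + 1)), ?_, funext fun l => ?_⟩)
  · simp [flips_eq_false_of_mem_commutator hx]
  · rw [mem_geomSquare]
    constructor
    · intro h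
      have := sec_mem_commutator hw hv hx fun l hl => congrFun h ⟨l, hl⟩
      exact ⟨flips_eq_false_of_mem_commutator hx, this _, this _⟩
    · rintro ⟨-, h, -⟩
      exact funext fun l => sgn_eq_zero_of_mem_commutator h l
  · rintro _ (⟨j, h1, h2, rfl⟩ | ⟨i, h1, h2, rfl⟩)
    · rw [genB_eq_gen le_rfl (by omega), genB_eq_gen (by omega) h2]
      exact rcomm_mem_commutator (gen_mem (by omega)) (gen_mem (by omega))
    · rw [genB_eq_gen le_rfl (by omega), genA_eq_gen h1]
      exact rcomm_mem_commutator (gen_mem (by omega)) (gen_mem (by omega))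
  · rw [gen_zero hw]
    by_cases h : (m : ℕ) + 1 < w.length
    · exact Or.inl ⟨m + 2, by omega, by omega, by rw [gen_of_lt h]⟩
    · obtain ⟨i, hi⟩ := Nat.exists_eq_add_of_le (show w.length ≤ m + 1 by omega)
      exact Or.inr ⟨i + 1, by omega, by omega, by rw [hi, gen_add i]⟩
  · change sgn l _ = _
    rw [hrc m m.2 l l.2, Pi.single_apply]
    simp [Fin.ext_iff, eq_comm]

end kneading

/-! ### Heisenberg functions and the lift to `ℤ/4` -/

section heisenberg
variable {G : Type*} [Group G]

/-- `q` is a coordinate of a homomorphism from `K` to the Heisenberg group over `ℤ / 2`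
(the dihedral group of order 8), with `f₁` and `f₂` as its other two coordinates. -/
structure IsHeisenberg (K : Subgroup G) (f₁ f₂ q : G → ZMod 2) : Prop where
  add₁ : ∀ x ∈ K, ∀ y ∈ K, f₁ (x * y) = f₁ x + f₁ y
  add₂ : ∀ x ∈ K, ∀ y ∈ K, f₂ (x * y) = f₂ x + f₂ y
  map_mul : ∀ x ∈ K, ∀ y ∈ K, q (x * y) = q x + q y + f₁ x * f₂ y

namespace IsHeisenberg
variable {K : Subgroup G} {f₁ f₂ q : G → ZMod 2}

theorem map_one (h : IsHeisenberg K f₁ f₂ q) : q 1 = 0 := by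
  have h1 := h.map_mul 1 (one_mem K) 1 (one_mem K)
  rw [mul_one, eq_zero_of_additive h.add₁] at h1
  simpa using h1

theorem map_rconj (h : IsHeisenberg K f₁ f₂ q) {x y : G} (hx : x ∈ K) (hy : y ∈ K) :
    q (rconj x y) = q x + f₁ x * f₂ y + f₁ y * f₂ x := by
  have hxy := rconj_mem hx hy
  -- This form of the conjugate avoids a formula for `q` at inverses.
  have e : y * rconj x y = x * y := by simp [rconj, mul_assoc]
  have h1 := h.map_mul y hy _ hxy
  have h2 := h.add₂ y hy _ hxy
  rw [e, h.map_mul x hx y hy] at h1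
  rw [e, h.add₂ x hx y hy] at h2
  revert h1 h2
  generalize q x = a1, q y = a2, q (rconj x y) = a3, f₁ x = a4, f₁ y = a5, f₂ x = a6,
    f₂ y = a7, f₂ (rconj x y) = a8
  revert a1 a2 a3 a4 a5 a6 a7 a8
  decide

/-- The center of the Heisenberg group records commutators through the alternating form of `f₁` and
`f₂`. Among commutators of generators dual to parities, `q` thus sees just one pair when `f₁` and
`f₂` are two of those parities. -/
theorem map_rcomm (h : IsHeisenberg K f₁ f₂ q) {x y : G} (hx : x ∈ K) (hy : y ∈ K) :
    q (rcomm x y) = f₁ x * f₂ y + f₁ y * f₂ x := by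
  have hxy := rcomm_mem hx hy
  have e : y * x * rcomm x y = x * y := by simp [rcomm, mul_assoc]
  have h1 := h.map_mul (y * x) (mul_mem hy hx) _ hxy
  have h2 := h.add₂ (y * x) (mul_mem hy hx) _ hxy
  rw [e, h.map_mul x hx y hy, h.map_mul y hy x hx] at h1
  rw [e, h.add₂ x hx y hy, h.add₂ y hy x hx, add_comm (f₂ x), left_eq_add] at h2
  rw [h2] at h1
  revert h1
  generalize q x = a1, q y = a2, q (rcomm x y) = a3, f₁ x * f₂ y = a4, f₁ y * f₂ x = a5,
    f₁ (y * x) = a6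
  revert a1 a2 a3 a4 a5 a6
  decide

/-- Serves to normalize `q` so that it vanishes on the generators. -/
theorem add_smul (h : IsHeisenberg K f₁ f₂ q) (c₁ c₂ : ZMod 2) :
    IsHeisenberg K f₁ f₂ fun x => q x + c₁ * f₁ x + c₂ * f₂ x where
  add₁ := h.add₁
  add₂ := h.add₂
  map_mul x hx y hy := by
    simp only [h.map_mul x hx y hy, h.add₁ x hx y hy, h.add₂ x hx y hy]; ring

theorem swap (h : IsHeisenberg K f₁ f₂ q) : IsHeisenberg K f₂ f₁ fun x => q x + f₁ x * f₂ x where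
  add₁ := h.add₂
  add₂ := h.add₁
  map_mul x hx y hy := by
    have := CharTwo.add_self_eq_zero (f₁ x * f₂ y)
    simp only [h.map_mul x hx y hy, h.add₁ x hx y hy, h.add₂ x hx y hy]
    linear_combination this

end IsHeisenberg

/-- The lift `f₁ + 2 q` to `ℤ / 4`. -/
def liftFour (a q : ZMod 2) : ZMod 4 := a.val + 2 * q.val

/-- The term `a * b` is the carry when the residues `a` and `b` are added in `ℤ/4`. -/
theorem liftFour_add (a b p q : ZMod 2) :
    liftFour (a + b) (p + q + a * b) = liftFour a p + liftFour b q := by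
  revert a b p q; decide

theorem liftFour_eq_zero {a q : ZMod 2} : liftFour a q = 0 ↔ a = 0 ∧ q = 0 := by
  revert a q; decide

theorem liftFour_one_sq (q : ZMod 2) : liftFour 1 q * liftFour 1 q = 1 := by
  revert q; decide

end heisenberg

section kneading
variable {w v : List Bool}

theorem IsHeisenberg.map_rconj_of_mem_commutator {f₁ f₂ q : TreeAut → ZMod 2}
    (hq : IsHeisenberg (kneadingGroup w v) f₁ f₂ q)
    (h₁ : ∀ g ∈ ⁅kneadingGroup w v, kneadingGroup w v⁆, f₁ g = 0)
    (h₂ : ∀ g ∈ ⁅kneadingGroup w v, kneadingGroup w v⁆, f₂ g = 0) {g h : TreeAut}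
    (hg : g ∈ ⁅kneadingGroup w v, kneadingGroup w v⁆) (hh : h ∈ kneadingGroup w v) :
    q (rconj g h) = q g := by
  rw [hq.map_rconj (mem_of_mem_commutator hg) hh, h₁ g hg, h₂ g hg]
  simp

/-- Passing to the other section exchanges the two parities `f₁` and `f₂`, by
`sgn_sec_eq_sgn_sec_not`. The Heisenberg function for the exchanged pair is `q + f₁ * f₂`, so both
sides obey the same product rule, and both vanish on generators. -/
theorem IsHeisenberg.sec_not (hw : w ≠ []) (hv : v ≠ []) {q : TreeAut → ZMod 2}
    (hq : IsHeisenberg (kneadingGroup w v) (sgn (w.length - 1))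
      (sgn (w.length + v.length - 1)) q)
    (hgen : ∀ m < w.length + v.length, q (gen w v m) = 0) {g : TreeAut}
    (hg : g ∈ kneadingGroup w v) (x : Bool) :
    q (sec g (!x)) = q (sec g x) +
      sgn (w.length - 1) (sec g x) * sgn (w.length + v.length - 1) (sec g x) := by
  have hk := List.length_pos_iff.2 hw
  have hn := List.length_pos_iff.2 hv
  have hprod : ∀ m < w.length + v.length,
      sgn (w.length - 1) (gen w v m) * sgn (w.length + v.length - 1) (gen w v m) = 0 := by
    intro m hm
    rw [sgn_gen hw hv (by omega) hm, sgn_gen hw hv (by omega) hm]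
    split_ifs <;> first | omega | simp
  induction hg using kneadingGroup_induction generalizing x with
  | hgen m hm =>
    rcases m with _ | m
    · simp [sec_gen_zero hw]
    · have key : ∀ y, sec (gen w v (m + 1)) y = 1 ∨
          ∃ l < w.length + v.length, sec (gen w v (m + 1)) y = gen w v l := by
        intro y
        by_cases hmk : m + 1 = w.length
        · obtain ⟨z, h1, h2⟩ := exists_sec_gen_length hw hv
          rw [hmk]
          obtain rfl | rfl : y = z ∨ y = !z := by cases y <;> cases z <;> simp
          · exact Or.inr ⟨_, by omega, h1⟩
          · exact Or.inr ⟨_, by omega, h2⟩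
        · obtain ⟨z, hz⟩ := gen_succ hm hmk
          rw [hz, sec_inj]
          split_ifs
          · exact Or.inr ⟨m, by omega, rfl⟩
          · exact Or.inl rfl
      have key2 : ∀ y, q (sec (gen w v (m + 1)) y) = 0 := by
        intro y
        obtain h | ⟨l, hl, h⟩ := key y
        · rw [h, hq.map_one]
        · rw [h, hgen l hl]
      rw [key2, key2]
      obtain h | ⟨l, hl, h⟩ := key x
      · simp [h]
      · rw [h, hprod l hl, add_zero]
  | one => simp [hq.map_one]
  | mul g h hg hh ihg ihh =>
    have hx : ((!x) ^^ flips g) = !(x ^^ flips g) := by cases x <;> cases flips g <;> rfl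
    have e1 := sgn_sec_eq_sgn_sec_not hw hv hg (!x)
    have e2 := sgn_sec_eq_sgn_sec_not hw hv hh (x ^^ flips g)
    rw [Bool.not_not] at e1
    rw [sec_mul, sec_mul, hx, hq.map_mul _ (sec_mem hw hv hg _) _ (sec_mem hw hv hh _),
      hq.map_mul _ (sec_mem hw hv hg _) _ (sec_mem hw hv hh _), ihg, ihh, e1, ← e2,
      sgn_mul, sgn_mul]
    generalize q (sec g x) = a1, q (sec h (x ^^ flips g)) = a2,
      sgn (w.length - 1) (sec g x) = a3, sgn (w.length - 1) (sec h (x ^^ flips g)) = a4,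
      sgn (w.length + v.length - 1) (sec g x) = a5,
      sgn (w.length + v.length - 1) (sec h (x ^^ flips g)) = a6
    revert a1 a2 a3 a4 a5 a6
    decide

/-- On sections of elements of `K'` the two parities in the cocycle agree (`sgn_sec_last_eq`), so
the cocycle is the carry in `ℤ/4`. -/
theorem IsHeisenberg.liftFour_sec_mul (hw : w ≠ []) (hv : v ≠ []) {q : TreeAut → ZMod 2}
    (hq : IsHeisenberg (kneadingGroup w v) (sgn (w.length - 1))
      (sgn (w.length + v.length - 1)) q) {g h : TreeAut}
    (hg : g ∈ ⁅kneadingGroup w v, kneadingGroup w v⁆)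
    (hh : h ∈ ⁅kneadingGroup w v, kneadingGroup w v⁆) :
    liftFour (sgn (w.length - 1) (sec (g * h) false)) (q (sec (g * h) false)) =
      liftFour (sgn (w.length - 1) (sec g false)) (q (sec g false)) +
        liftFour (sgn (w.length - 1) (sec h false)) (q (sec h false)) := by
  rw [sec_mul, flips_eq_false_of_mem_commutator hg, Bool.false_xor, sgn_mul,
    hq.map_mul _ (sec_mem hw hv (mem_of_mem_commutator hg) _) _
      (sec_mem hw hv (mem_of_mem_commutator hh) _), sgn_sec_last_eq hw hv hh, liftFour_add]

/-- The commutator of `b_1` with an involution supported on one subtree is an involution. -/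
theorem rcomm_inj_gen_zero_mul_self (hw : w ≠ []) (x : Bool) {g : TreeAut} (hg : g * g = 1) :
    rcomm (inj x g) (gen w v 0) * rcomm (inj x g) (gen w v 0) = 1 := by
  have hi : g⁻¹ = g := inv_eq_of_mul_eq_one_left hg
  refine ext_letter x ?_ ?_ ?_ <;> cases x <;>
    simp [rcomm, flips_gen_zero hw, sec_gen_zero hw, hi, hg, sec_inj]

/-- For `k = 1`: a Heisenberg function on `K(w, v)` that vanishes on the generators. -/
theorem exists_isHeisenberg_of_length_eq_one (hw : w ≠ []) (hv : v ≠ []) (hk : w.length = 1)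
    (hn : 2 ≤ v.length) :
    ∃ q : TreeAut → ZMod 2, IsHeisenberg (kneadingGroup w v) (sgn (w.length - 1))
        (sgn (w.length + v.length - 1)) q ∧
      (∀ m < w.length + v.length, q (gen w v m) = 0) ∧
      ∃ c, ∀ g, q g = sgn (v.length - 1) (sec g false) + c * sgn v.length g := by
  have hlast : w.length + v.length - 1 = v.length := by omega
  have hfirst : w.length - 1 = 0 := by omega
  rw [hlast, hfirst]
  -- If `x` is active, the section of `x * y` at `false` contains the section of `y` at `true`
  -- instead of `false`; the parities of these two differ by `sgn v.length y`.
  have h0 : IsHeisenberg (kneadingGroup w v) (sgn 0) (sgn v.length)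
      fun g => sgn (v.length - 1) (sec g false) := by
    refine ⟨fun _ _ _ _ => sgn_mul .., fun _ _ _ _ => sgn_mul .., fun x _ y _ => ?_⟩
    obtain ⟨n, hn'⟩ : ∃ n, v.length = n + 1 := ⟨v.length - 1, by omega⟩
    simp only [hn', Nat.add_sub_cancel, sec_mul, sgn_mul, sgn_succ, sgn]
    cases flips x
    · simp
    · have := CharTwo.add_self_eq_zero (sgn n (sec y false))
      simp only [Bool.false_xor, if_true]
      linear_combination -this
  -- Since `k = 1`, `gen w v v.length` is `a_n`, the only generator on which the function may be
  -- nonzero; the dual parity `sgn v.length` corrects it.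
  set c := sgn (v.length - 1) (sec (gen w v v.length) false) with hc
  refine ⟨_, h0.add_smul 0 c, ?_, c, fun g => by ring⟩
  intro m hm
  have hsgn : sgn v.length (gen w v m) = if m = v.length then 1 else 0 :=
    sgn_gen hw hv (by omega) hm
  simp only [hsgn]
  by_cases hmn : m = v.length
  · rw [hmn, ← hc, if_pos rfl, zero_mul, add_zero, mul_one]
    exact CharTwo.add_self_eq_zero c
  rw [if_neg hmn, mul_zero, zero_mul, add_zero, add_zero]
  rcases m with _ | m
  · rw [sec_gen_zero hw, sgn_one]
  by_cases hmk : m + 1 = w.length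
  · obtain ⟨z, h1, h2⟩ := exists_sec_gen_length hw hv
    rw [hmk]
    obtain h | h : false = z ∨ false = !z := by cases z <;> simp
    · rw [h, h1, sgn_gen hw hv (by omega) (by omega), if_neg (by omega)]
    · rw [h, h2, sgn_gen hw hv (by omega) (by omega), if_neg (by omega)]
  · obtain ⟨x, hx⟩ := gen_succ hm hmk
    rw [hx, sec_inj]
    split_ifs
    · rw [sgn_gen hw hv (by omega) (by omega), if_neg (by omega)]
    · rw [sgn_one]

/-! ### The case `k = 1`, `n ≥ 2` -/

section subgroupL₁

theorem conjInvariant_subgroupL₁ : ConjInvariant (kneadingGroup w v) (subgroupL₁ w v) :=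
  conjInvariant_normalClosureIn _ _

theorem subgroupL₁_le {M : Subgroup TreeAut} (hw : w ≠ []) (hk : w.length = 1)
    (hM : ConjInvariant (kneadingGroup w v) M)
    (h : ∀ i j, 1 ≤ i → i < j → j ≤ v.length → rcomm (gen w v i) (gen w v j) ∈ M)
    (h0 : ∀ i, 1 ≤ i → i < v.length → rcomm (gen w v i) (gen w v 0) ∈ M) :
    subgroupL₁ w v ≤ M := by
  have hA : ∀ i, 1 ≤ i → genA w v i = gen w v i := fun i hi => by
    rw [genA_eq_gen hi, hk, Nat.add_sub_cancel_left]
  refine normalClosureIn_le hM ?_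
  rintro _ (⟨i, j, h1, h2, h3, rfl⟩ | ⟨i, h1, h2, rfl⟩)
  · rw [hA i h1, hA j (by omega)]; exact h i j h1 h2 h3
  · rw [hA i h1, ← gen_zero hw]; exact h0 i h1 h2

theorem rcomm_gen_mem_subgroupL₁ (hk : w.length = 1) {i j : ℕ} (h1 : 1 ≤ i) (h2 : i < j)
    (h3 : j ≤ v.length) : rcomm (gen w v i) (gen w v j) ∈ subgroupL₁ w v := by
  have hA : ∀ i, 1 ≤ i → genA w v i = gen w v i := fun i hi => by
    rw [genA_eq_gen hi, hk, Nat.add_sub_cancel_left]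
  exact mem_normalClosureIn (Or.inl ⟨i, j, h1, h2, h3, by rw [hA i h1, hA j (by omega)]⟩)

theorem rcomm_gen_zero_mem_subgroupL₁ (hw : w ≠ []) (hk : w.length = 1) {i : ℕ} (h1 : 1 ≤ i)
    (h2 : i < v.length) : rcomm (gen w v i) (gen w v 0) ∈ subgroupL₁ w v := by
  refine mem_normalClosureIn (Or.inr ⟨i, h1, h2, ?_⟩)
  rw [genA_eq_gen h1, hk, Nat.add_sub_cancel_left, gen_zero hw]

theorem subgroupL₁_le_commutator (hw : w ≠ []) (hk : w.length = 1) :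
    subgroupL₁ w v ≤ ⁅kneadingGroup w v, kneadingGroup w v⁆ :=
  subgroupL₁_le hw hk (conjInvariant_commutator _)
    (fun _ _ _ _ _ => rcomm_mem_commutator (gen_mem (by omega)) (gen_mem (by omega)))
    (fun _ _ _ => rcomm_mem_commutator (gen_mem (by omega)) (gen_mem (by omega)))

theorem subgroupL₁_le_smallClosure (hw : w ≠ []) (hk : w.length = 1) :
    subgroupL₁ w v ≤ smallClosure w v :=
  subgroupL₁_le hw hk conjInvariant_smallClosure
    (fun _ _ _ _ _ => conjInvariant_smallClosure.rcomm_mem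
      (gen_mem_smallClosure (by omega) (by omega) (by omega)) (gen_mem (by omega)))
    (fun _ _ _ => conjInvariant_smallClosure.rcomm_mem
      (gen_mem_smallClosure (by omega) (by omega) (by omega)) (gen_mem (by omega)))

/-- Modulo `L` the only commutator of generators left is `[a_n, b_1]`. The involutions `a_n` and
`b_1` invert it, and every other generator commutes with both, so its powers form a normal subgroup
modulo `L`. -/
theorem generatesQuotient_subgroupL₁ (hw : w ≠ []) (hk : w.length = 1) (hn : 2 ≤ v.length) :
    GeneratesQuotient ⁅kneadingGroup w v, kneadingGroup w v⁆ (subgroupL₁ w v)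
      {rcomm (gen w v v.length) (gen w v 0)} := by
  have hcK : rcomm (gen w v v.length) (gen w v 0) ∈ ⁅kneadingGroup w v, kneadingGroup w v⁆ :=
    rcomm_mem_commutator (gen_mem (by omega)) (gen_mem (by omega))
  have hL := conjInvariant_subgroupL₁ (w := w) (v := v)
  have hc : rcomm (gen w v v.length) (gen w v 0) ∈
      Subgroup.closure {rcomm (gen w v v.length) (gen w v 0)} ⊔ subgroupL₁ w v :=
    Subgroup.mem_sup_left (Subgroup.subset_closure rfl)
  refine ⟨by simpa using hcK, le_antisymm
    (sup_le ((Subgroup.closure_le _).2 (by simpa using hcK)) (subgroupL₁_le_commutator hw hk)) ?_⟩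
  refine commutator_kneadingGroup_le (conjInvariant_kneadingGroup_sup hL ?_) ?_
  · rintro s rfl m hm
    by_cases h0 : m = 0
    · rw [h0, rconj_rcomm_right (gen_mul_self _)]
      exact inv_mem hc
    by_cases hn' : m = v.length
    · rw [hn', rconj_rcomm_left (gen_mul_self _)]
      exact inv_mem hc
    have : rcomm (rcomm (gen w v v.length) (gen w v 0)) (gen w v m) ∈ subgroupL₁ w v := by
      refine rcomm_rcomm_mem hL (gen_mem (by omega)) (gen_mem (by omega)) (gen_mem hm) ?_ ?_
      · rw [← rcomm_inv]
        exact inv_mem (rcomm_gen_mem_subgroupL₁ hk (by omega) (by omega) le_rfl)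
      · rw [← rcomm_inv]
        exact inv_mem (rcomm_gen_zero_mem_subgroupL₁ hw hk (by omega) (by omega))
    rw [rcomm_eq] at this
    have h2 := mul_mem hc (Subgroup.mem_sup_right this)
    rwa [mul_inv_cancel_left] at h2
  · intro l m hlm hm
    by_cases hl : l = 0
    · rw [hl, ← rcomm_inv (gen w v m)]
      apply inv_mem
      by_cases hn' : m = v.length
      · rw [hn']; exact hc
      · exact Subgroup.mem_sup_right
          (rcomm_gen_zero_mem_subgroupL₁ hw hk (by omega) (by omega))
    · exact Subgroup.mem_sup_right
        (rcomm_gen_mem_subgroupL₁ hk (by omega) (by omega) (by omega))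

variable {q : TreeAut → ZMod 2}

theorem IsHeisenberg.map_mul_of_mem_commutator {f₁ : ℕ}
    {f₂ : TreeAut → ZMod 2} (hq : IsHeisenberg (kneadingGroup w v) (sgn f₁) f₂ q) (x : TreeAut)
    (hx : x ∈ ⁅kneadingGroup w v, kneadingGroup w v⁆) (y : TreeAut)
    (hy : y ∈ ⁅kneadingGroup w v, kneadingGroup w v⁆) : q (x * y) = q x + q y := by
  rw [hq.map_mul x (mem_of_mem_commutator hx) y (mem_of_mem_commutator hy),
    sgn_eq_zero_of_mem_commutator hx, zero_mul, add_zero]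

/-- The form behind `q` pairs only `b_1` with `a_n`, so `q` kills the generators of `L` and is `1`
on `[a_n, b_1]`. This commutator is an involution, as `a_n` is the copy of `a_{n-1}` on one subtree,
and it generates `K'/L`. -/
theorem mem_subgroupL₁_iff (hw : w ≠ []) (hv : v ≠ []) (hk : w.length = 1) (hn : 2 ≤ v.length)
    (hq : IsHeisenberg (kneadingGroup w v) (sgn (w.length - 1))
        (sgn (w.length + v.length - 1)) q) {g : TreeAut} :
    g ∈ subgroupL₁ w v ↔ g ∈ ⁅kneadingGroup w v, kneadingGroup w v⁆ ∧ q g = 0 := by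
  have hadd := hq.map_mul_of_mem_commutator
  have hle : ∀ g ∈ subgroupL₁ w v,
      g ∈ ⁅kneadingGroup w v, kneadingGroup w v⁆ ∧ q g = 0 := by
    have hM : ConjInvariant (kneadingGroup w v) (kerOn _ q hadd) := fun m hm h hh =>
      ⟨conjInvariant_commutator _ m hm.1 h hh, by
        rw [hq.map_rconj_of_mem_commutator (fun g hg => sgn_eq_zero_of_mem_commutator hg _)
          (fun g hg => sgn_eq_zero_of_mem_commutator hg _) hm.1 hh, hm.2]⟩
    have hmem : ∀ i j, i < w.length + v.length → j < w.length + v.length → i ≠ j →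
        (i ≠ 0 ∨ j ≠ v.length) → (j ≠ 0 ∨ i ≠ v.length) →
        rcomm (gen w v i) (gen w v j) ∈ kerOn _ q hadd := by
      intro i j hi hj hij h1 h2
      refine ⟨rcomm_mem_commutator (gen_mem hi) (gen_mem hj), ?_⟩
      rw [hq.map_rcomm (gen_mem hi) (gen_mem hj), sgn_gen hw hv (by omega) hi,
        sgn_gen hw hv (by omega) hj, sgn_gen hw hv (by omega) hi, sgn_gen hw hv (by omega) hj]
      split_ifs <;> first | omega | simp
    exact subgroupL₁_le hw hk hM (fun i j _ _ _ => hmem i j (by omega) (by omega) (by omega)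
      (by omega) (by omega)) (fun i _ _ => hmem i 0 (by omega) (by omega) (by omega)
      (by omega) (by omega))
  refine ⟨hle g, fun ⟨hg, hqg⟩ => ?_⟩
  have hgen := generatesQuotient_subgroupL₁ (v := v) hw hk hn
  have hL := (conjInvariant_subgroupL₁ (w := w) (v := v)).mono
    (Subgroup.commutator_le_self (kneadingGroup w v))
  refine mem_of_additive_eq_zero (ι := Unit) hL (f := fun g _ => q g)
    (g := fun _ => rcomm (gen w v v.length) (gen w v 0))
    (fun x hx y hy => funext fun _ => hadd x hx y hy) (fun x hx => funext fun _ => (hle x hx).2)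
    (fun i => funext fun j => ?_) (fun i => ?_) ?_ ?_ hg (funext fun _ => hqg)
  · rw [hq.map_rcomm (gen_mem (by omega)) (gen_mem (by omega)),
      sgn_gen hw hv (by omega) (by omega), sgn_gen hw hv (by omega) (by omega),
      sgn_gen hw hv (by omega) (by omega), sgn_gen hw hv (by omega) (by omega)]
    simp only [Pi.single_apply]
    rw [if_neg (by omega), if_neg (by omega), if_pos (by omega), if_pos (by omega)]
    simp
  · obtain ⟨x, hx⟩ := gen_succ (show v.length - 1 + 1 < w.length + v.length by omega) (by omega)
    rw [Nat.sub_add_cancel (by omega)] at hx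
    rw [hx, rcomm_inj_gen_zero_mul_self hw x (gen_mul_self _)]
    exact one_mem _
  · refine commutator_le_of_generatesQuotient (subgroupL₁_le_commutator hw hk) hL hgen ?_
    rintro _ rfl _ rfl
    rw [rcomm_eq_one_iff.2 rfl]; exact one_mem _
  · rwa [Set.range_const]

end subgroupL₁

theorem closure_eq_of_liftFour {m : ℕ} {P : AddSubgroup (ZMod 4 × (Fin m → ZMod 2))} {u : ZMod 4}
    (hu : u * u = 1) (h1 : (u, 0) ∈ P) (h2 : ∀ i, (0, Pi.single i 1) ∈ P)
    (a : ZMod 4 × (Fin m → ZMod 2)) : a ∈ P := by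
  have ha : a = (a.1, 0) + (0, a.2) := by simp
  rw [ha]
  refine add_mem ?_ ?_
  · have : ((a.1, 0) : ZMod 4 × (Fin m → ZMod 2)) = (a.1 * u).val • (u, 0) := by
      rw [Prod.smul_mk, smul_zero, nsmul_eq_mul, ZMod.natCast_zmod_val, mul_assoc, hu, mul_one]
    rw [this]
    exact nsmul_mem h1 _
  · exact mem_of_pi_single_mem (P := P.comap (AddMonoidHom.inr (ZMod 4) (Fin m → ZMod 2))) h2 a.2

/-- The coordinates on `L/(L × L)` are taken from the section at `false`: its parity on level `0`
combined with its `q`-value into `ℤ/4`, and its parities on levels `1, …, n - 2`. Level `n - 1` is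
missing because its parity is the `q`-value of the element itself, which is zero on `L`. -/
theorem regularBranch_subgroupL₁ (hw : w ≠ []) (hv : v ≠ []) (hk : w.length = 1)
    (hn : 2 ≤ v.length) :
    IsRegularBranchOn (kneadingGroup w v) (subgroupL₁ w v) ∧
      QuotientIso ⁅kneadingGroup w v, kneadingGroup w v⁆ (subgroupL₁ w v)
        (Multiplicative (ZMod 2)) ∧
      GeneratesQuotient ⁅kneadingGroup w v, kneadingGroup w v⁆ (subgroupL₁ w v)
        {rcomm (genA w v v.length) (genB w v 1)} ∧
      QuotientIso (subgroupL₁ w v) (geomSquare (subgroupL₁ w v))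
        (Multiplicative (ZMod 4 × (Fin (v.length - 2) → ZMod 2))) ∧
      GeneratesQuotient (subgroupL₁ w v) (geomSquare (subgroupL₁ w v))
        {g | ∃ i, 1 ≤ i ∧ i < v.length ∧ g = rcomm (genA w v i) (genB w v 1)} ∧
      HasOrderMod (geomSquare (subgroupL₁ w v)) (rcomm (genA w v 1) (genB w v 1)) 4 ∧
      ∀ i, 2 ≤ i → i < v.length →
        HasOrderMod (geomSquare (subgroupL₁ w v)) (rcomm (genA w v i) (genB w v 1)) 2 := by
  have hA : ∀ i, 1 ≤ i → genA w v i = gen w v i := fun i hi => by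
    rw [genA_eq_gen hi, hk, Nat.add_sub_cancel_left]
  obtain ⟨q, hq, hqgen, c, hqc⟩ := exists_isHeisenberg_of_length_eq_one hw hv hk hn
  have hmem : ∀ {g}, g ∈ subgroupL₁ w v ↔ _ := mem_subgroupL₁_iff hw hv hk hn hq
  have hLK' := subgroupL₁_le_commutator (v := v) hw hk
  have hsq : geomSquare (subgroupL₁ w v) ≤ subgroupL₁ w v := by
    refine geomSquare_le_of_inj fun g hg x => hmem.2 ⟨inj_mem_commutator hw hv (hLK' hg)
      (inj_mem_of_mem_smallClosure hw hv (subgroupL₁_le_smallClosure hw hk hg) x), ?_⟩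
    have h1 : sgn v.length (inj x g) = 0 := by
      obtain ⟨n, hn'⟩ : ∃ n, v.length = n + 1 := ⟨v.length - 1, by omega⟩
      rw [hn', sgn_inj, sgn_eq_zero_of_mem_commutator (hLK' hg)]
    rw [hqc, h1, sec_inj]
    split_ifs <;> simp [sgn_eq_zero_of_mem_commutator (hLK' hg)]
  have hiso1 : QuotientIso ⁅kneadingGroup w v, kneadingGroup w v⁆ (subgroupL₁ w v)
      (Multiplicative (ZMod 2)) := by
    refine (quotientIso_of_additive hLK' hq.map_mul_of_mem_commutator
      (fun x hx => by rw [hmem]; exact ⟨fun h => ⟨hx, h⟩, fun h => h.2⟩)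
      (S := (⁅kneadingGroup w v, kneadingGroup w v⁆ : Subgroup TreeAut)) subset_rfl fun a => ?_).1
    have h1 : (1 : ZMod 2) ∈ AddSubgroup.closure
        (q '' (⁅kneadingGroup w v, kneadingGroup w v⁆ : Subgroup TreeAut)) := by
      refine AddSubgroup.subset_closure ⟨rcomm (gen w v v.length) (gen w v 0),
        rcomm_mem_commutator (gen_mem (by omega)) (gen_mem (by omega)), ?_⟩
      rw [hq.map_rcomm (gen_mem (by omega)) (gen_mem (by omega)),
        sgn_gen hw hv (by omega) (by omega), sgn_gen hw hv (by omega) (by omega),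
        sgn_gen hw hv (by omega) (by omega), sgn_gen hw hv (by omega) (by omega)]
      rw [if_neg (by omega), if_neg (by omega), if_pos (by omega), if_pos (by omega)]
      rfl
    have := nsmul_mem h1 a.val
    rwa [nsmul_one, ZMod.natCast_zmod_val] at this
  let f : TreeAut → ZMod 4 × (Fin (v.length - 2) → ZMod 2) := fun g =>
    (liftFour (sgn (w.length - 1) (sec g false)) (q (sec g false)),
      fun i => sgn (i + 1) (sec g false))
  have hadd : ∀ x ∈ subgroupL₁ w v, ∀ y ∈ subgroupL₁ w v, f (x * y) = f x + f y := by
    intro x hx y hy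
    refine Prod.ext (hq.liftFour_sec_mul hw hv (hLK' hx) (hLK' hy)) (funext fun i => ?_)
    simp [f, flips_eq_false_of_mem_commutator (hLK' hx)]
  have hker : ∀ x ∈ subgroupL₁ w v, f x = 0 ↔ x ∈ geomSquare (subgroupL₁ w v) := by
    intro x hx
    have hxK' := hLK' hx
    rw [mem_geomSquare]
    constructor
    · intro h
      obtain ⟨h1, h2⟩ := Prod.ext_iff.1 h
      obtain ⟨h3, h4⟩ := liftFour_eq_zero.1 h1
      have hqx := (hmem.1 hx).2
      rw [hqc, sgn_eq_zero_of_mem_commutator hxK', mul_zero, add_zero] at hqx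
      have hs := sec_mem_commutator hw hv hxK' fun l hl => by
        by_cases hl0 : l = 0
        · rwa [hl0, ← show w.length - 1 = 0 by omega]
        by_cases hl1 : l = v.length - 1
        · rwa [hl1]
        · have := congrFun h2 ⟨l - 1, by omega⟩
          simpa [f, Nat.sub_add_cancel (Nat.one_le_iff_ne_zero.2 hl0)] using this
      refine ⟨flips_eq_false_of_mem_commutator hxK', hmem.2 ⟨hs _, h4⟩, hmem.2 ⟨hs _, ?_⟩⟩
      -- The map `f` records `q` at `false` only; once the level-`0` parity vanishes, `q` has the
      -- same value at `true`.
      have := hq.sec_not hw hv hqgen (mem_of_mem_commutator hxK') false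
      rwa [h3, h4, zero_mul, add_zero] at this
    · rintro ⟨-, h, -⟩
      refine Prod.ext (liftFour_eq_zero.2 ⟨?_, (hmem.1 h).2⟩) (funext fun i => ?_)
      · exact sgn_eq_zero_of_mem_commutator (hLK' h) _
      · exact sgn_eq_zero_of_mem_commutator (hLK' h) _
  have hsec : ∀ m, flips (gen w v m) = false → sec (rcomm (gen w v m) (gen w v 0)) false =
      sec (gen w v m) false * sec (gen w v m) true := by
    intro m hf
    have : rcomm (gen w v m) (gen w v 0) = gen w v m * gen w v 0 * gen w v m * gen w v 0 := by
      simp [rcomm]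
    rw [this]
    simp [flips_gen_zero hw, sec_gen_zero hw, hf]
  -- The section is `b_1 a_n` or `a_n b_1` according to the last letter of `w`, and `u` is `-1` or
  -- `1` accordingly. Only that `u` is its own inverse matters.
  have hf1 : ∃ u, u * u = 1 ∧ f (rcomm (gen w v 1) (gen w v 0)) = (u, 0) := by
    have hs : ∃ l m, l < w.length + v.length ∧ m < w.length + v.length ∧
        ((l = 0 ∧ m = v.length) ∨ (l = v.length ∧ m = 0)) ∧
        sec (rcomm (gen w v 1) (gen w v 0)) false = gen w v l * gen w v m := by
      obtain ⟨z, h1, h2⟩ := exists_sec_gen_length hw hv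
      rw [hsec 1 (flips_gen (by omega) (by omega)), ← hk]
      rw [show w.length - 1 = 0 by omega] at h1
      rw [show w.length + v.length - 1 = v.length by omega] at h2
      cases z
      · exact ⟨0, v.length, by omega, by omega, by omega, by rw [h1, ← h2]; rfl⟩
      · exact ⟨v.length, 0, by omega, by omega, by omega, by rw [h1, ← h2]; rfl⟩
    obtain ⟨l, m, hl, hm, hlm, hs⟩ := hs
    refine ⟨_, ?_, Prod.ext rfl (funext fun i => ?_)⟩
    · have : sgn (w.length - 1) (sec (rcomm (gen w v 1) (gen w v 0)) false) = 1 := by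
        rw [hs, sgn_mul, sgn_gen hw hv (by omega) hl, sgn_gen hw hv (by omega) hm]
        split_ifs <;> first | omega | simp
      change liftFour (sgn _ _) _ * liftFour (sgn _ _) _ = 1
      rw [this]
      exact liftFour_one_sq _
    · have hi := i.2
      change sgn (i + 1) _ = 0
      rw [hs, sgn_mul, sgn_gen hw hv (by omega) hl, sgn_gen hw hv (by omega) hm]
      split_ifs <;> first | omega | simp
  have hf2 : ∀ i : Fin (v.length - 2),
      f (rcomm (gen w v (i + 2)) (gen w v 0)) = (0, Pi.single i 1) := by
    intro i
    have hi := i.2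
    have hs : sec (rcomm (gen w v (i + 2)) (gen w v 0)) false = gen w v (i + 1) := by
      rw [hsec _ (flips_gen (by omega) (by omega))]
      obtain ⟨x, hx⟩ := gen_succ (show (i : ℕ) + 1 + 1 < w.length + v.length by omega)
        (by omega)
      rw [hx]
      cases x <;> simp [sec_inj]
    refine Prod.ext (liftFour_eq_zero.2 ?_) (funext fun j => ?_)
    · rw [hs, hqgen _ (by omega), sgn_gen hw hv (by omega) (by omega), if_neg (by omega)]
      exact ⟨rfl, rfl⟩
    · have hj := j.2
      change sgn (j + 1) _ = (Pi.single i 1 : Fin (v.length - 2) → ZMod 2) j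
      rw [hs, sgn_gen hw hv (by omega) (by omega), Pi.single_apply]
      simp [Fin.ext_iff, eq_comm]
  obtain ⟨u, hu, hf1⟩ := hf1
  have hiso2 := quotientIso_of_additive hsq hadd hker
    (S := {g | ∃ i, 1 ≤ i ∧ i < v.length ∧ g = rcomm (genA w v i) (genB w v 1)}) (by
      rintro _ ⟨i, h1, h2, rfl⟩
      rw [hA i h1, ← gen_zero hw]
      exact rcomm_gen_zero_mem_subgroupL₁ hw hk h1 h2)
    (closure_eq_of_liftFour hu
      (AddSubgroup.subset_closure ⟨_, ⟨1, by omega, by omega, rfl⟩, by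
        rw [hA 1 le_rfl, ← gen_zero hw, hf1]⟩)
      fun i => AddSubgroup.subset_closure ⟨_, ⟨i + 2, by omega, by omega, rfl⟩, by
        rw [hA _ (by omega), ← gen_zero hw, hf2]⟩)
  have hord : HasOrderMod (geomSquare (subgroupL₁ w v)) (rcomm (genA w v 1) (genB w v 1)) 4 := by
    intro m
    have hx := rcomm_gen_zero_mem_subgroupL₁ (v := v) hw hk le_rfl hn
    rw [hA 1 le_rfl, ← gen_zero hw, ← hker _ (pow_mem hx m), pow_of_additive hadd hx, hf1,
      Prod.smul_mk, smul_zero, Prod.mk_eq_zero, ← ZMod.natCast_eq_zero_iff, nsmul_eq_mul]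
    refine ⟨fun h => ?_, fun h => by simp [h]⟩
    have := congrArg (· * u) h.1
    simpa [mul_assoc, hu] using this
  refine ⟨⟨⟨hLK'.trans (Subgroup.commutator_le_self _), ?_, hsq⟩, ⟨?_⟩⟩, hiso1, ?_, hiso2.1,
    hiso2.2, hord, ?_⟩
  · intro hbot
    have hx := rcomm_gen_zero_mem_subgroupL₁ (v := v) hw hk le_rfl hn
    rw [hbot, Subgroup.mem_bot] at hx
    have := (hord 1).1
    rw [hA 1 le_rfl, ← gen_zero hw, hx, one_pow] at this
    have := this (one_mem _)
    omega
  · exact Subgroup.relIndex_ne_zero_trans (QuotientIso.relIndex_ne_zero hiso1)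
      (QuotientIso.relIndex_ne_zero (abelianization_kneadingGroup hw hv).1)
  · rw [hA _ (by omega), ← gen_zero hw]
    exact generatesQuotient_subgroupL₁ hw hk hn
  · intro i h1 h2 m
    have hx := rcomm_gen_zero_mem_subgroupL₁ (i := i) hw hk (by omega) h2
    have hfi := hf2 ⟨i - 2, by omega⟩
    simp only [Nat.sub_add_cancel h1] at hfi
    rw [hA i (by omega), ← gen_zero hw, ← hker _ (pow_mem hx m), pow_of_additive hadd hx, hfi,
      Prod.smul_mk, smul_zero, Prod.mk_eq_zero, ← ZMod.natCast_eq_zero_iff, ← Pi.single_smul,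
      Pi.single_eq_zero_iff, nsmul_one]
    exact ⟨fun h => h.2, fun h => ⟨rfl, h⟩⟩

end kneading

/-! ### The case `k = 2`, `n = 1`: relations among three involutions -/

section involutions
variable {Q : Type*} [Group Q] {s b a : Q}

theorem conj_eq_conj_of_commute (hb : b * b = 1) (ha : a * a = 1)
    (h : s * (b * a) = b * a * s) : a * s * a = b * s * b := by
  calc a * s * a = b * b * (a * s * a) := by rw [hb, one_mul]
    _ = b * (b * a * s) * a := by simp only [mul_assoc]
    _ = b * s * b * (a * a) := by rw [← h]; simp only [mul_assoc]
    _ = b * s * b := by rw [ha, mul_one]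

theorem rcomm_eq_of_involutions (hs : s * s = 1) (hb : b * b = 1) :
    rcomm s b = s * (b * s * b) := by
  rw [rcomm, inv_eq_of_mul_eq_one_left hs, inv_eq_of_mul_eq_one_left hb]
  simp only [mul_assoc]

theorem rcomm_eq_rcomm_of_commute (hs : s * s = 1) (hb : b * b = 1) (ha : a * a = 1)
    (h : s * (b * a) = b * a * s) : rcomm s a = rcomm s b := by
  rw [rcomm_eq_of_involutions hs ha, rcomm_eq_of_involutions hs hb,
    conj_eq_conj_of_commute hb ha h]

theorem rconj_rcomm_of_commute (hs : s * s = 1) (hb : b * b = 1) (ha : a * a = 1)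
    (h : s * (b * a) = b * a * s) : rconj (rcomm s b) a = (rcomm s b)⁻¹ := by
  rw [← rcomm_eq_rcomm_of_commute hs hb ha h, rconj_rcomm_right ha]

theorem rconj_rcomm_of_commute' (hb : b * b = 1) (ha : a * a = 1)
    (h : s * (b * a) = b * a * s) : rconj (rcomm b a) s = rcomm b a := by
  have hc : Commute s (b * a) := h
  have e : rcomm b a = b * a * (b * a) := by
    rw [rcomm_eq_of_involutions hb ha]; simp only [mul_assoc]
  rw [e, rconj, mul_assoc, ← (hc.mul_right hc).eq, inv_mul_cancel_left]

/-- Here `[s, b] = s * (b * s * b)` and `[b, a] = (b * a)²`, and both `s` and `b * s * b` commute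
with `b * a`. -/
theorem rcomm_rcomm_of_commute (hs : s * s = 1) (hb : b * b = 1) (ha : a * a = 1)
    (h : s * (b * a) = b * a * s) : rcomm s b * rcomm b a = rcomm b a * rcomm s b := by
  have hc : Commute s (b * a) := h
  have e : rcomm b a = b * a * (b * a) := by
    rw [rcomm_eq_of_involutions hb ha]; simp only [mul_assoc]
  have ht : Commute (b * s * b) (b * a) := by
    calc b * s * b * (b * a) = b * s * (b * b) * a := by simp only [mul_assoc]
      _ = b * (a * a) * s * a := by rw [hb, ha]; simp only [mul_assoc, mul_one]
      _ = b * a * (a * s * a) := by simp only [mul_assoc]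
      _ = b * a * (b * s * b) := by rw [conj_eq_conj_of_commute hb ha h]
  rw [e, rcomm_eq_of_involutions hs hb]
  exact ((hc.mul_left ht).mul_right (hc.mul_left ht)).eq

/-- Commutation of `a * s * b` with `s` forces `(s * a)² = (s * b)⁻²`. -/
theorem pow_four_eq_one_of_commute (hs : s * s = 1) (hb : b * b = 1) (ha : a * a = 1)
    (h4 : (s * b) ^ 4 = 1) (h : a * s * b * s = s * (a * s * b)) : (s * a) ^ 4 = 1 := by
  have h2 : s * a * (s * a) = (s * b)⁻¹ * (s * b)⁻¹ := by
    rw [mul_inv_rev, inv_eq_of_mul_eq_one_left hs, inv_eq_of_mul_eq_one_left hb]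
    calc s * a * (s * a) = s * a * s * (a * s * b * s) * (s * b * s) := by
          simp only [mul_assoc]
          rw [← mul_assoc s s, hs, one_mul, ← mul_assoc b b, hb, one_mul, hs, mul_one]
      _ = s * (a * (s * s) * a) * s * b * (s * b * s) := by rw [h]; simp only [mul_assoc]
      _ = b * s * (b * s) := by
          rw [hs, mul_one, ha, mul_one, hs, one_mul]; simp only [mul_assoc]
  have h3 : (s * a) ^ 4 = s * a * (s * a) * (s * a * (s * a)) := by
    simp only [pow_succ, pow_zero, one_mul, mul_assoc]
  have h5 : (s * a) ^ 4 = ((s * b) ^ 4)⁻¹ := by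
    rw [h3, h2, ← inv_pow]
    simp only [pow_succ, pow_zero, one_mul, mul_assoc]
  rw [h5, h4, inv_one]

end involutions

/-- The parity of active vertices on the first two levels of the subtree at `0`. -/
def leftSign (g : TreeAut) : ZMod 2 := sgn 0 (sec g false) + sgn 1 (sec g false)

/-- The variant of `leftSign` that is additive up to a multiple of `sgn 0` of the second factor. -/
def leftSign' (g : TreeAut) : ZMod 2 := leftSign g + sgn 0 g * (sgn 1 g + sgn 2 g)

/-- If the first factor is active, the section of the product uses the other section of the second
factor, and the parities of its two sections differ by `sgn 1 + sgn 2`. -/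
theorem isHeisenberg_leftSign (K : Subgroup TreeAut) :
    IsHeisenberg K (sgn 0) (fun g => sgn 1 g + sgn 2 g) leftSign := by
  refine ⟨fun _ _ _ _ => sgn_mul .., fun x _ y _ => ?_, fun x _ y _ => ?_⟩
  · simp only [sgn_mul]; ring
  · have h2 : ∀ g, sgn 2 g = sgn 1 (sec g false) + sgn 1 (sec g true) := fun _ => rfl
    have h1 : ∀ g, sgn 1 g = sgn 0 (sec g false) + sgn 0 (sec g true) := fun _ => rfl
    have h0 : sgn 0 x = if flips x then 1 else 0 := rfl
    rw [h0, h1 y, h2 y]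
    simp only [leftSign, sec_mul, sgn_mul]
    cases flips x
    · simp only [Bool.false_xor, Bool.false_eq_true, if_false]; ring
    · have e0 := CharTwo.add_self_eq_zero (sgn 0 (sec y false))
      have e1 := CharTwo.add_self_eq_zero (sgn 1 (sec y false))
      simp only [Bool.false_xor, if_true]
      linear_combination -e0 - e1

theorem isHeisenberg_leftSign' (K : Subgroup TreeAut) :
    IsHeisenberg K (fun g => sgn 1 g + sgn 2 g) (sgn 0) leftSign' :=
  (isHeisenberg_leftSign K).swap

section kneading
variable {w v : List Bool}

/-- For `k = 2` and `n = 1`: a Heisenberg function on `K(w, v)` that vanishes on the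
generators. -/
theorem exists_isHeisenberg_of_length_eq_two (hw : w ≠ []) (hv : v ≠ []) (hk : w.length = 2)
    (hn : v.length = 1) :
    ∃ q : TreeAut → ZMod 2, IsHeisenberg (kneadingGroup w v) (sgn (w.length - 1))
        (sgn (w.length + v.length - 1)) q ∧
      (∀ m < w.length + v.length, q (gen w v m) = 0) ∧
      ∀ g, (∀ l, sgn l g = 0) → q g = leftSign' (sec g false) + leftSign' (sec g true) := by
  have hfirst : w.length - 1 = 1 := by omega
  have hlast : w.length + v.length - 1 = 2 := by omega
  have T : ∀ l < 3, ∀ m < 3, sgn l (gen w v m) = if m = l then 1 else 0 :=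
    fun l hl m hm => sgn_gen hw hv (by omega) (by omega)
  have h' := isHeisenberg_leftSign' (kneadingGroup w v)
  have h0 : IsHeisenberg (kneadingGroup w v) (sgn 2) (sgn 1)
      fun g => leftSign' (sec g false) + leftSign' (sec g true) := by
    refine ⟨fun _ _ _ _ => sgn_mul .., fun _ _ _ _ => sgn_mul .., fun x hx y hy => ?_⟩
    -- By the constraint on sections, `sgn 2` of one section is `sgn 1` of the other. So the first
    -- factor of the cocycle is the same at both letters, and the cocycles at the two letters add up
    -- to `sgn 2 x * sgn 1 y`.
    have hp : ∀ t, sgn 1 (sec x t) + sgn 2 (sec x t) = sgn 2 x := by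
      intro t
      have := sgn_sec_eq_sgn_sec_not hw hv hx (!t)
      rw [Bool.not_not, hfirst, hlast] at this
      rw [← this, sgn_succ 1 x]
      cases t
      · rfl
      · exact add_comm _ _
    have h1 : sgn 1 y = sgn 0 (sec y false) + sgn 0 (sec y true) := rfl
    have hm : ∀ t t', leftSign' (sec x t * sec y t') = _ := fun t t' =>
      h'.map_mul _ (sec_mem hw hv hx t) _ (sec_mem hw hv hy t')
    simp only [sec_mul, hm, hp, h1]
    cases flips x <;> simp <;> ring
  have h1 := (h0.swap.add_smul
    (leftSign' (sec (gen w v 1) false) + leftSign' (sec (gen w v 1) true))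
    (leftSign' (sec (gen w v 2) false) + leftSign' (sec (gen w v 2) true)))
  refine ⟨_, by rw [hfirst, hlast]; exact h1, ?_, fun g hg => by simp [hg]⟩
  intro m hm
  obtain rfl | rfl | rfl : m = 0 ∨ m = 1 ∨ m = 2 := by omega
  · simp (disch := omega) [T, sec_gen_zero hw, h'.map_one]
  · simp (disch := omega) only [T]
    simp [CharTwo.add_self_eq_zero]
  · simp (disch := omega) only [T]
    simp [CharTwo.add_self_eq_zero]

/-! ### The case `k = 2`, `n = 1`: the subgroup `L` -/

section subgroupL₂₁

theorem elemX_eq (hk : w.length = 2) :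
    elemX w v = rcomm (gen w v 0) (gen w v 1 * gen w v 2) := by
  rw [elemX, genB_eq_gen le_rfl (by omega), genB_eq_gen (by omega) (by omega),
    genA_eq_gen le_rfl, hk]

theorem conjInvariant_subgroupL₂₁ : ConjInvariant (kneadingGroup w v) (subgroupL₂₁ w v) :=
  conjInvariant_normalClosureIn _ _

theorem elemX_mem : elemX w v ∈ subgroupL₂₁ w v := mem_normalClosureIn rfl

theorem elemX_mem_commutator (hk : w.length = 2) (hn : v.length = 1) :
    elemX w v ∈ ⁅kneadingGroup w v, kneadingGroup w v⁆ := by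
  rw [elemX_eq hk]
  exact rcomm_mem_commutator (gen_mem (by omega))
    (mul_mem (gen_mem (by omega)) (gen_mem (by omega)))

theorem subgroupL₂₁_le {M : Subgroup TreeAut} (hM : ConjInvariant (kneadingGroup w v) M)
    (hx : elemX w v ∈ M) : subgroupL₂₁ w v ≤ M := by
  refine normalClosureIn_le hM ?_
  rintro _ rfl
  exact hx

theorem subgroupL₂₁_le_commutator (hk : w.length = 2) (hn : v.length = 1) :
    subgroupL₂₁ w v ≤ ⁅kneadingGroup w v, kneadingGroup w v⁆ :=
  subgroupL₂₁_le (conjInvariant_commutator _) (elemX_mem_commutator hk hn)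

theorem subgroupL₂₁_le_smallClosure (hk : w.length = 2) (hn : v.length = 1) :
    subgroupL₂₁ w v ≤ smallClosure w v := by
  refine subgroupL₂₁_le conjInvariant_smallClosure ?_
  rw [elemX_eq hk]
  exact conjInvariant_smallClosure.rcomm_mem
    (gen_mem_smallClosure (by omega) (by omega) (by omega))
    (mul_mem (gen_mem (by omega)) (gen_mem (by omega)))

/-- Modulo `L`, the element `b_1` commutes with `b_2 a_1`. -/
theorem exists_quotient_subgroupL₂₁ (hk : w.length = 2) (hn : v.length = 1) :
    ∃ (Q : Type) (_ : Group Q) (π : kneadingGroup w v →* Q) (s b a : kneadingGroup w v),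
      (s : TreeAut) = gen w v 0 ∧ (b : TreeAut) = gen w v 1 ∧ (a : TreeAut) = gen w v 2 ∧
      (∀ g : kneadingGroup w v, π g = 1 ↔ (g : TreeAut) ∈ subgroupL₂₁ w v) ∧
      π s * π s = 1 ∧ π b * π b = 1 ∧ π a * π a = 1 ∧
      π s * (π b * π a) = π b * π a * π s := by
  obtain ⟨Q, _, π, hπ⟩ := (conjInvariant_subgroupL₂₁ (w := w) (v := v)).exists_quotient
  have h2 : ∀ m, ∀ hm : gen w v m ∈ kneadingGroup w v,
      π ⟨gen w v m, hm⟩ * π ⟨gen w v m, hm⟩ = 1 := by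
    intro m hm
    rw [← map_mul, ← π.map_one]
    exact congrArg π (Subtype.ext (gen_mul_self m))
  refine ⟨Q, inferInstance, π, ⟨_, gen_mem (m := 0) (by omega)⟩,
    ⟨_, gen_mem (m := 1) (by omega)⟩, ⟨_, gen_mem (m := 2) (by omega)⟩, rfl, rfl, rfl, hπ,
    h2 _ _, h2 _ _, h2 _ _, ?_⟩
  rw [← rcomm_eq_one_iff, ← map_mul, ← map_rcomm, hπ]
  have := elemX_mem (w := w) (v := v)
  rwa [elemX_eq hk] at this

/-- Modulo `L`, `b_1` commutes with `b_2 a_1`. Hence `[b_1, a_1] = [b_1, b_2]`, `a_1` inverts `[b_1,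
b_2]`, and `b_1` centralizes `[b_2, a_1] = (b_2 a_1)²`; every other conjugation by a generator is
inversion of a commutator by one of its entries. -/
theorem generatesQuotient_subgroupL₂₁ (hk : w.length = 2) (hn : v.length = 1) :
    GeneratesQuotient ⁅kneadingGroup w v, kneadingGroup w v⁆ (subgroupL₂₁ w v)
      {rcomm (gen w v 0) (gen w v 1), rcomm (gen w v 1) (gen w v 2)} := by
  have hS : ({rcomm (gen w v 0) (gen w v 1), rcomm (gen w v 1) (gen w v 2)} : Set TreeAut) ⊆
      (⁅kneadingGroup w v, kneadingGroup w v⁆ : Subgroup TreeAut) := by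
    rintro _ (rfl | rfl) <;>
      exact rcomm_mem_commutator (gen_mem (by omega)) (gen_mem (by omega))
  obtain ⟨Q, _, π, s, b, a, hs, hb, ha, hπ, hs2, hb2, ha2, hc⟩ :=
    exists_quotient_subgroupL₂₁ (w := w) (v := v) hk hn
  have h1 := Subgroup.mem_sup_left (T := subgroupL₂₁ w v) (Subgroup.subset_closure
    (Set.mem_insert (rcomm (gen w v 0) (gen w v 1)) {rcomm (gen w v 1) (gen w v 2)}))
  have h2 := Subgroup.mem_sup_left (T := subgroupL₂₁ w v) (Subgroup.subset_closure
    (Set.mem_insert_of_mem (rcomm (gen w v 0) (gen w v 1))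
      (Set.mem_singleton (rcomm (gen w v 1) (gen w v 2)))))
  have hmod : ∀ x y : kneadingGroup w v, π x = π y →
      (x : TreeAut) ∈ Subgroup.closure {rcomm (gen w v 0) (gen w v 1),
        rcomm (gen w v 1) (gen w v 2)} ⊔ subgroupL₂₁ w v →
      (y : TreeAut) ∈ Subgroup.closure {rcomm (gen w v 0) (gen w v 1),
        rcomm (gen w v 1) (gen w v 2)} ⊔ subgroupL₂₁ w v := by
    intro x y hxy hx
    have : π (x⁻¹ * y) = 1 := by rw [map_mul, map_inv, hxy, inv_mul_cancel]
    rw [hπ] at this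
    have h3 := mul_mem hx (Subgroup.mem_sup_right this)
    simpa using h3
  refine ⟨hS, le_antisymm
    (sup_le ((Subgroup.closure_le _).2 hS) (subgroupL₂₁_le_commutator hk hn)) ?_⟩
  refine commutator_kneadingGroup_le
    (conjInvariant_kneadingGroup_sup conjInvariant_subgroupL₂₁ ?_) ?_
  · rintro _ (rfl | rfl) m hm
    · obtain rfl | rfl | rfl : m = 0 ∨ m = 1 ∨ m = 2 := by omega
      · rw [rconj_rcomm_left (gen_mul_self _)]; exact inv_mem h1
      · rw [rconj_rcomm_right (gen_mul_self _)]; exact inv_mem h1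
      · have := hmod (rcomm s b)⁻¹ (rconj (rcomm s b) a)
          (by rw [map_inv, map_rconj, map_rcomm, rconj_rcomm_of_commute hs2 hb2 ha2 hc])
          (by simpa [rcomm, hs, hb] using inv_mem h1)
        simpa [rcomm, rconj, hs, hb, ha] using this
    · obtain rfl | rfl | rfl : m = 0 ∨ m = 1 ∨ m = 2 := by omega
      · have := hmod (rcomm b a) (rconj (rcomm b a) s)
          (by rw [map_rconj, map_rcomm, rconj_rcomm_of_commute' hb2 ha2 hc])
          (by simpa [rcomm, ha, hb] using h2)
        simpa [rcomm, rconj, hs, hb, ha] using this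
      · rw [rconj_rcomm_left (gen_mul_self _)]; exact inv_mem h2
      · rw [rconj_rcomm_right (gen_mul_self _)]; exact inv_mem h2
  · intro l m hlm hm
    obtain ⟨rfl, rfl⟩ | ⟨rfl, rfl⟩ | ⟨rfl, rfl⟩ :
        (l = 0 ∧ m = 1) ∨ (l = 0 ∧ m = 2) ∨ (l = 1 ∧ m = 2) := by omega
    · exact h1
    · have := hmod (rcomm s b) (rcomm s a)
        (by rw [map_rcomm, map_rcomm, rcomm_eq_rcomm_of_commute hs2 hb2 ha2 hc])
        (by simpa [rcomm, hs, hb] using h1)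
      simpa [rcomm, hs, ha] using this
    · exact h2

theorem commutator_commutator_le_subgroupL₂₁ (hk : w.length = 2)
    (hn : v.length = 1) :
    ⁅⁅kneadingGroup w v, kneadingGroup w v⁆, ⁅kneadingGroup w v, kneadingGroup w v⁆⁆ ≤
      subgroupL₂₁ w v := by
  have hL := (conjInvariant_subgroupL₂₁ (w := w) (v := v)).mono
    (Subgroup.commutator_le_self (kneadingGroup w v))
  obtain ⟨Q, _, π, s, b, a, hs, hb, ha, hπ, hs2, hb2, ha2, hc⟩ :=
    exists_quotient_subgroupL₂₁ (w := w) (v := v) hk hn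
  have h1 : rcomm (rcomm (gen w v 0) (gen w v 1)) (rcomm (gen w v 1) (gen w v 2)) ∈
      subgroupL₂₁ w v := by
    have := (hπ (rcomm (rcomm s b) (rcomm b a))).1 (by
      rw [map_rcomm, map_rcomm, map_rcomm, rcomm_eq_one_iff,
        rcomm_rcomm_of_commute hs2 hb2 ha2 hc])
    simpa [rcomm, hs, hb, ha] using this
  refine commutator_le_of_generatesQuotient (subgroupL₂₁_le_commutator hk hn) hL
    (generatesQuotient_subgroupL₂₁ hk hn) ?_
  rintro _ (rfl | rfl) _ (rfl | rfl)
  · rw [rcomm_eq_one_iff.2 rfl]; exact one_mem _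
  · exact h1
  · rw [← rcomm_inv]; exact inv_mem h1
  · rw [rcomm_eq_one_iff.2 rfl]; exact one_mem _

/-- The letters of `w` and the letter `t` decide between the two words, which are inverse to each
other. Either way each generator occurs once. -/
theorem sec_elemX (hw : w ≠ []) (hv : v ≠ []) (hk : w.length = 2) (hn : v.length = 1)
    (t : Bool) :
    sec (elemX w v) t = gen w v 2 * gen w v 0 * gen w v 1 ∨
      sec (elemX w v) t = gen w v 1 * gen w v 0 * gen w v 2 := by
  obtain ⟨y, hy⟩ := gen_succ (w := w) (v := v) (m := 0) (by omega) (by omega)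
  obtain ⟨z, h1, h2⟩ := exists_sec_gen_length hw hv
  have hf := flips_gen_length (w := w) (v := v)
  rw [show w.length + v.length - 1 = 2 by omega, hk] at h2
  rw [show w.length - 1 = 1 by omega, hk] at h1
  rw [hk] at hf
  have hx : elemX w v = gen w v 0 * (gen w v 2 * gen w v 1) * gen w v 0 *
      (gen w v 1 * gen w v 2) := by
    rw [elemX_eq hk, rcomm, mul_inv_rev, gen_inv, gen_inv, gen_inv]
  have hb : ∀ u, sec (gen w v 1) u = if y = u then gen w v 0 else 1 := fun u => by
    rw [zero_add] at hy
    rw [hy, sec_inj]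
  have hbf : flips (gen w v 1) = false := flips_gen (by omega) (by omega)
  rw [hx]
  cases z <;> cases y <;> cases t <;>
    simp_all [sec_gen_zero hw, flips_gen_zero hw, mul_assoc]

/-- As `b_2` is the copy of `b_1` at `y`, the square is the copy of `(b_1 c)^4`, where `c` is the
section of `a_1` at `y`. If `c = b_2`, this power is trivial. If `c = a_1`, it is trivial modulo the
normal closure of `[x_y, b_1]`, where `x_y` is the section of `x` at `y`, and the copy of that
closure lies in `L`. -/
theorem rcomm_mul_self_mem_subgroupL₂₁ (hw : w ≠ []) (hv : v ≠ []) (hk : w.length = 2)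
    (hn : v.length = 1) :
    rcomm (gen w v 1) (gen w v 2) * rcomm (gen w v 1) (gen w v 2) ∈ subgroupL₂₁ w v := by
  obtain ⟨y, hy⟩ := gen_succ (w := w) (v := v) (m := 0) (by omega) (by omega)
  rw [zero_add] at hy
  obtain ⟨z, h1, h2⟩ := exists_sec_gen_length hw hv
  have hf := flips_gen_length (w := w) (v := v)
  rw [show w.length + v.length - 1 = 2 by omega, hk] at h2
  rw [show w.length - 1 = 1 by omega, hk] at h1
  rw [hk] at hf
  have hsb : (gen w v 0 * gen w v 1) ^ 4 = 1 := by
    have h := rcomm_inj_gen_zero_mul_self (v := v) hw y (gen_mul_self (w := w) (v := v) 0)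
    rw [← hy] at h
    have e : (gen w v 0 * gen w v 1) ^ 4 =
        (rcomm (gen w v 1) (gen w v 0) * rcomm (gen w v 1) (gen w v 0))⁻¹ := by
      simp [pow_succ, rcomm, mul_assoc]
    rw [e, h, inv_one]
  have hsec : ∀ u, sec (gen w v 2) u = gen w v 1 ∨ sec (gen w v 2) u = gen w v 2 := by
    intro u
    obtain rfl | rfl : u = z ∨ u = !z := by cases u <;> cases z <;> simp
    · exact Or.inl h1
    · exact Or.inr h2
  have hsq : sec (gen w v 2) (!y) * sec (gen w v 2) (!y) = 1 := by
    obtain h | h := hsec (!y) <;> rw [h, gen_mul_self]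
  have hinj : rcomm (gen w v 1) (gen w v 2) * rcomm (gen w v 1) (gen w v 2) =
      inj y ((gen w v 0 * sec (gen w v 2) y) ^ 4) := by
    have hy0 : sec (gen w v 1) y = gen w v 0 := by rw [hy, sec_inj_self]
    have hy1 : sec (gen w v 1) (!y) = 1 := by rw [hy, sec_inj_not]
    have hbf : flips (gen w v 1) = false := by rw [hy, flips_inj]
    have e : rcomm (gen w v 1) (gen w v 2) = gen w v 1 * gen w v 2 * gen w v 1 * gen w v 2 := by
      simp [rcomm]
    rw [e]
    refine ext_letter y (by simp [hbf, hf]) ?_ ?_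
    · simp [hbf, hf, hy0, pow_succ, mul_assoc]
    · simp [hbf, hf, hy1, hsq]
  rw [hinj]
  obtain h | h := hsec y
  · rw [h, hsb, inj_one]; exact one_mem _
  rw [h]
  -- The commutator of `x` with `b_2` is supported on the subtree at `y`.
  have hxs : inj y (rcomm (sec (elemX w v) y) (gen w v 0)) ∈ subgroupL₂₁ w v := by
    have hm := (conjInvariant_subgroupL₂₁ (w := w) (v := v)).rcomm_mem elemX_mem
      (gen_mem (show 1 < w.length + v.length by omega))
    have hxf := flips_eq_false_of_mem_commutator (elemX_mem_commutator hk hn)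
    have e : rcomm (elemX w v) (gen w v 1) =
        inj y (rcomm (sec (elemX w v) y) (gen w v 0)) := by
      rw [hy]
      refine ext_letter y ?_ ?_ ?_ <;> simp [rcomm, hxf]
    rwa [e] at hm
  refine inj_mem_of_mem_normalClosureIn (S := {rcomm (sec (elemX w v) y) (gen w v 0)}) hw hv
    conjInvariant_subgroupL₂₁ (fun s hs => ⟨y, by rwa [Set.mem_singleton_iff.1 hs]⟩) ?_ y
  obtain ⟨Q, _, π, hπ⟩ := (conjInvariant_normalClosureIn (kneadingGroup w v)
    {rcomm (sec (elemX w v) y) (gen w v 0)}).exists_quotient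
  have hπx := mem_normalClosureIn (K := kneadingGroup w v)
    (Set.mem_singleton (rcomm (sec (elemX w v) y) (gen w v 0)))
  obtain ⟨s, hs⟩ : ∃ s : kneadingGroup w v, (s : TreeAut) = gen w v 0 :=
    ⟨⟨_, gen_mem (by omega)⟩, rfl⟩
  obtain ⟨b, hb⟩ : ∃ b : kneadingGroup w v, (b : TreeAut) = gen w v 1 :=
    ⟨⟨_, gen_mem (by omega)⟩, rfl⟩
  obtain ⟨a, ha⟩ : ∃ a : kneadingGroup w v, (a : TreeAut) = gen w v 2 :=
    ⟨⟨_, gen_mem (by omega)⟩, rfl⟩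
  have hs2 : s * s = 1 := Subtype.ext (by simp [hs])
  have hb2 : b * b = 1 := Subtype.ext (by simp [hb])
  have ha2 : a * a = 1 := Subtype.ext (by simp [ha])
  have hsb' : (s * b) ^ 4 = 1 := Subtype.ext (by simpa [hs, hb] using hsb)
  have hs2' : π s * π s = 1 := by rw [← map_mul, hs2, map_one]
  have hb2' : π b * π b = 1 := by rw [← map_mul, hb2, map_one]
  have ha2' : π a * π a = 1 := by rw [← map_mul, ha2, map_one]
  have hsb'' : (π s * π b) ^ 4 = 1 := by rw [← map_mul, ← map_pow, hsb', map_one]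
  have hcomm : π a * π s * π b * π s = π s * (π a * π s * π b) := by
    obtain h | h := sec_elemX hw hv hk hn y
    · have h3 : π (rcomm (a * s * b) s) = 1 := by
        rw [hπ]
        rw [h] at hπx
        rw [h]
        simpa [rcomm, hs, hb, ha] using hπx
      rwa [map_rcomm, rcomm_eq_one_iff, map_mul, map_mul] at h3
    · have h3 : π (rcomm (b * s * a) s) = 1 := by
        rw [hπ]
        rw [h] at hπx
        rw [h]
        simpa [rcomm, hs, hb, ha] using hπx
      rw [map_rcomm, rcomm_eq_one_iff, map_mul, map_mul] at h3
      have h4 := congrArg (·⁻¹) h3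
      simp only [mul_inv_rev, inv_eq_of_mul_eq_one_left hs2', inv_eq_of_mul_eq_one_left hb2',
        inv_eq_of_mul_eq_one_left ha2'] at h4
      simpa [mul_assoc] using h4.symm
  have := (hπ ((s * a) ^ 4)).1 (by
    rw [map_pow, map_mul, pow_four_eq_one_of_commute hs2' hb2' ha2' hsb'' hcomm])
  simpa [hs, ha] using this

end subgroupL₂₁
end kneading

/-- The two first coordinates are the opposite units of `ℤ/4`, so the sum of the pairs is `(0, 1)`.
-/
theorem closure_eq_of_liftFour_pair {P : AddSubgroup (ZMod 4 × ZMod 2)} {e d : ZMod 2}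
    (h1 : (liftFour 1 e, d) ∈ P) (h2 : (liftFour 1 (e + 1), d + 1) ∈ P) (a : ZMod 4 × ZMod 2) :
    a ∈ P := by
  have key : ∀ (e d : ZMod 2) (a : ZMod 4 × ZMod 2), ∃ i j : Fin 4,
      a = (i : ℕ) • (liftFour 1 e, d) + (j : ℕ) • (liftFour 1 (e + 1), d + 1) := by decide
  obtain ⟨i, j, h⟩ := key e d a
  rw [h]
  exact add_mem (nsmul_mem h1 _) (nsmul_mem h2 _)

section kneading
variable {w v : List Bool} {q : TreeAut → ZMod 2}

/-- The pair `(leftSign, q)` is dual to `[b_1, b_2]` and `[b_2, a_1]`, which generate the elementary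
abelian `K'/L`. It kills `x`: `sgn 1 + sgn 2` vanishes on `b_2 a_1`, and `sgn 1` and `sgn 2` both
vanish on `b_1`. -/
theorem mem_subgroupL₂₁_iff (hw : w ≠ []) (hv : v ≠ []) (hk : w.length = 2) (hn : v.length = 1)
    (hq : IsHeisenberg (kneadingGroup w v) (sgn 1) (sgn 2) q) {g : TreeAut} :
    g ∈ subgroupL₂₁ w v ↔
      g ∈ ⁅kneadingGroup w v, kneadingGroup w v⁆ ∧ leftSign g = 0 ∧ q g = 0 := by
  have T : ∀ l < 3, ∀ m < 3, sgn l (gen w v m) = if m = l then 1 else 0 :=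
    fun l hl m hm => sgn_gen hw hv (by omega) (by omega)
  have hs := isHeisenberg_leftSign (kneadingGroup w v)
  let f : TreeAut → Fin 2 → ZMod 2 := fun g => ![leftSign g, q g]
  have hf : ∀ g, f g = 0 ↔ leftSign g = 0 ∧ q g = 0 := fun g => by simp [f]
  have hadd : ∀ x ∈ ⁅kneadingGroup w v, kneadingGroup w v⁆,
      ∀ y ∈ ⁅kneadingGroup w v, kneadingGroup w v⁆, f (x * y) = f x + f y := by
    intro x hx y hy
    simp [f, hs.map_mul_of_mem_commutator x hx y hy, hq.map_mul_of_mem_commutator x hx y hy]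
  have hle : ∀ g ∈ subgroupL₂₁ w v, g ∈ ⁅kneadingGroup w v, kneadingGroup w v⁆ ∧ f g = 0 := by
    have hM : ConjInvariant (kneadingGroup w v) (kerOn _ f hadd) := fun m hm h hh => by
      obtain ⟨h1, h2⟩ := (hf m).1 hm.2
      refine ⟨conjInvariant_commutator _ m hm.1 h hh, (hf _).2 ⟨?_, ?_⟩⟩
      · rw [hs.map_rconj_of_mem_commutator (fun g hg => sgn_eq_zero_of_mem_commutator hg _)
          (fun g hg => by simp [sgn_eq_zero_of_mem_commutator hg]) hm.1 hh, h1]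
      · rw [hq.map_rconj_of_mem_commutator (fun g hg => sgn_eq_zero_of_mem_commutator hg _)
          (fun g hg => sgn_eq_zero_of_mem_commutator hg _) hm.1 hh, h2]
    have hx := elemX_mem_commutator hk hn
    refine subgroupL₂₁_le hM ⟨hx, (hf _).2 ?_⟩
    have hba : gen w v 1 * gen w v 2 ∈ kneadingGroup w v :=
      mul_mem (gen_mem (by omega)) (gen_mem (by omega))
    rw [elemX_eq hk, hs.map_rcomm (gen_mem (by omega)) hba,
      hq.map_rcomm (gen_mem (by omega)) hba]
    simp only [sgn_mul]
    simp (disch := omega) only [T]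
    decide
  rw [← hf]
  refine ⟨hle g, fun ⟨hg, hfg⟩ => ?_⟩
  refine mem_of_additive_eq_zero
    (conjInvariant_subgroupL₂₁.mono (Subgroup.commutator_le_self (kneadingGroup w v)))
    hadd (fun x hx => (hle x hx).2)
    (g := ![rcomm (gen w v 0) (gen w v 1), rcomm (gen w v 1) (gen w v 2)]) ?_ ?_
    (commutator_commutator_le_subgroupL₂₁ hk hn) ?_ hg hfg
  · have h0 : gen w v 0 ∈ kneadingGroup w v := gen_mem (by omega)
    have h1 : gen w v 1 ∈ kneadingGroup w v := gen_mem (by omega)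
    have h2 : gen w v 2 ∈ kneadingGroup w v := gen_mem (by omega)
    intro i
    fin_cases i
    · change ![leftSign (rcomm (gen w v 0) (gen w v 1)), q (rcomm (gen w v 0) (gen w v 1))] = _
      rw [hs.map_rcomm h0 h1, hq.map_rcomm h0 h1]
      simp (disch := omega) only [T]
      decide
    · change ![leftSign (rcomm (gen w v 1) (gen w v 2)), q (rcomm (gen w v 1) (gen w v 2))] = _
      rw [hs.map_rcomm h1 h2, hq.map_rcomm h1 h2]
      simp (disch := omega) only [T]
      decide
  · intro i
    fin_cases i
    · obtain ⟨y, hy⟩ := gen_succ (w := w) (v := v) (m := 0) (by omega) (by omega)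
      have h := rcomm_inj_gen_zero_mul_self (v := v) hw y (gen_mul_self (w := w) (v := v) 0)
      rw [← hy, zero_add] at h
      have e : rcomm (gen w v 0) (gen w v 1) * rcomm (gen w v 0) (gen w v 1) = 1 := by
        rw [← rcomm_inv, ← mul_inv_rev, h, inv_one]
      simp [e]
    · exact rcomm_mul_self_mem_subgroupL₂₁ hw hv hk hn
  · rw [Matrix.range_cons, Matrix.range_cons, Matrix.range_empty, Set.union_empty]
    exact generatesQuotient_subgroupL₂₁ hk hn

/-- The coordinates on `L/(L × L)` come from the section at `false`: `sgn 1` and `q` combined into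
`ℤ/4`, and `leftSign'`. What is missing follows from membership in `L`: `leftSign = 0` ties `sgn 0`
of this section to its `sgn 1`, and `q = 0` makes `leftSign'` equal on both sections. -/
theorem regularBranch_subgroupL₂₁ (hw : w ≠ []) (hv : v ≠ []) (hk : w.length = 2)
    (hn : v.length = 1) :
    IsRegularBranchOn (kneadingGroup w v) (subgroupL₂₁ w v) ∧
      QuotientIso ⁅kneadingGroup w v, kneadingGroup w v⁆ (subgroupL₂₁ w v)
        (Multiplicative (Fin 2 → ZMod 2)) ∧
      GeneratesQuotient ⁅kneadingGroup w v, kneadingGroup w v⁆ (subgroupL₂₁ w v)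
        {rcomm (genB w v 1) (genB w v 2), rcomm (genB w v 2) (genA w v 1)} ∧
      QuotientIso (subgroupL₂₁ w v) (geomSquare (subgroupL₂₁ w v))
        (Multiplicative (ZMod 4 × ZMod 2)) ∧
      GeneratesQuotient (subgroupL₂₁ w v) (geomSquare (subgroupL₂₁ w v))
        {elemX w v, rconj (elemX w v) (genA w v 1)} ∧
      elemX w v ^ 4 ∈ geomSquare (subgroupL₂₁ w v) ∧
      rconj (elemX w v) (genA w v 1) ^ 4 ∈ geomSquare (subgroupL₂₁ w v) ∧
      elemX w v ^ 2 * rconj (elemX w v ^ 2) (genA w v 1) ∈ geomSquare (subgroupL₂₁ w v) := by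
  have hgb1 : genB w v 1 = gen w v 0 := genB_eq_gen le_rfl (by omega)
  have hgb2 : genB w v 2 = gen w v 1 := genB_eq_gen (by omega) (by omega)
  have hga : genA w v 1 = gen w v 2 := by rw [genA_eq_gen le_rfl, hk]
  rw [hgb1, hgb2, hga]
  have T : ∀ l < 3, ∀ m < 3, sgn l (gen w v m) = if m = l then 1 else 0 :=
    fun l hl m hm => sgn_gen hw hv (by omega) (by omega)
  have h0K : gen w v 0 ∈ kneadingGroup w v := gen_mem (by omega)
  have h1K : gen w v 1 ∈ kneadingGroup w v := gen_mem (by omega)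
  have h2K : gen w v 2 ∈ kneadingGroup w v := gen_mem (by omega)
  obtain ⟨q, hq', hqgen, hqc⟩ := exists_isHeisenberg_of_length_eq_two hw hv hk hn
  have e1 : w.length - 1 = 1 := by omega
  have e2 : w.length + v.length - 1 = 2 := by omega
  have hq : IsHeisenberg (kneadingGroup w v) (sgn 1) (sgn 2) q := by rwa [e1, e2] at hq'
  have hs := isHeisenberg_leftSign (kneadingGroup w v)
  have hs' := isHeisenberg_leftSign' (kneadingGroup w v)
  have hmem : ∀ {g}, g ∈ subgroupL₂₁ w v ↔ _ := mem_subgroupL₂₁_iff hw hv hk hn hq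
  have hLK' := subgroupL₂₁_le_commutator (w := w) (v := v) hk hn
  have hleft : ∀ g ∈ ⁅kneadingGroup w v, kneadingGroup w v⁆, leftSign' g = leftSign g := by
    intro g hg
    simp [leftSign', sgn_eq_zero_of_mem_commutator hg]
  have hsq : geomSquare (subgroupL₂₁ w v) ≤ subgroupL₂₁ w v := by
    refine geomSquare_le_of_inj fun g hg x => ?_
    have hgK' := hLK' hg
    have hx := inj_mem_commutator hw hv hgK'
      (inj_mem_of_mem_smallClosure hw hv (subgroupL₂₁_le_smallClosure hk hn hg) x)
    refine hmem.2 ⟨hx, ?_, ?_⟩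
    · rw [leftSign, sec_inj]
      split_ifs <;> simp [sgn_eq_zero_of_mem_commutator hgK']
    · rw [hqc _ (sgn_eq_zero_of_mem_commutator hx)]
      have h1 : leftSign' g = 0 := by rw [hleft g hgK']; exact (hmem.1 hg).2.1
      rw [sec_inj, sec_inj]
      cases x <;> simp [h1, hs'.map_one]
  have hgenQ := generatesQuotient_subgroupL₂₁ (w := w) (v := v) hk hn
  have hiso1 : QuotientIso ⁅kneadingGroup w v, kneadingGroup w v⁆ (subgroupL₂₁ w v)
      (Multiplicative (Fin 2 → ZMod 2)) := by
    refine (quotientIso_of_additive hLK' (f := fun g => (![leftSign g, q g] : Fin 2 → ZMod 2))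
      (fun x hx y hy => ?_) (fun x hx => ?_) hgenQ.1 (mem_of_pi_single_mem fun i => ?_)).1
    · simp [hs.map_mul_of_mem_commutator x hx y hy, hq.map_mul_of_mem_commutator x hx y hy]
    · rw [hmem]
      simp [hx]
    · fin_cases i
      · refine AddSubgroup.subset_closure ⟨rcomm (gen w v 0) (gen w v 1), Or.inl rfl, ?_⟩
        simp only [hs.map_rcomm h0K h1K, hq.map_rcomm h0K h1K]
        simp (disch := omega) only [T]
        decide
      · refine AddSubgroup.subset_closure ⟨rcomm (gen w v 1) (gen w v 2), Or.inr rfl, ?_⟩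
        simp only [hs.map_rcomm h1K h2K, hq.map_rcomm h1K h2K]
        simp (disch := omega) only [T]
        decide
  let f : TreeAut → ZMod 4 × ZMod 2 := fun g =>
    (liftFour (sgn (w.length - 1) (sec g false)) (q (sec g false)), leftSign' (sec g false))
  have hadd : ∀ x ∈ subgroupL₂₁ w v, ∀ y ∈ subgroupL₂₁ w v, f (x * y) = f x + f y := by
    intro x hx y hy
    refine Prod.ext (hq'.liftFour_sec_mul hw hv (hLK' hx) (hLK' hy)) ?_
    have hp := sgn_sec_last_eq hw hv (hLK' hx)
    rw [e1, e2] at hp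
    have hm := hs'.map_mul _ (sec_mem hw hv (mem_of_mem_commutator (hLK' hx)) false) _
      (sec_mem hw hv (mem_of_mem_commutator (hLK' hy)) false)
    rw [hp, sgn_add_self, zero_mul, add_zero] at hm
    simpa [f, flips_eq_false_of_mem_commutator (hLK' hx)] using hm
  have hker : ∀ x ∈ subgroupL₂₁ w v, f x = 0 ↔ x ∈ geomSquare (subgroupL₂₁ w v) := by
    intro x hx
    have hxK' := hLK' hx
    obtain ⟨-, hx1, hx2⟩ := hmem.1 hx
    rw [mem_geomSquare]
    constructor
    · intro h
      obtain ⟨h1, h2⟩ := Prod.ext_iff.1 h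
      obtain ⟨h3, h4⟩ := liftFour_eq_zero.1 h1
      have h2 : leftSign' (sec x false) = 0 := h2
      have h3' := h3
      rw [e1] at h3'
      rw [leftSign, h3', add_zero] at hx1
      rw [hqc _ (sgn_eq_zero_of_mem_commutator hxK'), h2, zero_add] at hx2
      have hsm := sec_mem_commutator hw hv hxK' fun l hl => by
        obtain rfl | rfl : l = 0 ∨ l = 1 := by omega
        · exact hx1
        · exact h3'
      rw [hleft _ (hsm _)] at h2 hx2
      refine ⟨flips_eq_false_of_mem_commutator hxK', hmem.2 ⟨hsm _, h2, h4⟩,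
        hmem.2 ⟨hsm _, hx2, ?_⟩⟩
      have := hq'.sec_not hw hv hqgen (mem_of_mem_commutator hxK') false
      rwa [h3, h4, zero_mul, add_zero] at this
    · rintro ⟨-, h, -⟩
      obtain ⟨ha, hb, hc⟩ := hmem.1 h
      exact Prod.ext (liftFour_eq_zero.2 ⟨sgn_eq_zero_of_mem_commutator ha _, hc⟩)
        ((hleft _ ha).trans hb)
  have hxL := elemX_mem (w := w) (v := v)
  have hxaL : rconj (elemX w v) (gen w v 2) ∈ subgroupL₂₁ w v :=
    conjInvariant_subgroupL₂₁ _ hxL _ h2K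
  have hfx : ∃ e d, f (elemX w v) = (liftFour 1 e, d) ∧
      f (rconj (elemX w v) (gen w v 2)) = (liftFour 1 (e + 1), d + 1) := by
    have hxK := mem_of_mem_commutator (hLK' hxL)
    have hxf := flips_eq_false_of_mem_commutator (hLK' hxL)
    have hs0 : sgn 0 (sec (elemX w v) false) = 1 ∧ sgn 1 (sec (elemX w v) false) = 1 ∧
        sgn 2 (sec (elemX w v) false) = 1 := by
      obtain h | h := sec_elemX hw hv hk hn false <;> rw [h] <;> simp only [sgn_mul] <;>
        simp (disch := omega) only [T] <;> decide
    have haf : flips (gen w v 2) = false := flips_gen (by omega) (by omega)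
    have hsec : sec (rconj (elemX w v) (gen w v 2)) false =
        rconj (sec (elemX w v) false) (sec (gen w v 2) false) := by
      simp [rconj, haf, hxf, -gen_inv]
    -- The section of `a_1` is `b_2` or `a_1`. In both cases conjugation by it changes `q` and
    -- `leftSign'` of the section of `x` by `1`.
    have hat : sgn 0 (sec (gen w v 2) false) = 0 ∧
        sgn 1 (sec (gen w v 2) false) + sgn 2 (sec (gen w v 2) false) = 1 := by
      obtain ⟨z, h1, h2⟩ := exists_sec_gen_length hw hv
      rw [e2, hk] at h2
      rw [e1, hk] at h1
      cases z
      · rw [h1]; simp (disch := omega) only [T]; decide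
      · rw [Bool.not_true] at h2
        rw [h2]; simp (disch := omega) only [T]; decide
    refine ⟨q (sec (elemX w v) false), leftSign' (sec (elemX w v) false),
      Prod.ext ?_ rfl, Prod.ext ?_ ?_⟩
    · simp only [f, e1, hs0.2.1]
    · simp only [f, hsec, sgn_rconj, e1, hs0.2.1]
      rw [hq.map_rconj (sec_mem hw hv hxK _) (sec_mem hw hv h2K _), hs0.2.1, hs0.2.2, one_mul,
        mul_one, add_assoc, add_comm (sgn 2 _), hat.2]
    · simp only [f, hsec]
      rw [hs'.map_rconj (sec_mem hw hv hxK _) (sec_mem hw hv h2K _), hs0.1, hat.1, hat.2,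
        mul_zero, add_zero, mul_one]
  obtain ⟨e, d, hfx, hfxa⟩ := hfx
  have hiso2 := quotientIso_of_additive hsq hadd hker
    (S := {elemX w v, rconj (elemX w v) (gen w v 2)})
    (by rintro _ (rfl | rfl) <;> assumption)
    (closure_eq_of_liftFour_pair
      (AddSubgroup.subset_closure ⟨_, Or.inl rfl, hfx⟩)
      (AddSubgroup.subset_closure ⟨_, Or.inr rfl, hfxa⟩))
  have h4 : ∀ p : ZMod 4 × ZMod 2, 4 • p = 0 := by decide
  have h2 : ∀ e d : ZMod 2,
      2 • (liftFour 1 e, d) + 2 • (liftFour 1 (e + 1), d + 1) = 0 := by decide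
  refine ⟨⟨⟨hLK'.trans (Subgroup.commutator_le_self _), ?_, hsq⟩, ⟨?_⟩⟩, hiso1, hgenQ, hiso2.1,
    hiso2.2, ?_, ?_, ?_⟩
  · intro hbot
    have hx := hxL
    rw [hbot, Subgroup.mem_bot] at hx
    have hz := (hker _ hxL).2 (by rw [hx]; exact one_mem _)
    rw [hfx] at hz
    exact absurd (liftFour_eq_zero.1 (Prod.ext_iff.1 hz).1).1 one_ne_zero
  · exact Subgroup.relIndex_ne_zero_trans (QuotientIso.relIndex_ne_zero hiso1)
      (QuotientIso.relIndex_ne_zero (abelianization_kneadingGroup hw hv).1)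
  · rw [← hker _ (pow_mem hxL 4), pow_of_additive hadd hxL, h4]
  · rw [← hker _ (pow_mem hxaL 4), pow_of_additive hadd hxaL, h4]
  · have hp : rconj (elemX w v ^ 2) (gen w v 2) = rconj (elemX w v) (gen w v 2) ^ 2 := by
      rw [pow_two, pow_two, rconj_mul]
    rw [hp, ← hker _ (mul_mem (pow_mem hxL 2) (pow_mem hxaL 2)),
      hadd _ (pow_mem hxL 2) _ (pow_mem hxaL 2), pow_of_additive hadd hxL,
      pow_of_additive hadd hxaL, hfx, hfxa, h2]

end kneading

/-! ### The case `k = n = 1`: the infinite dihedral group -/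

theorem TreeAut.flips_pow (g : TreeAut) (m : ℕ) : flips (g ^ (2 * m)) = false := by
  rw [mul_comm, pow_mul, pow_two, flips_mul, Bool.xor_self]

theorem TreeAut.sec_pow {g : TreeAut} (hg : flips g = false) (x : Bool) (m : ℕ) :
    flips (g ^ m) = false ∧ sec (g ^ m) x = sec g x ^ m := by
  induction m with
  | zero => simp
  | succ m ih => simp [pow_succ, ih, hg]

theorem TreeAut.sec_zpow {g : TreeAut} (hg : flips g = false) (x : Bool) (m : ℤ) :
    flips (g ^ m) = false ∧ sec (g ^ m) x = sec g x ^ m := by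
  obtain ⟨n, rfl | rfl⟩ := m.eq_nat_or_neg
  · simpa using sec_pow hg x n
  · simp [sec_pow hg x n]

section kneading
variable {w v : List Bool}

theorem gen_zero_mul_zpow (m : ℤ) :
    (gen w v 0 * gen w v 1) ^ m * gen w v 0 = gen w v 0 * (gen w v 0 * gen w v 1) ^ (-m) := by
  have h : gen w v 0 * (gen w v 0 * gen w v 1) * (gen w v 0)⁻¹ =
      (gen w v 0 * gen w v 1)⁻¹ := by
    rw [mul_inv_rev, gen_inv, gen_inv, ← mul_assoc, gen_mul_self, one_mul]
  have h2 := conj_zpow (i := -m) (a := gen w v 0) (b := gen w v 0 * gen w v 1)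
  rw [h, inv_zpow, ← zpow_neg, neg_neg] at h2
  rw [h2, inv_mul_cancel_right]

theorem exists_sec_sq (hw : w ≠ []) (hv : v ≠ []) (hk : w.length = 1) (hn : v.length = 1) :
    ∃ z, sec (gen w v 1) z = gen w v 0 ∧ sec (gen w v 1) (!z) = gen w v 1 ∧
      sec ((gen w v 0 * gen w v 1) ^ 2) z = (gen w v 0 * gen w v 1)⁻¹ ∧
      sec ((gen w v 0 * gen w v 1) ^ 2) (!z) = gen w v 0 * gen w v 1 := by
  obtain ⟨z, h1, h2⟩ := exists_sec_gen_length hw hv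
  rw [show w.length + v.length - 1 = 1 by omega, hk] at h2
  rw [show w.length - 1 = 0 by omega, hk] at h1
  have hf : flips (gen w v 1) = false := flips_gen one_ne_zero (by omega)
  refine ⟨z, h1, h2, ?_, ?_⟩ <;>
    simp [pow_two, flips_gen_zero hw, sec_gen_zero hw, hf, h1, h2]

theorem flips_gen_mul (hw : w ≠ []) (hk : w.length = 1) (hn : v.length = 1) :
    flips (gen w v 0 * gen w v 1) = true := by
  rw [flips_mul, flips_gen_zero hw, flips_gen one_ne_zero (by omega)]
  rfl

theorem sq_zpow (m : ℤ) (hw : w ≠ []) (hv : v ≠ []) (hk : w.length = 1) (hn : v.length = 1)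
    (x : Bool) : flips ((gen w v 0 * gen w v 1) ^ (2 * m)) = false ∧
      ∃ e : ℤ, (e = 1 ∨ e = -1) ∧ sec ((gen w v 0 * gen w v 1) ^ (2 * m)) x =
        (gen w v 0 * gen w v 1) ^ (e * m) := by
  obtain ⟨z, -, -, h1, h2⟩ := exists_sec_sq hw hv hk hn
  have hf : flips ((gen w v 0 * gen w v 1) ^ 2) = false := flips_pow _ 1
  have h := sec_zpow hf x m
  have e : (gen w v 0 * gen w v 1) ^ (2 * m) = ((gen w v 0 * gen w v 1) ^ (2 : ℕ)) ^ m := by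
    rw [zpow_mul, zpow_ofNat]
  rw [e]
  refine ⟨h.1, ?_⟩
  rw [h.2]
  obtain rfl | rfl : x = z ∨ x = !z := by cases x <;> cases z <;> simp
  · exact ⟨-1, Or.inr rfl, by rw [h1, zpow_mul, zpow_neg_one]⟩
  · exact ⟨1, Or.inl rfl, by rw [h2, one_mul]⟩

/-- Descent on `|m|`: odd powers of `b_1 a_1` are active, and an even power has sections whose
exponent is `±m/2`. -/
theorem gen_mul_zpow_eq_one (hw : w ≠ []) (hv : v ≠ []) (hk : w.length = 1) (hn : v.length = 1)
    {m : ℤ} (h : (gen w v 0 * gen w v 1) ^ m = 1) : m = 0 := by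
  induction hm : m.natAbs using Nat.strong_induction_on generalizing m with
  | _ N ih =>
    obtain ⟨j, rfl | rfl⟩ := m.even_or_odd'
    · obtain ⟨-, e, he, hs⟩ := sq_zpow j hw hv hk hn false
      rw [h, sec_one] at hs
      by_contra hj
      have := ih (e * j).natAbs (by rcases he with rfl | rfl <;> omega) hs.symm rfl
      rcases he with rfl | rfl <;> omega
    · have hf := congrArg flips h
      rw [zpow_add_one, flips_mul, (sq_zpow j hw hv hk hn false).1, flips_gen_mul hw hk hn] at hf
      exact absurd hf (by simp)

/-- Otherwise `b_1` is a power of `b_1 a_1` and commutes with it. But `b_1` also inverts it, so its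
square would be trivial. -/
theorem gen_zero_mul_zpow_ne_one (hw : w ≠ []) (hv : v ≠ []) (hk : w.length = 1)
    (hn : v.length = 1) (m : ℤ) : gen w v 0 * (gen w v 0 * gen w v 1) ^ m ≠ 1 := by
  intro h
  have h1 : (gen w v 0 * gen w v 1) ^ m = gen w v 0 :=
    (eq_inv_of_mul_eq_one_right h).trans (gen_inv 0)
  have h2 := gen_zero_mul_zpow (w := w) (v := v) 1
  have h3 := ((Commute.refl (gen w v 0 * gen w v 1)).zpow_right m).eq
  rw [h1] at h3
  rw [zpow_one, h3] at h2
  have h4 : (gen w v 0 * gen w v 1) ^ (2 : ℤ) = 1 := by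
    have := mul_left_cancel h2
    rw [zpow_neg_one, eq_inv_iff_mul_eq_one] at this
    rw [zpow_two, this]
  have := gen_mul_zpow_eq_one hw hv hk hn h4
  omega

theorem zpow_mul_gen_zero_mul_zpow (i j : ℤ) :
    (gen w v 0 * gen w v 1) ^ i * (gen w v 0 * (gen w v 0 * gen w v 1) ^ j) =
      gen w v 0 * (gen w v 0 * gen w v 1) ^ (j - i) := by
  rw [← mul_assoc, gen_zero_mul_zpow, mul_assoc, ← zpow_add, neg_add_eq_sub]

variable (w v) in
/-- The powers of `b_1 a_1`. -/
def rotation (i : ℤ) : TreeAut := (gen w v 0 * gen w v 1) ^ i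

variable (w v) in
/-- The homomorphism from the infinite dihedral group onto `K(w, v)`, for `k = n = 1`. -/
def dihedralHom : DihedralGroup 0 →* TreeAut :=
  MonoidHom.mk' (fun x => match x with
    | .r i => rotation w v i
    | .sr i => gen w v 0 * rotation w v i) (by
    -- The indices of `DihedralGroup 0` lie in `ZMod 0`, which is `ℤ` by definition; the four
    -- product rules are therefore proved over `ℤ`.
    have h1 : ∀ i j : ℤ, rotation w v (i + j) = rotation w v i * rotation w v j :=
      fun i j => zpow_add _ i j
    have h2 : ∀ i j : ℤ, gen w v 0 * rotation w v (j - i) =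
        rotation w v i * (gen w v 0 * rotation w v j) :=
      fun i j => (zpow_mul_gen_zero_mul_zpow i j).symm
    have h3 : ∀ i j : ℤ, gen w v 0 * rotation w v (i + j) =
        gen w v 0 * rotation w v i * rotation w v j := fun i j => by rw [h1, mul_assoc]
    have h4 : ∀ i j : ℤ, rotation w v (j - i) =
        gen w v 0 * rotation w v i * (gen w v 0 * rotation w v j) := fun i j => by
      rw [mul_assoc, ← h2, ← mul_assoc, gen_mul_self, one_mul]
    rintro (i | i) (j | j)
    · exact h1 i j
    · exact h2 i j
    · exact h3 i j
    · exact h4 i j)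

theorem dihedralHom_injective (hw : w ≠ []) (hv : v ≠ []) (hk : w.length = 1)
    (hn : v.length = 1) : Function.Injective (dihedralHom w v) := by
  rw [injective_iff_map_eq_one]
  rintro (i | i) h
  · rw [show i = 0 from gen_mul_zpow_eq_one hw hv hk hn h]; rfl
  · exact absurd h (gen_zero_mul_zpow_ne_one hw hv hk hn i)

theorem range_dihedralHom (hw : w ≠ []) (hk : w.length = 1) (hn : v.length = 1) :
    (dihedralHom w v).range = kneadingGroup w v := by
  have h0 : gen w v 0 ∈ kneadingGroup w v := gen_zero_mem hw
  have h1 : gen w v 1 ∈ kneadingGroup w v := gen_mem (by omega)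
  have hr : ∀ i : ℤ, rotation w v i ∈ kneadingGroup w v := fun i => zpow_mem (mul_mem h0 h1) i
  refine le_antisymm ?_ ?_
  · rintro _ ⟨i | i, rfl⟩
    · exact hr i
    · exact mul_mem h0 (hr i)
  · rw [kneadingGroup_eq, Subgroup.closure_le]
    rintro _ ⟨m, hm, rfl⟩
    obtain rfl | rfl : m = 0 ∨ m = 1 := by omega
    · exact ⟨.sr (0 : ℤ), mul_eq_left.2 (zpow_zero _)⟩
    · refine ⟨.sr (1 : ℤ), ?_⟩
      have : gen w v 0 * rotation w v 1 = gen w v 1 := by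
        rw [rotation, zpow_one, ← mul_assoc, gen_mul_self, one_mul]
      exact this

theorem exists_eq_zpow (hw : w ≠ []) (hk : w.length = 1) (hn : v.length = 1) {g : TreeAut}
    (hg : g ∈ kneadingGroup w v) : ∃ i : ℤ, g = (gen w v 0 * gen w v 1) ^ i ∨
      g = gen w v 0 * (gen w v 0 * gen w v 1) ^ i := by
  rw [← range_dihedralHom hw hk hn] at hg
  obtain ⟨i | i, rfl⟩ := hg
  · exact ⟨i, Or.inl rfl⟩
  · exact ⟨i, Or.inr rfl⟩

/-- For `k = n = 1`, only the identity acts trivially on a subtree of the first level. -/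
theorem eq_one_of_sec_eq_one (hw : w ≠ []) (hv : v ≠ []) (hk : w.length = 1)
    (hn : v.length = 1) {g : TreeAut} (hg : g ∈ kneadingGroup w v) (hf : flips g = false)
    {x : Bool} (hx : sec g x = 1) : g = 1 := by
  have hodd : ∀ j : ℤ, flips ((gen w v 0 * gen w v 1) ^ (2 * j + 1)) = true := fun j => by
    rw [zpow_add_one, flips_mul, (sq_zpow j hw hv hk hn false).1, flips_gen_mul hw hk hn]
    rfl
  obtain ⟨i, rfl | rfl⟩ := exists_eq_zpow hw hk hn hg
  · obtain ⟨j, hj⟩ := Int.even_or_odd' i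
    rcases hj with hj | hj
    · obtain ⟨-, e, he, hs⟩ := sq_zpow j hw hv hk hn x
      rw [hj, hs] at hx
      have := gen_mul_zpow_eq_one hw hv hk hn hx
      have hj0 : j = 0 := by rcases he with rfl | rfl <;> omega
      rw [hj, hj0, mul_zero, zpow_zero]
    · rw [hj, hodd] at hf
      exact absurd hf (by simp)
  · exfalso
    obtain ⟨j, hj⟩ := Int.even_or_odd' i
    rcases hj with hj | hj
    · rw [hj, flips_mul, (sq_zpow j hw hv hk hn false).1, flips_gen_zero hw] at hf
      exact absurd hf (by simp)
    · obtain ⟨-, e, -, hs⟩ := sq_zpow j hw hv hk hn x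
      -- Rewritten this way, the reflection visibly has reflections as its sections, and no
      -- reflection is trivial.
      have he : gen w v 0 * (gen w v 0 * gen w v 1) ^ (2 * j + 1) =
          gen w v 1 * (gen w v 0 * gen w v 1) ^ (2 * j) := by
        rw [add_comm, zpow_add, zpow_one, ← mul_assoc, ← mul_assoc, gen_mul_self, one_mul]
      have h1f : flips (gen w v 1) = false := flips_gen one_ne_zero (by omega)
      rw [hj, he, sec_mul, h1f, Bool.xor_false, hs] at hx
      obtain ⟨z, h1, h2, -, -⟩ := exists_sec_sq hw hv hk hn
      obtain rfl | rfl : x = z ∨ x = !z := by cases x <;> cases z <;> simp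
      · rw [h1] at hx
        exact gen_zero_mul_zpow_ne_one hw hv hk hn _ hx
      · have e1 : gen w v 1 = gen w v 0 * (gen w v 0 * gen w v 1) ^ (1 : ℤ) := by
          rw [zpow_one, ← mul_assoc, gen_mul_self, one_mul]
        rw [h2, e1, mul_assoc, ← e1, ← zpow_add] at hx
        exact gen_zero_mul_zpow_ne_one hw hv hk hn _ hx

/-- Either branching property would supply a nontrivial element of `K` acting only below the letter
`0`, against `eq_one_of_sec_eq_one`. -/
theorem infiniteDihedral_not_weaklyBranch (hw : w ≠ []) (hv : v ≠ []) (hk : w.length = 1)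
    (hn : v.length = 1) :
    Nonempty (kneadingGroup w v ≃* DihedralGroup 0) ∧ ¬ IsWeaklyBranch (kneadingGroup w v) ∧
      ∀ H : Subgroup TreeAut, ¬ IsRegularWeaklyBranchOn (kneadingGroup w v) H := by
  refine ⟨⟨?_⟩, ?_, ?_⟩
  · exact (MulEquiv.subgroupCongr (range_dihedralHom hw hk hn).symm).trans
      (MonoidHom.ofInjective (dihedralHom_injective hw hv hk hn)).symm
  · rintro ⟨-, h⟩
    obtain ⟨g, hg, hg1, hfix⟩ := h [false]
    have hfix' : ∀ u, g.toEquiv (true :: u) = true :: u := fun u =>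
      hfix _ (by simp [List.cons_prefix_cons])
    have hf : flips g = false := by
      have := hfix' []
      rw [apply_cons] at this
      simpa using (List.cons.inj this).1
    exact hg1 (eq_one_of_sec_eq_one hw hv hk hn hg hf (eq_of_apply_cons (s := 1) hfix'))
  · intro H hH
    obtain ⟨h, hh, h1⟩ := H.bot_or_exists_ne_one.resolve_left hH.ne_bot
    have hp : pair h 1 ∈ geomSquare H :=
      mem_geomSquare.2 ⟨by simp, by simpa using hh, by simp⟩
    have := eq_one_of_sec_eq_one hw hv hk hn (hH.le (hH.geomSquare_le hp)) (flips_pair _ _)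
      (x := true) (by simp)
    apply h1
    rw [← sec_pair_false h 1, this, sec_one]

end kneading

end Kneading

theorem mainTheorem10 (w v : List Bool) (k n : ℕ) (hk : w.length = k) (hn : v.length = n)
    (hw : w ≠ []) (hv : v ≠ []) (hlast : w.getLast hw ≠ v.getLast hv) :
    -- `k, n ≥ 2`, or `k ≥ 3` and `n = 1`
    ((2 ≤ k ∧ 2 ≤ n) ∨ (3 ≤ k ∧ n = 1) →
      IsRegularBranchOn (kneadingGroup w v)
        ⁅kneadingGroup w v, kneadingGroup w v⁆ ∧
      QuotientIso (kneadingGroup w v)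
        ⁅kneadingGroup w v, kneadingGroup w v⁆
        (Multiplicative (Fin (k + n) → ZMod 2)) ∧
      GeneratesQuotient (kneadingGroup w v)
        ⁅kneadingGroup w v, kneadingGroup w v⁆
        ({g | ∃ i, 1 ≤ i ∧ i ≤ n ∧ g = genA w v i} ∪
          {g | ∃ j, 1 ≤ j ∧ j ≤ k ∧ g = genB w v j}) ∧
      QuotientIso ⁅kneadingGroup w v, kneadingGroup w v⁆
        (geomSquare ⁅kneadingGroup w v, kneadingGroup w v⁆)
        (Multiplicative (Fin (k + n - 1) → ZMod 2)) ∧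
      GeneratesQuotient ⁅kneadingGroup w v, kneadingGroup w v⁆
        (geomSquare ⁅kneadingGroup w v, kneadingGroup w v⁆)
        ({g | ∃ j, 2 ≤ j ∧ j ≤ k ∧ g = rcomm (genB w v 1) (genB w v j)} ∪
          {g | ∃ i, 1 ≤ i ∧ i ≤ n ∧
            g = rcomm (genB w v 1) (genA w v i)})) ∧
    -- `k = 2` and `n = 1`
    (k = 2 ∧ n = 1 →
      IsRegularBranchOn (kneadingGroup w v) (subgroupL₂₁ w v) ∧
      QuotientIso ⁅kneadingGroup w v, kneadingGroup w v⁆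
        (subgroupL₂₁ w v) (Multiplicative (Fin 2 → ZMod 2)) ∧
      GeneratesQuotient ⁅kneadingGroup w v, kneadingGroup w v⁆
        (subgroupL₂₁ w v)
        {rcomm (genB w v 1) (genB w v 2),
          rcomm (genB w v 2) (genA w v 1)} ∧
      QuotientIso (subgroupL₂₁ w v)
        (geomSquare (subgroupL₂₁ w v)) (Multiplicative (ZMod 4 × ZMod 2)) ∧
      GeneratesQuotient (subgroupL₂₁ w v)
        (geomSquare (subgroupL₂₁ w v))
        {elemX w v, rconj (elemX w v) (genA w v 1)} ∧
      elemX w v ^ 4 ∈ geomSquare (subgroupL₂₁ w v) ∧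
      rconj (elemX w v) (genA w v 1) ^ 4 ∈
        geomSquare (subgroupL₂₁ w v) ∧
      elemX w v ^ 2 * rconj (elemX w v ^ 2) (genA w v 1) ∈
        geomSquare (subgroupL₂₁ w v)) ∧
    -- `k = 1` and `n ≥ 2`
    (k = 1 ∧ 2 ≤ n →
      IsRegularBranchOn (kneadingGroup w v) (subgroupL₁ w v) ∧
      QuotientIso ⁅kneadingGroup w v, kneadingGroup w v⁆
        (subgroupL₁ w v) (Multiplicative (ZMod 2)) ∧
      GeneratesQuotient ⁅kneadingGroup w v, kneadingGroup w v⁆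
        (subgroupL₁ w v) {rcomm (genA w v n) (genB w v 1)} ∧
      QuotientIso (subgroupL₁ w v)
        (geomSquare (subgroupL₁ w v))
        (Multiplicative (ZMod 4 × (Fin (n - 2) → ZMod 2))) ∧
      GeneratesQuotient (subgroupL₁ w v)
        (geomSquare (subgroupL₁ w v))
        {g | ∃ i, 1 ≤ i ∧ i < n ∧ g = rcomm (genA w v i) (genB w v 1)} ∧
      HasOrderMod (geomSquare (subgroupL₁ w v))
        (rcomm (genA w v 1) (genB w v 1)) 4 ∧
      ∀ i, 2 ≤ i → i < n →
        HasOrderMod (geomSquare (subgroupL₁ w v))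
          (rcomm (genA w v i) (genB w v 1)) 2) ∧
    -- `k = n = 1`
    (k = 1 ∧ n = 1 →
      Nonempty (kneadingGroup w v ≃* DihedralGroup 0) ∧
      ¬ IsWeaklyBranch (kneadingGroup w v) ∧
      ∀ H : Subgroup TreeAut,
        ¬ IsRegularWeaklyBranchOn (kneadingGroup w v) H) := by
  subst hk hn
  refine ⟨fun h => ?_, fun ⟨h1, h2⟩ => regularBranch_subgroupL₂₁ hw hv h1 h2,
    fun ⟨h1, h2⟩ => regularBranch_subgroupL₁ hw hv h1 h2,
    fun ⟨h1, h2⟩ => infiniteDihedral_not_weaklyBranch hw hv h1 h2⟩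
  obtain ⟨h1, h2, h3⟩ := regularBranch_commutator hw hv h
  obtain ⟨h4, h5⟩ := abelianization_kneadingGroup hw hv
  exact ⟨h1, h4, h5, h2, h3⟩
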